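/- Let $M$ be a (finite-dimensional, Hausdorff, second countable) smooth manifold, $\mathbb T^n=\mathbb R^n/\mathbb Z^n$, and $\pi:X\to M$ a smooth principal $\mathbb T^n$-bundle. Let $\{M_\alpha\}$ be an open cover of $M$ whose non-empty twofold overlaps $M_{\alpha\beta}=M_\alpha\cap M_\beta$ (including $M_{\alpha\alpha}=M_\alpha$) are simply connected, and over which $X$ is trivialized, with fibre coordinates $\theta_\alpha$ (real vectors modulo $\mathbb Z^n$) on $X_\alpha=\pi^{-1}(M_\alpha)$ and smooth gluing functions $\lambda_{\alpha\beta}:M_{\alpha\beta}\to\mathbb R^n$, $\lambda_{\beta\alpha}=-\lambda_{\alpha\beta}$, $\theta_\alpha-\theta_\beta=-\lambda_{\alpha\beta}$ modulo $\mathbb Z^n$. Let $\Theta=(\Theta_I)$ be a connection on $X$, with $\Theta|_{X_\alpha}=d\theta_\alpha+A_\alpha$, $A_\alpha$ an $\mathbb R^n$-valued $1$-form on $M_\alpha$. Let a gerbe with connection on $X$ relative to the cover $\{X_\alpha\}$ be given: unitary line bundles with connection $L_{\alpha\beta}$ on $X_{\alpha\beta}=X_\alpha\cap X_\beta$, flat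 isomorphisms $L_{\alpha\beta}\cong L_{\beta\alpha}^{*}$ (symmetric in $\alpha,\beta$), flat unit sections of $L_{\alpha\beta}\otimes L_{\beta\gamma}\otimes L_{\gamma\alpha}$ on threefold overlaps satisfying the cocycle condition on fourfold overlaps, and $2$-forms $B_\alpha$ on $X_\alpha$ such that $B_\alpha-B_\beta$ is the curvature of $L_{\alpha\beta}$ (that is, $B_\alpha-B_\beta=dA$ where $\nabla e=2\pi i\,A\,e$ in any local unit frame $e$). Assume that every $B_\alpha$ is invariant under the action of $\mathbb T^n$. Then the following hold (summation over repeated indices $I,J$). 1. (Reduction.) There are smooth forms $B_{j\alpha}$ of degree $j=0,1,2$ on $M_\alpha$, with $B_{0\alpha}^{IJ}=-B_{0\alpha}^{JI}$, such that $$B_\alpha=B_{2\alpha}+B_{1\alpha}^I\wedge\Theta_I+\tfrac12B_{0\alpha}^{IJ}\,\Theta_I\wedge\Theta_J ,$$ and there are skew-symmetric integral matrices $m_{\alpha\beta}=-m_{\beta\alpha}$, with $m_{\alpha\beta}+m_{\beta\gamma}+m_{\gamma\alpha}=0$ on non-empty threefold overlaps, and smooth functions $\tilde h_{\alpha\beta}=-\tilde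 h_{\beta\alpha}:M_{\alpha\beta}\to\mathbb R^n$ such that on $M_{\alpha\beta}$ $$B_{0\alpha}-B_{0\beta}=m_{\alpha\beta},\qquad B_{1\alpha}-B_{1\beta}=d\tilde h_{\alpha\beta}+m_{\alpha\beta}\bigl(A_\beta-\tfrac12d\lambda_{\beta\alpha}\bigr).$$ 2. (Affine torus bundle.) These data can be chosen so that they define a smooth affine $\mathbb T^n\times\mathbb T^n$-bundle $p:Y\to M$, trivial over each $M_\alpha$ with fibre coordinates $(\tilde\theta_\alpha,\theta_\alpha)$, and glued over $M_{\alpha\beta}$ by $$\begin{pmatrix}\tilde\theta_\alpha+\frac12\tilde h_{\alpha\beta}\\ \theta_\alpha+\frac12\lambda_{\alpha\beta}\end{pmatrix}=\begin{pmatrix}1&m_{\alpha\beta}\\0&1\end{pmatrix}\begin{pmatrix}\tilde\theta_\beta+\frac12\tilde h_{\beta\alpha}\\ \theta_\beta+\frac12\lambda_{\beta\alpha}\end{pmatrix}\pmod{\mathbb Z^{2n}} .$$ The total space $Y$ maps smoothly to $X$ over $M$ by $(\tilde\theta_\alpha,\theta_\alpha)\mapsto\theta_\alpha$. 3. (Affine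 connection.) On $Y_\alpha=p^{-1}(M_\alpha)$ there are smooth $\mathbb R^n$-valued $1$-forms $\tilde\Theta_\alpha=d\tilde\theta_\alpha+B_{1\alpha}$ and $\Theta_\alpha=d\theta_\alpha+A_\alpha$, and on twofold overlaps $$\begin{pmatrix}\tilde\Theta_\alpha\\ \Theta_\alpha\end{pmatrix}=\begin{pmatrix}1&m_{\alpha\beta}\\0&1\end{pmatrix}\begin{pmatrix}\tilde\Theta_\beta\\ \Theta_\beta\end{pmatrix}.$$ 4. (Global form.) There are smooth $1$-forms $\Theta_\#^I$ on the whole of $Y$ with $\Theta_\#^I|_{Y_\alpha}=\tilde\Theta_\alpha^I-B_{0\alpha}^{IJ}\Theta_{\alpha J}$ for every $\alpha$. -/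

import Mathlib

open Set
open scoped Manifold ContDiff Topology Matrix

universe u w

noncomputable section

namespace TorusGerbe

/-! ### Differential forms of degree one and two on manifolds without boundary -/

section Forms

variable (E : Type*) [NormedAddCommGroup E] [NormedSpace ℝ E]
  (M : Type*) [TopologicalSpace M] [ChartedSpace E M]

/-- A field of covectors on `M`; it is a differential form on an open set `U` if it is smooth
there (`SmoothOneFormOn`), and its values outside `U` are then irrelevant. -/
abbrev OneForm : Type _ := ∀ x : M, TangentSpace 𝓘(ℝ, E) x →L[ℝ] ℝ

/-- A field of bilinear forms on the tangent spaces of `M`. -/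
abbrev TwoForm : Type _ :=
  ∀ x : M, TangentSpace 𝓘(ℝ, E) x →L[ℝ] TangentSpace 𝓘(ℝ, E) x →L[ℝ] ℝ

variable {E M}

/-- The pull-back of a `1`-form under the inverse of the preferred chart at `x₀`. -/
def oneFormInChart (η : OneForm E M) (x₀ : M) : E → E →L[ℝ] ℝ := fun y =>
  (η ((extChartAt 𝓘(ℝ, E) x₀).symm y)).comp
    (mfderiv 𝓘(ℝ, E) 𝓘(ℝ, E) (extChartAt 𝓘(ℝ, E) x₀).symm y)

/-- The pull-back of a bilinear form under the inverse of the preferred chart at `x₀`. -/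
def twoFormInChart (B : TwoForm E M) (x₀ : M) : E → E →L[ℝ] E →L[ℝ] ℝ := fun y =>
  let D : E →L[ℝ] E := mfderiv 𝓘(ℝ, E) 𝓘(ℝ, E) (extChartAt 𝓘(ℝ, E) x₀).symm y
  let b : E →L[ℝ] E →L[ℝ] ℝ := B ((extChartAt 𝓘(ℝ, E) x₀).symm y)
  b.bilinearComp D D

/-- Smoothness of a `1`-form on an open set. -/
def SmoothOneFormOn (η : OneForm E M) (U : Set M) : Prop :=
  ∀ x ∈ U, ContDiffAt ℝ ∞ (oneFormInChart η x) (extChartAt 𝓘(ℝ, E) x x)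

/-- `B` is a smooth differential `2`-form on the open set `U`. -/
structure IsSmoothTwoFormOn (B : TwoForm E M) (U : Set M) : Prop where
  alternating : ∀ x ∈ U, ∀ v, B x v v = 0
  smooth : ∀ x ∈ U, ContDiffAt ℝ ∞ (twoFormInChart B x) (extChartAt 𝓘(ℝ, E) x x)

/-- The exterior derivative of a `1`-form, `dη (v, w) = ∂_v (η w) - ∂_w (η v)`, computed in the
preferred chart at `x` (which is also the chart that identifies the tangent space at `x`
with `E`). -/
def extDerivOne (η : OneForm E M) (x : M) (v w : TangentSpace 𝓘(ℝ, E) x) : ℝ :=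
  fderiv ℝ (oneFormInChart η x) (extChartAt 𝓘(ℝ, E) x x) v w
    - fderiv ℝ (oneFormInChart η x) (extChartAt 𝓘(ℝ, E) x x) w v

/-- Smoothness of a `U(1)`-valued function on an open set. -/
def SmoothCircleOn (f : M → Circle) (U : Set M) : Prop :=
  ContMDiffOn 𝓘(ℝ, E) 𝓘(ℝ, ℂ) ∞ (fun x => (f x : ℂ)) U

/-- The form `(2πi)⁻¹ f⁻¹ df = (2πi)⁻¹ d log f` of a `U(1)`-valued function. -/
def dLog (f : M → Circle) (x : M) (v : TangentSpace 𝓘(ℝ, E) x) : ℂ :=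
  let df : ℂ := mfderiv 𝓘(ℝ, E) 𝓘(ℝ, ℂ) (fun y => (f y : ℂ)) x v
  (2 * Real.pi * Complex.I)⁻¹ * ((f x : ℂ)⁻¹ * df)

end Forms

/-! ### Torus fibrations

The torus `ℝ^κ / ℤ^κ` enters through its linear coordinates, which are real vectors
modulo integral ones. -/

section Fibrations

/-- `v` and `w` represent the same point of `ℝ^κ / ℤ^κ`. -/
def EqModInt {κ : Type*} (v w : κ → ℝ) : Prop := ∃ k : κ → ℤ, ∀ i, v i = w i + k i

/-- The point of the torus `𝕋ⁿ = (ℝ/ℤ)ⁿ` with coordinates `θ`. -/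
def torusPt {n : ℕ} (θ : Fin n → ℝ) : Fin n → UnitAddCircle := fun i => (θ i : UnitAddCircle)

variable {E : Type*} [NormedAddCommGroup E] [NormedSpace ℝ E]
  {M : Type*} [TopologicalSpace M] [ChartedSpace E M]
  {F : Type*} [NormedAddCommGroup F] [NormedSpace ℝ F]
  {Y : Type*} [TopologicalSpace Y] [ChartedSpace F Y]
  {κ : Type*} [Fintype κ]

/-- `Φ` identifies the part of `p : Y → M` over `U` with `U × ℝ^κ / ℤ^κ`, as manifolds over `U`:
`Φ x w` is the point over `x` with fibre coordinates `w`. -/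
structure IsTorusChart (p : Y → M) (U : Set M) (Φ : M → (κ → ℝ) → Y) : Prop where
  proj_apply : ∀ x ∈ U, ∀ w, p (Φ x w) = x
  exists_coord : ∀ y, p y ∈ U → ∃ w, Φ (p y) w = y
  eq_iff : ∀ x ∈ U, ∀ w w', Φ x w = Φ x w' ↔ EqModInt w w'
  localDiffeo : IsLocalDiffeomorphOn (𝓘(ℝ, E).prod 𝓘(ℝ, κ → ℝ)) 𝓘(ℝ, F) ∞
    (fun q : M × (κ → ℝ) => Φ q.1 q.2) (U ×ˢ univ)

/-- `p : Y → M`, with the charts `Φ α` over the members `U α` of an open cover, is an affine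
torus bundle with linear parts `G α β ∈ GL(κ, ℤ)`: on each twofold overlap the fibre coordinates
are related by `w_α = G_{αβ} w_β + c_{αβ}` modulo `ℤ^κ`, for a smooth function `c_{αβ}` on the
overlap. -/
structure IsAffineTorusBundle [DecidableEq κ] {ι : Type*} (p : Y → M) (U : ι → Set M)
    (Φ : ι → M → (κ → ℝ) → Y) (G : ι → ι → Matrix κ κ ℤ) : Prop where
  isOpen : ∀ α, IsOpen (U α)
  cover : ⋃ α, U α = univ
  smooth_proj : ContMDiff 𝓘(ℝ, F) 𝓘(ℝ, E) ∞ p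
  chart : ∀ α, IsTorusChart (E := E) (F := F) p (U α) (Φ α)
  isUnit : ∀ α β, IsUnit (G α β)
  affine : ∀ α β, ∃ c : M → κ → ℝ, ContMDiffOn 𝓘(ℝ, E) 𝓘(ℝ, κ → ℝ) ∞ c (U α ∩ U β) ∧
    ∀ x ∈ U α ∩ U β, ∀ w,
      Φ β x w = Φ α x ((G α β).map (Int.cast : ℤ → ℝ) *ᵥ w + c x)

/-- In the chart `Φ` over `U`, the `1`-form `η` on `Y` is `dw_i + a`, where `w_i` is the `i`-th
fibre coordinate and `a` is a `1`-form on the base. -/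
def IsLocallyCoordPlus (U : Set M) (Φ : M → (κ → ℝ) → Y) (i : κ) (a : OneForm E M)
    (η : OneForm F Y) : Prop :=
  ∀ x ∈ U, ∀ w : κ → ℝ, ∀ (v : TangentSpace 𝓘(ℝ, E) x) (t : κ → ℝ),
    η (Φ x w) (mfderiv (𝓘(ℝ, E).prod 𝓘(ℝ, κ → ℝ)) 𝓘(ℝ, F)
      (fun q : M × (κ → ℝ) => Φ q.1 q.2) (x, w) (v, t)) = t i + a x v

end Fibrations

/-! ### Principal torus bundles -/

section Principal

variable (n : ℕ)
  (E : Type*) [NormedAddCommGroup E] [NormedSpace ℝ E]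
  (M : Type*) [TopologicalSpace M] [ChartedSpace E M]
  (E' : Type*) [NormedAddCommGroup E'] [NormedSpace ℝ E']
  (X : Type*) [TopologicalSpace X] [ChartedSpace E' X]
  [AddAction (Fin n → UnitAddCircle) X] (ι : Type*)

/-- A smooth principal `𝕋ⁿ`-bundle `π : X → M` with an open cover `U α` of `M`, local sections
`sec α` over `U α`, and hence fibre coordinates `θ_α` determined up to integers by
`x = θ_α + sec α (π x)`, and `ℝⁿ`-valued gluing functions `λ_{αβ}` on twofold overlaps,
skew-symmetric in `α, β`, such that `θ_α - θ_β = -λ_{αβ}` modulo integers. -/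
structure PrincipalTorusBundle where
  proj : X → M
  smooth_proj : ContMDiff 𝓘(ℝ, E') 𝓘(ℝ, E) ∞ proj
  smooth_action : ContMDiff (𝓘(ℝ, Fin n → ℝ).prod 𝓘(ℝ, E')) 𝓘(ℝ, E') ∞
    (fun q : (Fin n → ℝ) × X => torusPt q.1 +ᵥ q.2)
  proj_vadd : ∀ (t : Fin n → UnitAddCircle) (x : X), proj (t +ᵥ x) = proj x
  U : ι → Set M
  isOpen_U : ∀ α, IsOpen (U α)
  cover : ⋃ α, U α = univ
  sec : ι → M → X
  chart : ∀ α, IsTorusChart (E := E) (F := E') proj (U α)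
    (fun x (θ : Fin n → ℝ) => torusPt θ +ᵥ sec α x)
  lam : ι → ι → M → Fin n → ℝ
  smooth_lam : ∀ α β, ContMDiffOn 𝓘(ℝ, E) 𝓘(ℝ, Fin n → ℝ) ∞ (lam α β) (U α ∩ U β)
  lam_skew : ∀ α β, ∀ x ∈ U α ∩ U β, lam β α x = -lam α β x
  lam_spec : ∀ α β, ∀ x ∈ U α ∩ U β, sec α x = torusPt (lam α β x) +ᵥ sec β x

variable {n E M E' X ι}

/-- The point of `X` over `x` with coordinates `θ_α = θ`. -/
def PrincipalTorusBundle.coord (P : PrincipalTorusBundle n E M E' X ι) (α : ι) (x : M)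
    (θ : Fin n → ℝ) : X := torusPt θ +ᵥ P.sec α x

/-- The part of `X` over `U α`. -/
def PrincipalTorusBundle.patch (P : PrincipalTorusBundle n E M E' X ι) (α : ι) : Set X :=
  P.proj ⁻¹' P.U α

/-- The fundamental vector field `∂/∂θ_I` of the torus action. -/
def fundVec (I : Fin n) (x : X) : TangentSpace 𝓘(ℝ, E') x :=
  (mfderiv 𝓘(ℝ, Fin n → ℝ) 𝓘(ℝ, E') (fun θ : Fin n → ℝ => torusPt θ +ᵥ x) 0
    (Pi.single I 1 : Fin n → ℝ) : E')

/-- A connection on a principal `𝕋ⁿ`-bundle: invariant `1`-forms `Θ_I` on the total space with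
`Θ_I (∂/∂θ_J) = δ_{IJ}`. -/
structure TorusConnection (P : PrincipalTorusBundle n E M E' X ι) where
  form : Fin n → OneForm E' X
  smooth : ∀ I, SmoothOneFormOn (form I) univ
  invariant : ∀ I (t : Fin n → UnitAddCircle) (x : X) (v : TangentSpace 𝓘(ℝ, E') x),
    form I (t +ᵥ x) (mfderiv 𝓘(ℝ, E') 𝓘(ℝ, E') (fun y : X => t +ᵥ y) x v) = form I x v
  vertical : ∀ I J x, form I x (fundVec J x) = if I = J then 1 else 0

end Principal

/-! ### Gerbes with connection -/

section Gerbes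

variable {E : Type*} [NormedAddCommGroup E] [NormedSpace ℝ E]
  {X : Type*} [TopologicalSpace X] [ChartedSpace E X]

/-- A unitary line bundle with connection over the open set `W`, given by unit frames `e_i` over
the members of an open cover of `W`: `e_i = g_{ij} e_j` and `∇ e_i = 2πi A_i e_i`. -/
structure LineBundleWithConnection (W : Set X) where
  J : Type w
  dom : J → Set X
  isOpen_dom : ∀ i, IsOpen (dom i)
  cover : ⋃ i, dom i = W
  g : J → J → X → Circle
  smooth_g : ∀ i j, SmoothCircleOn (E := E) (g i j) (dom i ∩ dom j)
  cocycle : ∀ i j k, ∀ x ∈ dom i ∩ dom j ∩ dom k, g i j x * g j k x = g i k x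
  A : J → OneForm E X
  smooth_A : ∀ i, SmoothOneFormOn (A i) (dom i)
  gauge : ∀ i j, ∀ x ∈ dom i ∩ dom j, ∀ v, ((A i x v - A j x v : ℝ) : ℂ) = dLog (g i j) x v

/-- A gerbe with connection relative to an open cover `W α` of `X`.
* `L α β` is a line bundle with connection on `W α ∩ W β`;
* `r α β` is a flat isomorphism of `L α β` with the dual of `L β α`, that is, a flat unit section
  `σ` of `L α β ⊗ L β α`, written in local frames as `e_i ⊗ e_j = r_{ij} σ`;
* `f α β γ` is a flat unit section `τ` of `L α β ⊗ L β γ ⊗ L γ α`, written in local frames as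
  `e_i ⊗ e_j ⊗ e_k = f_{ijk} τ`, which satisfies the cocycle condition on fourfold overlaps;
* `B α` is a `2`-form on `W α`, and `B α - B β` is the curvature of `L α β`. -/
structure GerbeWithConnection {ι : Type*} (W : ι → Set X) where
  L : ∀ α β, LineBundleWithConnection.{w} (E := E) (W α ∩ W β)
  r : ∀ α β, (L α β).J → (L β α).J → X → Circle
  smooth_r : ∀ α β i j, SmoothCircleOn (E := E) (r α β i j) ((L α β).dom i ∩ (L β α).dom j)
  frame_r : ∀ α β i i' j j',
    ∀ x ∈ (L α β).dom i ∩ (L α β).dom i' ∩ ((L β α).dom j ∩ (L β α).dom j'),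
      r α β i' j' x = (L α β).g i' i x * (L β α).g j' j x * r α β i j x
  symm_r : ∀ α β i j, ∀ x ∈ (L α β).dom i ∩ (L β α).dom j, r β α j i x = r α β i j x
  flat_r : ∀ α β i j, ∀ x ∈ (L α β).dom i ∩ (L β α).dom j, ∀ v,
    (((L α β).A i x v + (L β α).A j x v : ℝ) : ℂ) = dLog (r α β i j) x v
  f : ∀ α β γ, (L α β).J → (L β γ).J → (L γ α).J → X → Circle
  smooth_f : ∀ α β γ i j k, SmoothCircleOn (E := E) (f α β γ i j k)
    ((L α β).dom i ∩ (L β γ).dom j ∩ (L γ α).dom k)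
  frame_f : ∀ α β γ i i' j j' k k',
    ∀ x ∈ (L α β).dom i ∩ (L α β).dom i' ∩ ((L β γ).dom j ∩ (L β γ).dom j') ∩
        ((L γ α).dom k ∩ (L γ α).dom k'),
      f α β γ i' j' k' x =
        (L α β).g i' i x * (L β γ).g j' j x * (L γ α).g k' k x * f α β γ i j k x
  flat_f : ∀ α β γ i j k, ∀ x ∈ (L α β).dom i ∩ (L β γ).dom j ∩ (L γ α).dom k, ∀ v,
    (((L α β).A i x v + (L β γ).A j x v + (L γ α).A k x v : ℝ) : ℂ) = dLog (f α β γ i j k) x v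
  cocycle_f : ∀ α β γ δ (i : (L α β).J) (j : (L β γ).J) (k : (L γ α).J) (l : (L γ δ).J)
      (p : (L δ α).J) (q : (L α γ).J) (s : (L δ β).J) (t : (L β δ).J) (x : X),
    x ∈ (L α β).dom i → x ∈ (L β γ).dom j → x ∈ (L γ α).dom k → x ∈ (L γ δ).dom l →
    x ∈ (L δ α).dom p → x ∈ (L α γ).dom q → x ∈ (L δ β).dom s → x ∈ (L β δ).dom t →
      f α β γ i j k x * f γ δ α l p q x * r δ β s t x =
        f β γ δ j l s x * f δ α β p i t x * r γ α k q x
  B : ι → TwoForm E X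
  smooth_B : ∀ α, IsSmoothTwoFormOn (B α) (W α)
  curvature : ∀ α β (i : (L α β).J), ∀ x ∈ (L α β).dom i, ∀ v w,
    B α x v w - B β x v w = extDerivOne ((L α β).A i) x v w

end Gerbes

/-! ### Invariant gerbe connections on a principal torus bundle -/

section Reduction

variable {n : ℕ}
  {E : Type*} [NormedAddCommGroup E] [NormedSpace ℝ E]
  {M : Type*} [TopologicalSpace M] [ChartedSpace E M]
  {E' : Type*} [NormedAddCommGroup E'] [NormedSpace ℝ E']
  {X : Type*} [TopologicalSpace X] [ChartedSpace E' X]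
  [AddAction (Fin n → UnitAddCircle) X] {ι : Type*}

/-- The gerbe connection `B_α` is invariant under the torus action, for every `α`. -/
def IsTorusInvariant (P : PrincipalTorusBundle n E M E' X ι)
    (𝒢 : GerbeWithConnection.{w} (E := E') P.patch) : Prop :=
  ∀ α (t : Fin n → UnitAddCircle), ∀ x ∈ P.patch α, ∀ v v' : TangentSpace 𝓘(ℝ, E') x,
    𝒢.B α (t +ᵥ x) (mfderiv 𝓘(ℝ, E') 𝓘(ℝ, E') (fun y : X => t +ᵥ y) x v)
      (mfderiv 𝓘(ℝ, E') 𝓘(ℝ, E') (fun y : X => t +ᵥ y) x v') = 𝒢.B α x v v'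

/-- The reduction to the base of a torus-invariant gerbe connection `B_α` on `X`, with respect to
a connection `Θ`:
* local connection forms `A_α` with `Θ = dθ_α + A_α`;
* forms `B_{jα}` on `U α` with `B_α = B_{2α} + B_{1α}^I ∧ Θ_I + ½ B_{0α}^{IJ} Θ_I ∧ Θ_J`;
* integral skew-symmetric matrices `m_{αβ}` and functions `h_{αβ}` on twofold overlaps (`h` is
  called `h̃` in formulas below) with `B_{0α} - B_{0β} = m_{αβ}` and
  `B_{1α} - B_{1β} = dh̃_{αβ} + m_{αβ} (A_β - ½ dλ_{βα})`. -/
structure Reduction (P : PrincipalTorusBundle n E M E' X ι) (Θ : TorusConnection P)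
    (𝒢 : GerbeWithConnection.{w} (E := E') P.patch) where
  A : ι → Fin n → OneForm E M
  smooth_A : ∀ α I, SmoothOneFormOn (A α I) (P.U α)
  connection_eq : ∀ α I, IsLocallyCoordPlus (P.U α) (P.coord α) I (A α I) (Θ.form I)
  B₀ : ι → M → Matrix (Fin n) (Fin n) ℝ
  smooth_B₀ : ∀ α I J, ContMDiffOn 𝓘(ℝ, E) 𝓘(ℝ, ℝ) ∞ (fun x => B₀ α x I J) (P.U α)
  B₀_skew : ∀ α, ∀ x ∈ P.U α, (B₀ α x)ᵀ = -B₀ α x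
  B₁ : ι → Fin n → OneForm E M
  smooth_B₁ : ∀ α I, SmoothOneFormOn (B₁ α I) (P.U α)
  B₂ : ι → TwoForm E M
  smooth_B₂ : ∀ α, IsSmoothTwoFormOn (B₂ α) (P.U α)
  decomposition : ∀ α, ∀ x ∈ P.patch α, ∀ v w : TangentSpace 𝓘(ℝ, E') x,
    𝒢.B α x v w =
      B₂ α (P.proj x) (mfderiv 𝓘(ℝ, E') 𝓘(ℝ, E) P.proj x v)
          (mfderiv 𝓘(ℝ, E') 𝓘(ℝ, E) P.proj x w)
      + ∑ I, (B₁ α I (P.proj x) (mfderiv 𝓘(ℝ, E') 𝓘(ℝ, E) P.proj x v) * Θ.form I x w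
          - B₁ α I (P.proj x) (mfderiv 𝓘(ℝ, E') 𝓘(ℝ, E) P.proj x w) * Θ.form I x v)
      + 1 / 2 * ∑ I, ∑ J, B₀ α (P.proj x) I J *
          (Θ.form I x v * Θ.form J x w - Θ.form I x w * Θ.form J x v)
  m : ι → ι → Matrix (Fin n) (Fin n) ℤ
  m_skew : ∀ α β, (m α β)ᵀ = -m α β
  m_symm : ∀ α β, m β α = -m α β
  m_cocycle : ∀ α β γ, (P.U α ∩ P.U β ∩ P.U γ).Nonempty → m α β + m β γ + m γ α = 0
  h : ι → ι → M → Fin n → ℝ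
  smooth_h : ∀ α β, ContMDiffOn 𝓘(ℝ, E) 𝓘(ℝ, Fin n → ℝ) ∞ (h α β) (P.U α ∩ P.U β)
  h_skew : ∀ α β, ∀ x ∈ P.U α ∩ P.U β, h β α x = -h α β x
  gluing_B₀ : ∀ α β, ∀ x ∈ P.U α ∩ P.U β, B₀ α x - B₀ β x = (m α β).map (Int.cast : ℤ → ℝ)
  gluing_B₁ : ∀ α β, ∀ x ∈ P.U α ∩ P.U β, ∀ (I : Fin n) (v : TangentSpace 𝓘(ℝ, E) x),
    B₁ α I x v - B₁ β I x v =
      (mfderiv 𝓘(ℝ, E) 𝓘(ℝ, Fin n → ℝ) (h α β) x v : Fin n → ℝ) I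
      + ∑ J, (m α β I J : ℝ) * (A β J x v
          - 1 / 2 * (mfderiv 𝓘(ℝ, E) 𝓘(ℝ, Fin n → ℝ) (P.lam β α) x v : Fin n → ℝ) J)

variable {P : PrincipalTorusBundle n E M E' X ι} {Θ : TorusConnection P}
  {𝒢 : GerbeWithConnection.{w} (E := E') P.patch}

/-- The matrix with blocks `1, m_{αβ}, 0, 1`; the first block of coordinates is `θ̃`, the second
is `θ`. -/
def Reduction.G (R : Reduction P Θ 𝒢) (α β : ι) : Matrix (Fin n ⊕ Fin n) (Fin n ⊕ Fin n) ℤ :=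
  Matrix.fromBlocks 1 (R.m α β) 0 1

/-- The column `(h̃_{αβ}, λ_{αβ})`. -/
def Reduction.shift (R : Reduction P Θ 𝒢) (α β : ι) (x : M) : Fin n ⊕ Fin n → ℝ :=
  Sum.elim (R.h α β x) (P.lam α β x)

/-- The column `(B_{1α}, A_α)` of local connection forms. -/
def Reduction.potential (R : Reduction P Θ 𝒢) (α : ι) : Fin n ⊕ Fin n → OneForm E M :=
  Sum.elim (R.B₁ α) (R.A α)

end Reduction

end TorusGerbe

end

/-!
The theorem rests on the holonomy of the line bundles `L α β` around the circles of the torus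
action. For `y` over `U α ∩ U β` let `H^I_{αβ}(y)` be the holonomy of `L α β` around the orbit of
the `I`-th circle through `y` (`fibreHol`).

*Variation.* Parallel transport along a moving curve changes by the curvature, so for loops moved
by translation `(2πi)⁻¹ d log H^I_{αβ} = (B_α - B_β)(·, ∂/∂θ_I)`; here the invariance of the
`2`-forms makes the integrand constant around the loop (`hasDLogWithinAt_hol`,
`hasDLogWithinAt_fibreHol`). The duality of `L α β` and `L β α` and the flat sections of the triple
products give `H_{αβ} H_{βα} = 1` and `H_{αβ} H_{βγ} = H_{αγ}` (`hol_mul_hol_swap`,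
`hol_mul_hol_mul_hol`).

*Reduction.* The invariant form `B_α` is determined by its values along the section `θ_α = 0`.
Evaluated there on fundamental vector fields and on horizontal lifts it gives `B_{0α}`, `B_{1α}`
and `B_{2α}` (`bilinAt_eq_red`). Along a fibre of `X`, the variation formula says that `H^I_{αβ}` is
an exponential of an affine function with linear part given by `B_{0α} - B_{0β}`
(`fibreHol_vadd`). As `H^I_{αβ}` is a function on the torus, this matrix is integral, hence constant
over a connected overlap: it is `m_{αβ}`. Its skew-symmetry and cocycle condition are inherited
from `B_{0α}`.

*The functions `h̃`.* Over a simply connected overlap, `H^I_{αβ}` along the section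
`θ_α = -½ λ_{αβ}` has a continuous real logarithm `h̃^I_{αβ}` (`exists_isHolLog`). This section,
half-way between `θ_α = 0` and `θ_β = 0`, is the same for `(α, β)` and `(β, α)`, so `h̃_{αβ}` can be
chosen skew-symmetric; this is also what produces the term `-½ dλ_{βα}`. By the variation formula
`dh̃^I_{αβ}` is `B_α - B_β` contracted with `∂/∂θ_I` along the section. It follows that `h̃` is
smooth, and expanding the contraction in the reduced forms gives the gluing law of `B_{1α}`
(`exists_reduction`).

*The bundle `Y`.* Solving the symmetric gluing relation for the `α`-th coordinates gives an affine
map `w ↦ G_{αβ} w + c_{αβ}`, where `c_{αβ} = -(h̃_{αβ} + ½ m_{αβ} λ_{αβ}, λ_{αβ})`. The cocycle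
condition for these maps modulo integers is the relation `H_{αβ} H_{βγ} = H_{αγ}`, written at the
point `θ_α = 0`, together with the cocycle condition of `λ` (`Reduction.trans_cocycle`). The maps
therefore glue a smooth bundle of tori (`AffineCocycle.isAffineTorusBundle`).

*Connection forms.* In the `α`-th coordinates the forms `dw_i + a_{αi}` with `a_α = (B_{1α}, A_α)`
glue by `G_{αβ}` because `a_α + dc_{αβ} = G_{αβ} a_β`, which is the gluing law of `B_{1α}` and `A_α`
(`Reduction.potential_gluing`, `coordForm_gluing`). Since `B_{0α} - B_{0β} = m_{αβ}`, the
combinations `Θ̃_α - B_{0α} Θ_α` agree on overlaps (`exists_global_form`).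
-/

noncomputable section

set_option linter.unusedSectionVars false

namespace TorusGerbe

/-! ### Pull-backs of differential forms to normed spaces -/

section Pullback

variable {E : Type*} [NormedAddCommGroup E] [NormedSpace ℝ E]
  {X : Type*} [TopologicalSpace X] [ChartedSpace E X]
  {V : Type*} [NormedAddCommGroup V] [NormedSpace ℝ V]
  {V' : Type*} [NormedAddCommGroup V'] [NormedSpace ℝ V']

/-- The pull-back of a `1`-form under a map from a normed space. -/
def pullOne (η : OneForm E X) (g : V → X) (v : V) : V →L[ℝ] ℝ :=
  (η (g v)).comp (mfderiv 𝓘(ℝ, V) 𝓘(ℝ, E) g v)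

/-- The pull-back under a map from a normed space of a form of degree two, regarded as a bilinear
form. -/
def pullTwo (B : TwoForm E X) (g : V → X) (v : V) : V →L[ℝ] V →L[ℝ] ℝ :=
  let D : V →L[ℝ] E := mfderiv 𝓘(ℝ, V) 𝓘(ℝ, E) g v
  let b : E →L[ℝ] E →L[ℝ] ℝ := B (g v)
  b.bilinearComp D D

lemma pullOne_apply (η : OneForm E X) (g : V → X) (v u : V) :
    pullOne η g v u = η (g v) (mfderiv 𝓘(ℝ, V) 𝓘(ℝ, E) g v u) := rfl

lemma pullTwo_apply (B : TwoForm E X) (g : V → X) (v u u' : V) :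
    pullTwo B g v u u' = B (g v) (mfderiv 𝓘(ℝ, V) 𝓘(ℝ, E) g v u)
      (mfderiv 𝓘(ℝ, V) 𝓘(ℝ, E) g v u') := rfl

lemma pullOne_comp (η : OneForm E X) {g : V' → X} {k : V → V'} {v : V}
    (hg : MDifferentiableAt 𝓘(ℝ, V') 𝓘(ℝ, E) g (k v)) (hk : DifferentiableAt ℝ k v) :
    pullOne η (g ∘ k) v = (pullOne η g (k v)).comp (fderiv ℝ k v) := by
  ext u
  have h := mfderiv_comp v hg hk.mdifferentiableAt
  rw [pullOne_apply, h, mfderiv_eq_fderiv]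
  rfl

lemma pullTwo_comp (B : TwoForm E X) {g : V' → X} {k : V → V'} {v : V}
    (hg : MDifferentiableAt 𝓘(ℝ, V') 𝓘(ℝ, E) g (k v)) (hk : DifferentiableAt ℝ k v) :
    pullTwo B (g ∘ k) v = (pullTwo B g (k v)).bilinearComp (fderiv ℝ k v) (fderiv ℝ k v) := by
  ext u u'
  have h := mfderiv_comp v hg hk.mdifferentiableAt
  rw [pullTwo_apply, h, mfderiv_eq_fderiv]
  rfl

lemma pullOne_congr (η : OneForm E X) {g g' : V → X} {v : V} (h : g =ᶠ[𝓝 v] g') :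
    pullOne η g v = pullOne η g' v := by
  ext u
  rw [pullOne_apply, pullOne_apply, h.mfderiv_eq, h.eq_of_nhds]

lemma pullTwo_congr (B : TwoForm E X) {g g' : V → X} {v : V} (h : g =ᶠ[𝓝 v] g') :
    pullTwo B g v = pullTwo B g' v := by
  ext u u'
  rw [pullTwo_apply, pullTwo_apply, h.mfderiv_eq, h.eq_of_nhds]

lemma _root_.ContDiffAt.eventually_differentiableAt {F : Type*} [NormedAddCommGroup F]
    [NormedSpace ℝ F] {f : V → F} {v : V} (hf : ContDiffAt ℝ ∞ f v) :
    ∀ᶠ v' in 𝓝 v, DifferentiableAt ℝ f v' := by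
  filter_upwards [(hf.of_le (m := 1) (by exact_mod_cast le_top)).eventually (by simp)] with v' h
  exact h.differentiableAt (by simp)

lemma extChartAt_symm_comp_eventuallyEq {g : V → X} {v₀ : V} {x₀ : X} (hg : ContinuousAt g v₀)
    (h₀ : g v₀ ∈ (extChartAt 𝓘(ℝ, E) x₀).source) :
    g =ᶠ[𝓝 v₀] (extChartAt 𝓘(ℝ, E) x₀).symm ∘ (extChartAt 𝓘(ℝ, E) x₀ ∘ g) := by
  filter_upwards [hg.preimage_mem_nhds ((isOpen_extChartAt_source x₀).mem_nhds h₀)] with v hv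
  exact ((extChartAt 𝓘(ℝ, E) x₀).left_inv hv).symm

lemma mdifferentiableAt_extChartAt_symm [IsManifold 𝓘(ℝ, E) ∞ X] {x₀ : X} {z : E}
    (hz : z ∈ (extChartAt 𝓘(ℝ, E) x₀).target) :
    MDifferentiableAt 𝓘(ℝ, E) 𝓘(ℝ, E) (extChartAt 𝓘(ℝ, E) x₀).symm z :=
  ((contMDiffOn_extChartAt_symm (n := ∞) x₀ z hz).contMDiffAt
    ((isOpen_extChartAt_target x₀).mem_nhds hz)).mdifferentiableAt (by simp)

section
variable [IsManifold 𝓘(ℝ, E) ∞ X]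

lemma contDiffAt_extChartAt_comp {g : V → X} {v₀ : V} {x₀ : X}
    (hg : ContMDiffAt 𝓘(ℝ, V) 𝓘(ℝ, E) ∞ g v₀)
    (h₀ : g v₀ ∈ (extChartAt 𝓘(ℝ, E) x₀).source) :
    ContDiffAt ℝ ∞ (extChartAt 𝓘(ℝ, E) x₀ ∘ g) v₀ :=
  ((contMDiffAt_extChartAt' (by simpa using h₀)).comp v₀ hg).contDiffAt

/-- Near `v₀` the pull-back can be computed from the coordinate expression of the form in one fixed
chart. -/
lemma pullOne_eventuallyEq (η : OneForm E X) {g : V → X} {v₀ : V} {x₀ : X}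
    (hg : ContMDiffAt 𝓘(ℝ, V) 𝓘(ℝ, E) ∞ g v₀)
    (h₀ : g v₀ ∈ (extChartAt 𝓘(ℝ, E) x₀).source) :
    pullOne η g =ᶠ[𝓝 v₀] fun v =>
      (oneFormInChart η x₀ ((extChartAt 𝓘(ℝ, E) x₀ ∘ g) v)).comp
        (fderiv ℝ (extChartAt 𝓘(ℝ, E) x₀ ∘ g) v) := by
  have hk := contDiffAt_extChartAt_comp hg h₀
  filter_upwards [(extChartAt_symm_comp_eventuallyEq hg.continuousAt h₀).eventuallyEq_nhds,
    hk.eventually_differentiableAt,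
    hg.continuousAt.preimage_mem_nhds ((isOpen_extChartAt_source x₀).mem_nhds h₀)] with v h1 h2 h3
  rw [pullOne_congr η h1, pullOne_comp η (k := extChartAt 𝓘(ℝ, E) x₀ ∘ g)
    (mdifferentiableAt_extChartAt_symm ((extChartAt 𝓘(ℝ, E) x₀).map_source h3)) h2]
  rfl

lemma pullTwo_eventuallyEq (B : TwoForm E X) {g : V → X} {v₀ : V} {x₀ : X}
    (hg : ContMDiffAt 𝓘(ℝ, V) 𝓘(ℝ, E) ∞ g v₀)
    (h₀ : g v₀ ∈ (extChartAt 𝓘(ℝ, E) x₀).source) :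
    pullTwo B g =ᶠ[𝓝 v₀] fun v =>
      (twoFormInChart B x₀ ((extChartAt 𝓘(ℝ, E) x₀ ∘ g) v)).bilinearComp
        (fderiv ℝ (extChartAt 𝓘(ℝ, E) x₀ ∘ g) v) (fderiv ℝ (extChartAt 𝓘(ℝ, E) x₀ ∘ g) v) := by
  have hk := contDiffAt_extChartAt_comp hg h₀
  filter_upwards [(extChartAt_symm_comp_eventuallyEq hg.continuousAt h₀).eventuallyEq_nhds,
    hk.eventually_differentiableAt,
    hg.continuousAt.preimage_mem_nhds ((isOpen_extChartAt_source x₀).mem_nhds h₀)] with v h1 h2 h3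
  rw [pullTwo_congr B h1, pullTwo_comp B (k := extChartAt 𝓘(ℝ, E) x₀ ∘ g)
    (mdifferentiableAt_extChartAt_symm ((extChartAt 𝓘(ℝ, E) x₀).map_source h3)) h2]
  rfl

lemma _root_.ContDiffAt.bilinearComp_clm {b : V → E →L[ℝ] E →L[ℝ] ℝ} {D : V → V' →L[ℝ] E} {v : V}
    (hb : ContDiffAt ℝ ∞ b v) (hD : ContDiffAt ℝ ∞ D v) :
    ContDiffAt ℝ ∞ (fun v => (b v).bilinearComp (D v) (D v)) v := by
  have h1 : ContDiffAt ℝ ∞ (fun v => (b v).comp (D v)) v := hb.clm_comp hD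
  have hf : ContDiff ℝ ∞ (fun f : V' →L[ℝ] E →L[ℝ] ℝ => f.flip) := by
    exact ContinuousLinearEquiv.contDiff (𝕜 := ℝ) (E := V' →L[ℝ] E →L[ℝ] ℝ)
      (F := E →L[ℝ] V' →L[ℝ] ℝ) (n := ∞)
      (ContinuousLinearMap.flipₗᵢ ℝ V' E ℝ).toContinuousLinearEquiv
  have hf' : ContDiff ℝ ∞ (fun f : V' →L[ℝ] V' →L[ℝ] ℝ => f.flip) := by
    exact ContinuousLinearEquiv.contDiff (𝕜 := ℝ) (E := V' →L[ℝ] V' →L[ℝ] ℝ)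
      (F := V' →L[ℝ] V' →L[ℝ] ℝ) (n := ∞)
      (ContinuousLinearMap.flipₗᵢ ℝ V' V' ℝ).toContinuousLinearEquiv
  have h2 : ContDiffAt ℝ ∞ (fun v => ((b v).comp (D v)).flip) v :=
    hf.contDiffAt.comp v h1
  have h3 : ContDiffAt ℝ ∞ (fun v => (((b v).comp (D v)).flip).comp (D v)) v := h2.clm_comp hD
  exact hf'.contDiffAt.comp v h3

lemma SmoothOneFormOn.contDiffAt_pullOne {η : OneForm E X} {U : Set X} (hη : SmoothOneFormOn η U)
    {g : V → X} {v₀ : V} (hg : ContMDiffAt 𝓘(ℝ, V) 𝓘(ℝ, E) ∞ g v₀) (h₀ : g v₀ ∈ U) :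
    ContDiffAt ℝ ∞ (pullOne η g) v₀ := by
  have hs := mem_extChartAt_source (I := 𝓘(ℝ, E)) (g v₀)
  have hk := contDiffAt_extChartAt_comp hg hs
  refine ContDiffAt.congr_of_eventuallyEq ?_ (pullOne_eventuallyEq η hg hs)
  exact ((hη _ h₀).comp v₀ hk).clm_comp (hk.fderiv_right (by simp))

lemma IsSmoothTwoFormOn.contDiffAt_pullTwo {B : TwoForm E X} {U : Set X}
    (hB : IsSmoothTwoFormOn B U)
    {g : V → X} {v₀ : V} (hg : ContMDiffAt 𝓘(ℝ, V) 𝓘(ℝ, E) ∞ g v₀) (h₀ : g v₀ ∈ U) :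
    ContDiffAt ℝ ∞ (pullTwo B g) v₀ := by
  have hs := mem_extChartAt_source (I := 𝓘(ℝ, E)) (g v₀)
  have hk := contDiffAt_extChartAt_comp hg hs
  have hb : ContDiffAt ℝ ∞ (twoFormInChart B (g v₀) ∘ (extChartAt 𝓘(ℝ, E) (g v₀) ∘ g)) v₀ :=
    (hB.smooth _ h₀).comp v₀ hk
  have hD : ContDiffAt ℝ ∞ (fderiv ℝ (extChartAt 𝓘(ℝ, E) (g v₀) ∘ g)) v₀ :=
    hk.fderiv_right (by simp)
  exact (hb.bilinearComp_clm hD).congr_of_eventuallyEq (pullTwo_eventuallyEq B hg hs)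

/-- In a normed space, the exterior derivative commutes with pull-back: the second derivative of
the map drops out because it is symmetric. -/
lemma fderiv_clm_comp_sub {a : V' → V' →L[ℝ] ℝ} {k : V → V'} {v₀ : V}
    (ha : DifferentiableAt ℝ a (k v₀)) (hk : ContDiffAt ℝ ∞ k v₀) (v w : V) :
    fderiv ℝ (fun y => (a (k y)).comp (fderiv ℝ k y)) v₀ v w
      - fderiv ℝ (fun y => (a (k y)).comp (fderiv ℝ k y)) v₀ w v =
    fderiv ℝ a (k v₀) (fderiv ℝ k v₀ v) (fderiv ℝ k v₀ w)
      - fderiv ℝ a (k v₀) (fderiv ℝ k v₀ w) (fderiv ℝ k v₀ v) := by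
  have hk1 : DifferentiableAt ℝ k v₀ := hk.differentiableAt (by simp)
  have hk2 : DifferentiableAt ℝ (fderiv ℝ k) v₀ :=
    (hk.fderiv_right (m := ∞) (by simp)).differentiableAt (by simp)
  have h := (ha.hasFDerivAt.comp v₀ hk1.hasFDerivAt).clm_comp hk2.hasFDerivAt
  have hsymm : IsSymmSndFDerivAt ℝ k v₀ :=
    hk.isSymmSndFDerivAt (by simpa using WithTop.coe_le_coe.2 (le_top : (2 : ℕ∞) ≤ ⊤))
  have h' : fderiv ℝ (fun y => (a (k y)).comp (fderiv ℝ k y)) v₀ = _ := h.fderiv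
  rw [h']
  have := hsymm v w
  simp [this]

lemma mfderiv_extChartAt_comp {g : V → X} {v₀ : V} (hg : MDifferentiableAt 𝓘(ℝ, V) 𝓘(ℝ, E) g v₀)
    (v : V) :
    fderiv ℝ (extChartAt 𝓘(ℝ, E) (g v₀) ∘ g) v₀ v = mfderiv 𝓘(ℝ, V) 𝓘(ℝ, E) g v₀ v := by
  have h1 : MDifferentiableAt 𝓘(ℝ, E) 𝓘(ℝ, E) (extChartAt 𝓘(ℝ, E) (g v₀)) (g v₀) :=
    (contMDiffAt_extChartAt (n := ∞)).mdifferentiableAt (by simp)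
  have := mfderiv_comp v₀ h1 hg
  rw [mfderiv_extChartAt_self, mfderiv_eq_fderiv] at this
  rw [this]
  rfl

/-- The exterior derivative, defined in the preferred chart, evaluated on vectors in the image of
`dg`, is that of the pull-back along `g`. -/
lemma extDerivOne_mfderiv {η : OneForm E X} {g : V → X} {v₀ : V}
    (hη : ContDiffAt ℝ ∞ (oneFormInChart η (g v₀)) (extChartAt 𝓘(ℝ, E) (g v₀) (g v₀)))
    (hg : ContMDiffAt 𝓘(ℝ, V) 𝓘(ℝ, E) ∞ g v₀) (v w : V) :
    extDerivOne η (g v₀) (mfderiv 𝓘(ℝ, V) 𝓘(ℝ, E) g v₀ v) (mfderiv 𝓘(ℝ, V) 𝓘(ℝ, E) g v₀ w) =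
      fderiv ℝ (pullOne η g) v₀ v w - fderiv ℝ (pullOne η g) v₀ w v := by
  have hs := mem_extChartAt_source (I := 𝓘(ℝ, E)) (g v₀)
  have hk := contDiffAt_extChartAt_comp hg hs
  rw [(pullOne_eventuallyEq η hg hs).fderiv_eq,
    fderiv_clm_comp_sub (k := extChartAt 𝓘(ℝ, E) (g v₀) ∘ g) (hη.differentiableAt (by simp)) hk]
  have hd := hg.mdifferentiableAt (by simp)
  unfold extDerivOne
  rw [mfderiv_extChartAt_comp hd v, mfderiv_extChartAt_comp hd w]
  rfl

/-- A `1`-form is smooth at a point if its pull-back under a local diffeomorphism is. -/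
lemma contDiffAt_oneFormInChart_of_pullOne {η : OneForm E X} {g : V → X} {v₀ : V} {k : X → V}
    (hg : ContMDiffAt 𝓘(ℝ, V) 𝓘(ℝ, E) ∞ g v₀) (hk : ContMDiffAt 𝓘(ℝ, E) 𝓘(ℝ, V) ∞ k (g v₀))
    (hkg : k (g v₀) = v₀) (hgk : ∀ᶠ x in 𝓝 (g v₀), g (k x) = x)
    (hη : ContDiffAt ℝ ∞ (pullOne η g) v₀) :
    ContDiffAt ℝ ∞ (oneFormInChart η (g v₀)) (extChartAt 𝓘(ℝ, E) (g v₀) (g v₀)) := by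
  set e := extChartAt 𝓘(ℝ, E) (g v₀)
  set z₀ := e (g v₀)
  have hz : e.symm z₀ = g v₀ := extChartAt_to_inv (g v₀)
  have hz₀ : z₀ ∈ e.target := mem_extChartAt_target (g v₀)
  have hsm : ContMDiffAt 𝓘(ℝ, E) 𝓘(ℝ, E) ∞ e.symm z₀ :=
    (contMDiffOn_extChartAt_symm (n := ∞) (g v₀) z₀ hz₀).contMDiffAt
      ((isOpen_extChartAt_target (g v₀)).mem_nhds hz₀)
  have hK : ContDiffAt ℝ ∞ (k ∘ e.symm) z₀ :=
    (ContMDiffAt.comp z₀ (by rw [hz]; exact hk) hsm).contDiffAt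
  have hK0 : (k ∘ e.symm) z₀ = v₀ := by simp [hz, hkg]
  have hev : e.symm =ᶠ[𝓝 z₀] g ∘ (k ∘ e.symm) := by
    have : Filter.Tendsto e.symm (𝓝 z₀) (𝓝 (g v₀)) := by
      have := hsm.continuousAt.tendsto; rwa [hz] at this
    filter_upwards [this.eventually hgk] with z h using h.symm
  have hev2 : oneFormInChart η (g v₀) =ᶠ[𝓝 z₀] fun z =>
      (pullOne η g ((k ∘ e.symm) z)).comp (fderiv ℝ (k ∘ e.symm) z) := by
    have hgev : ∀ᶠ z in 𝓝 z₀, MDifferentiableAt 𝓘(ℝ, V) 𝓘(ℝ, E) g ((k ∘ e.symm) z) := by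
      have h1 : ∀ᶠ v in 𝓝 v₀, MDifferentiableAt 𝓘(ℝ, V) 𝓘(ℝ, E) g v := by
        have : ContMDiffAt 𝓘(ℝ, V) 𝓘(ℝ, E) 1 g v₀ := hg.of_le (by exact_mod_cast le_top)
        filter_upwards [(contMDiffAt_iff_contMDiffAt_nhds (by simp)).1 this] with v hv
        exact hv.mdifferentiableAt (by simp)
      have := hK.continuousAt.tendsto
      rw [hK0] at this
      exact this.eventually h1
    filter_upwards [hev.eventuallyEq_nhds, hK.eventually_differentiableAt, hgev] with z h1 h2 h3
    have : oneFormInChart η (g v₀) z = pullOne η e.symm z := rfl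
    rw [this, pullOne_congr η h1, pullOne_comp η h3 h2]
  refine ContDiffAt.congr_of_eventuallyEq ?_ hev2
  exact (ContDiffAt.comp z₀ (by rw [hK0]; exact hη) hK).clm_comp (hK.fderiv_right (by simp))

end
end Pullback

/-! ### Logarithmic derivatives of circle-valued functions -/

section DLog

variable {V : Type*} [NormedAddCommGroup V] [NormedSpace ℝ V]
  {V' : Type*} [NormedAddCommGroup V'] [NormedSpace ℝ V']

/-- The complex-valued form `2πi c ℓ`. -/
def twoPiIForm (c : ℂ) (ℓ : V →L[ℝ] ℝ) : V →L[ℝ] ℂ :=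
  (2 * Real.pi * Complex.I * c) • (Complex.ofRealCLM.comp ℓ)

lemma twoPiIForm_apply (c : ℂ) (ℓ : V →L[ℝ] ℝ) (v : V) :
    twoPiIForm c ℓ v = 2 * Real.pi * Complex.I * c * (ℓ v : ℂ) := by
  simp [twoPiIForm]

/-- `ℓ` is the derivative `(2πi)⁻¹ d log f` of the circle-valued function `f` at `v`
within `s`. -/
def HasDLogWithinAt (f : V → Circle) (ℓ : V →L[ℝ] ℝ) (s : Set V) (v : V) : Prop :=
  HasFDerivWithinAt (fun v => (f v : ℂ)) (twoPiIForm (f v) ℓ) s v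

variable {f f' : V → Circle} {ℓ ℓ' : V →L[ℝ] ℝ} {s : Set V} {v : V}

lemma HasDLogWithinAt.mono {t : Set V} (h : HasDLogWithinAt f ℓ s v) (hst : t ⊆ s) :
    HasDLogWithinAt f ℓ t v := HasFDerivWithinAt.mono h hst

lemma HasDLogWithinAt.mono_of_mem {t : Set V} (h : HasDLogWithinAt f ℓ t v)
    (hst : t ∈ 𝓝[s] v) : HasDLogWithinAt f ℓ s v := HasFDerivWithinAt.mono_of_mem_nhdsWithin h hst

lemma HasDLogWithinAt.congr' (h : HasDLogWithinAt f ℓ s v) (hf : f' =ᶠ[𝓝[s] v] f)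
    (hv : f' v = f v) : HasDLogWithinAt f' ℓ s v := by
  unfold HasDLogWithinAt at *
  rw [hv]
  exact h.congr_of_eventuallyEq (hf.mono fun x hx => by simp only [hx]) (by rw [hv])

lemma HasDLogWithinAt.congr_form (h : HasDLogWithinAt f ℓ s v) (hl : ℓ = ℓ') :
    HasDLogWithinAt f ℓ' s v := hl ▸ h

lemma HasDLogWithinAt.mul (h : HasDLogWithinAt f ℓ s v) (h' : HasDLogWithinAt f' ℓ' s v) :
    HasDLogWithinAt (fun v => f v * f' v) (ℓ + ℓ') s v := by
  have h1 : HasFDerivWithinAt (fun v => ((f v * f' v : Circle) : ℂ)) _ s v :=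
    HasFDerivWithinAt.mul h h'
  refine h1.congr_fderiv ?_
  ext u
  simp only [_root_.add_apply, _root_.smul_apply, twoPiIForm_apply,
    Circle.coe_mul, smul_eq_mul, Complex.ofReal_add]
  ring

lemma HasDLogWithinAt.inv (h : HasDLogWithinAt f ℓ s v) :
    HasDLogWithinAt (fun v => (f v)⁻¹) (-ℓ) s v := by
  have h1 := (Complex.conjCLE.toContinuousLinearMap.hasFDerivAt).comp_hasFDerivWithinAt v h
  have h2 : HasFDerivWithinAt (fun v => (((f v)⁻¹ : Circle) : ℂ)) _ s v :=
    h1.congr_of_eventuallyEq (Filter.Eventually.of_forall fun x =>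
      Circle.coe_inv_eq_conj (f x)) (Circle.coe_inv_eq_conj (f v))
  refine h2.congr_fderiv ?_
  ext u
  have h2 : (starRingEnd ℂ) 2 = 2 := map_ofNat _ 2
  simp [twoPiIForm_apply, ← Circle.coe_inv_eq_conj, h2]

lemma HasDLogWithinAt.div (h : HasDLogWithinAt f ℓ s v) (h' : HasDLogWithinAt f' ℓ' s v) :
    HasDLogWithinAt (fun v => f v / f' v) (ℓ - ℓ') s v := by
  simpa only [div_eq_mul_inv, sub_eq_add_neg] using h.mul h'.inv

lemma HasDLogWithinAt.const (c : Circle) : HasDLogWithinAt (fun _ : V => c) 0 s v :=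
  (hasFDerivWithinAt_const (c : ℂ) v s).congr_fderiv (by ext u; simp [twoPiIForm_apply])

lemma hasDLogWithinAt_exp {u : V → ℝ} (h : HasFDerivWithinAt u ℓ s v) :
    HasDLogWithinAt (fun v => Circle.exp (2 * Real.pi * u v)) ℓ s v := by
  have h1 : HasFDerivWithinAt (fun v => (2 * Real.pi * Complex.I) * ((u v : ℝ) : ℂ)) _ s v :=
    ((Complex.ofRealCLM.hasFDerivAt (x := u v)).comp_hasFDerivWithinAt v h).const_mul
      (2 * Real.pi * Complex.I : ℂ)
  have h2 : HasFDerivWithinAt (fun v => (Circle.exp (2 * Real.pi * u v) : ℂ)) _ s v :=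
    h1.cexp.congr_of_eventuallyEq (Filter.Eventually.of_forall fun x => by
      simp [Circle.coe_exp, mul_right_comm]) (by simp [Circle.coe_exp, mul_right_comm])
  refine h2.congr_fderiv ?_
  ext x
  simp [twoPiIForm_apply, Circle.coe_exp, mul_right_comm]
  ring

lemma HasDLogWithinAt.comp {k : V' → V} {D : V' →L[ℝ] V} {t : Set V'} {v' : V'}
    (h : HasDLogWithinAt f ℓ s (k v')) (hk : HasFDerivWithinAt k D t v') (hm : MapsTo k t s) :
    HasDLogWithinAt (fun v => f (k v)) (ℓ.comp D) t v' :=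
  (HasFDerivWithinAt.comp v' h hk hm).congr_fderiv (by ext u; simp [twoPiIForm_apply])

lemma eq_of_hasDLogWithinAt_zero {f : ℝ → Circle} {a b : ℝ}
    (h : ∀ t ∈ Icc a b, HasDLogWithinAt f 0 (Icc a b) t) {s t : ℝ} (hs : s ∈ Icc a b)
    (ht : t ∈ Icc a b) : f s = f t := by
  have hd : DifferentiableOn ℝ (fun t => (f t : ℂ)) (Icc a b) :=
    fun t ht => (h t ht).differentiableWithinAt
  have key : (f s : ℂ) = f t := by
    rcases (hs.1.trans hs.2).eq_or_lt with hab | hab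
    · subst hab; rw [Icc_self] at hs ht; rw [hs, ht]
    refine (convex_Icc a b).is_const_of_fderivWithin_eq_zero hd (fun x hx => ?_) hs ht
    have := HasFDerivWithinAt.fderivWithin (h x hx) (uniqueDiffOn_Icc hab x hx)
    rw [this]; ext; simp [twoPiIForm_apply]
  exact Circle.ext key

variable {E : Type*} [NormedAddCommGroup E] [NormedSpace ℝ E]
  {X : Type*} [TopologicalSpace X] [ChartedSpace E X]

lemma SmoothCircleOn.hasDLogWithinAt {f : X → Circle} {U : Set X}
    (hf : SmoothCircleOn (E := E) f U) (hU : IsOpen U) {g : V → X} {v : V}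
    (hg : MDifferentiableAt 𝓘(ℝ, V) 𝓘(ℝ, E) g v) (hv : g v ∈ U)
    (hl : ∀ u, (ℓ u : ℂ) = dLog f (g v) (mfderiv 𝓘(ℝ, V) 𝓘(ℝ, E) g v u)) :
    HasDLogWithinAt (fun v => f (g v)) ℓ s v := by
  have h1 : MDifferentiableAt 𝓘(ℝ, E) 𝓘(ℝ, ℂ) (fun x => (f x : ℂ)) (g v) :=
    ((hf (g v) hv).contMDiffAt (hU.mem_nhds hv)).mdifferentiableAt (by simp)
  have h2 := (h1.hasMFDerivAt.comp v hg.hasMFDerivAt).hasFDerivAt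
  have h3 : HasFDerivAt (fun v => (f (g v) : ℂ)) (twoPiIForm (f (g v)) ℓ) v := by
    refine h2.congr_fderiv ?_
    ext u
    have hpi : (2 * Real.pi * Complex.I : ℂ) ≠ 0 := Complex.two_pi_I_ne_zero
    have hne : (f (g v) : ℂ) ≠ 0 := Circle.coe_ne_zero _
    refine Eq.trans ?_ (twoPiIForm_apply (f (g v)) ℓ u).symm
    rw [hl u]
    have key : ∀ d : ℂ, 2 * Real.pi * Complex.I * (f (g v) : ℂ) *
        ((2 * Real.pi * Complex.I)⁻¹ * ((f (g v) : ℂ)⁻¹ * d)) = d := by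
      intro d
      rw [mul_assoc, mul_left_comm (f (g v) : ℂ), mul_inv_cancel_left₀ hne,
        mul_inv_cancel_left₀ hpi]
    exact (key _).symm
  exact h3.hasFDerivWithinAt

end DLog

/-! ### Parallel transport in line bundles with connection -/

section Transport

variable {E : Type*} [NormedAddCommGroup E] [NormedSpace ℝ E]
  {X : Type*} [TopologicalSpace X] [ChartedSpace E X] {W : Set X}

/-- A reflexive-transitive relation that holds locally holds globally on a preconnected space. -/
lemma rel_of_local {T : Type*} [TopologicalSpace T] [PreconnectedSpace T] {Q : T → T → Prop}
    (htrans : ∀ r s t, Q r s → Q s t → Q r t)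
    (hloc : ∀ t, ∀ᶠ s in 𝓝 t, Q t s ∧ Q s t) (s t : T) : Q s t := by
  have hcl : IsClopen {t | Q s t} := by
    constructor
    · rw [← closure_subset_iff_isClosed]
      intro t ht
      obtain ⟨t', h1, h2⟩ := (mem_closure_iff_frequently.1 ht).and_eventually (hloc t) |>.exists
      exact htrans _ _ _ h1 h2.2
    · rw [isOpen_iff_mem_nhds]
      intro t ht
      filter_upwards [hloc t] with t' h using htrans _ _ _ ht h.1
  have := hcl.eq_univ ⟨s, (hloc s).self_of_nhds.1⟩
  exact this.ge (mem_univ t)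

/-- A solution of the parallel transport equation along the curve `γ` over `[a, b]`, in terms of
its components in the local frames: the components `φ i` transform like the frames, and
`(2πi)⁻¹ d log φ i` is the pull-back of the connection form. -/
structure LineBundleWithConnection.IsTransport (L : LineBundleWithConnection.{w} (E := E) W)
    (γ : ℝ → X) (a b : ℝ) (φ : L.J → ℝ → Circle) : Prop where
  change : ∀ i j, ∀ t ∈ Icc a b, γ t ∈ L.dom i → γ t ∈ L.dom j → φ i t = L.g i j (γ t) * φ j t
  dlog : ∀ i, ∀ t ∈ Icc a b, γ t ∈ L.dom i →
    HasDLogWithinAt (φ i) (pullOne (L.A i) γ t) (Icc a b) t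

namespace LineBundleWithConnection

variable {L : LineBundleWithConnection.{w} (E := E) W} {γ : ℝ → X} {a b : ℝ}

lemma IsTransport.mono {φ : L.J → ℝ → Circle} (h : L.IsTransport γ a b φ) {a' b' : ℝ}
    (ha : a ≤ a') (hb : b' ≤ b) : L.IsTransport γ a' b' φ where
  change i j t ht := h.change i j t (Icc_subset_Icc ha hb ht)
  dlog i t ht hi := (h.dlog i t (Icc_subset_Icc ha hb ht) hi).mono (Icc_subset_Icc ha hb)

lemma exists_mem_dom (L : LineBundleWithConnection.{w} (E := E) W) {x : X} (hx : x ∈ W) :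
    ∃ i, x ∈ L.dom i := by
  rw [← L.cover] at hx; simpa using hx

variable {V : Type*} [NormedAddCommGroup V] [NormedSpace ℝ V]

lemma hasDLogWithinAt_g (L : LineBundleWithConnection.{w} (E := E) W) (i j : L.J) {g : V → X}
    {v : V} {s : Set V} (hg : MDifferentiableAt 𝓘(ℝ, V) 𝓘(ℝ, E) g v)
    (hi : g v ∈ L.dom i) (hj : g v ∈ L.dom j) :
    HasDLogWithinAt (fun v => L.g i j (g v)) (pullOne (L.A i) g v - pullOne (L.A j) g v) s v :=
  (L.smooth_g i j).hasDLogWithinAt ((L.isOpen_dom i).inter (L.isOpen_dom j)) hg ⟨hi, hj⟩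
    fun _ => L.gauge i j _ ⟨hi, hj⟩ _

/-- Transports over adjacent intervals glue once the second is rescaled by the constant that makes
the two agree at the common end point. -/
lemma IsTransport.glue {φ ψ : L.J → ℝ → Circle} {c : ℝ} (hφ : L.IsTransport γ a c φ)
    (hψ : L.IsTransport γ c b ψ) (hac : a ≤ c) (hcb : c ≤ b) (hc : γ c ∈ W) :
    ∃ χ, L.IsTransport γ a b χ := by
  obtain ⟨i₀, hi₀⟩ := L.exists_mem_dom hc
  set k : Circle := φ i₀ c / ψ i₀ c
  have hk : ∀ i, γ c ∈ L.dom i → φ i c = k * ψ i c := by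
    intro i hi
    rw [hφ.change i i₀ c ⟨hac, le_rfl⟩ hi hi₀, hψ.change i i₀ c ⟨le_rfl, hcb⟩ hi hi₀]
    simp only [k]
    rw [mul_left_comm, div_mul_cancel]
  have hdψ : ∀ i, ∀ t ∈ Icc c b, γ t ∈ L.dom i →
      HasDLogWithinAt (fun t => k * ψ i t) (pullOne (L.A i) γ t) (Icc c b) t := by
    intro i t ht hi
    exact ((HasDLogWithinAt.const k).mul (hψ.dlog i t ht hi)).congr_form (zero_add _)
  refine ⟨fun i t => if t ≤ c then φ i t else k * ψ i t, ⟨?_, ?_⟩⟩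
  · intro i j t ht hi hj
    by_cases h : t ≤ c
    · simp only [h, if_true]; exact hφ.change i j t ⟨ht.1, h⟩ hi hj
    · simp only [h, if_false]; rw [hψ.change i j t ⟨(not_le.1 h).le, ht.2⟩ hi hj, mul_left_comm]
  · intro i t ht hi
    have hsplit : Icc a b = Icc a c ∪ Icc c b := (Icc_union_Icc_eq_Icc hac hcb).symm
    have h1 : ∀ t ∈ Icc a c, γ t ∈ L.dom i → HasDLogWithinAt
        (fun t => if t ≤ c then φ i t else k * ψ i t) (pullOne (L.A i) γ t) (Icc a c) t := by
      intro t ht hi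
      refine (hφ.dlog i t ht hi).congr' ?_ (by simp [ht.2])
      filter_upwards [self_mem_nhdsWithin] with s hs using by simp [hs.2]
    have h2 : ∀ t ∈ Icc c b, γ t ∈ L.dom i → HasDLogWithinAt
        (fun t => if t ≤ c then φ i t else k * ψ i t) (pullOne (L.A i) γ t) (Icc c b) t := by
      intro t ht hi
      by_cases htc : t = c
      · subst htc
        refine (hdψ i t ht hi).congr' ?_ (by simp [hk i hi])
        filter_upwards [self_mem_nhdsWithin] with s hs
        by_cases hst : s ≤ t
        · have : s = t := le_antisymm hst hs.1
          simp [this, hk i hi]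
        · simp [hst]
      · have htc' : c < t := lt_of_le_of_ne ht.1 (Ne.symm htc)
        refine (hdψ i t ht hi).congr' ?_ (by simp [htc'])
        have : Ioi c ∈ 𝓝[Icc c b] t := mem_nhdsWithin_of_mem_nhds (Ioi_mem_nhds htc')
        filter_upwards [this] with s hs
        simp [mem_Ioi.1 hs]
    rcases lt_trichotomy t c with h | h | h
    · refine (h1 t ⟨ht.1, h.le⟩ hi).mono_of_mem ?_
      rw [hsplit, nhdsWithin_union]
      refine Filter.mem_sup.2 ⟨self_mem_nhdsWithin, ?_⟩
      have : (Iio c) ∈ 𝓝[Icc c b] t := mem_nhdsWithin_of_mem_nhds (Iio_mem_nhds h)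
      filter_upwards [this, self_mem_nhdsWithin] with s hs hs'
      exact absurd hs'.1 (not_le.2 hs)
    · subst h
      unfold HasDLogWithinAt
      rw [hsplit]
      exact HasFDerivWithinAt.union (h1 t ⟨ht.1, le_rfl⟩ hi) (h2 t ⟨le_rfl, ht.2⟩ hi)
    · refine (h2 t ⟨h.le, ht.2⟩ hi).mono_of_mem ?_
      rw [hsplit, nhdsWithin_union]
      refine Filter.mem_sup.2 ⟨?_, self_mem_nhdsWithin⟩
      have : (Ioi c) ∈ 𝓝[Icc a c] t := mem_nhdsWithin_of_mem_nhds (Ioi_mem_nhds h)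
      filter_upwards [this, self_mem_nhdsWithin] with s hs hs'
      exact absurd hs'.2 (not_le.2 hs)

variable [IsManifold 𝓘(ℝ, E) ∞ X]

/-- In a single frame, `∫ γ^* A_i` is a real logarithm of the transport. -/
lemma hasFDerivAt_integral_pullOne (L : LineBundleWithConnection.{w} (E := E) W)
    (hγ : ContMDiff 𝓘(ℝ, ℝ) 𝓘(ℝ, E) ∞ γ) {i : L.J} {s τ : ℝ}
    (h : ∀ x ∈ uIcc s τ, γ x ∈ L.dom i) :
    HasFDerivAt (fun τ => ∫ x in s..τ, pullOne (L.A i) γ x 1) (pullOne (L.A i) γ τ) τ := by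
  have hopen : IsOpen (γ ⁻¹' L.dom i) := (L.isOpen_dom i).preimage hγ.continuous
  have hcont : ContinuousOn (fun τ => pullOne (L.A i) γ τ 1) (γ ⁻¹' L.dom i) := by
    intro τ hτ
    have : ContDiffAt ℝ ∞ (pullOne (L.A i) γ) τ :=
      (L.smooth_A i).contDiffAt_pullOne hγ.contMDiffAt hτ
    exact (this.continuousAt.clm_apply continuousAt_const).continuousWithinAt
  have hτ : τ ∈ γ ⁻¹' L.dom i := h τ right_mem_uIcc
  have h2 := intervalIntegral.integral_hasDerivAt_right
    ((hcont.mono (show uIcc s τ ⊆ _ from h)).intervalIntegrable)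
    (hcont.stronglyMeasurableAtFilter hopen τ hτ) (hcont.continuousAt (hopen.mem_nhds hτ))
  refine h2.hasFDerivAt.congr_fderiv ?_
  ext
  simp

/-- Transports exist over every interval: inside one frame they are exponentials of integrals, and
the intervals over which they exist can be concatenated. -/
lemma exists_isTransport (L : LineBundleWithConnection.{w} (E := E) W)
    (hγ : ContMDiff 𝓘(ℝ, ℝ) 𝓘(ℝ, E) ∞ γ) (hW : ∀ t, γ t ∈ W) (a b : ℝ) :
    ∃ φ, L.IsTransport γ a b φ := by
  suffices h : ∀ s t : ℝ, s ≤ t → ∃ φ, L.IsTransport γ s t φ by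
    rcases le_total a b with h' | h'
    · exact h a b h'
    · obtain ⟨φ, hφ⟩ := h a a le_rfl
      exact ⟨φ, hφ.mono le_rfl h'⟩
  refine rel_of_local ?_ ?_
  · intro r s t h1 h2 hrt
    rcases le_total r s with hrs | hrs
    · rcases le_total s t with hst | hst
      · obtain ⟨φ, hφ⟩ := h1 hrs
        obtain ⟨ψ, hψ⟩ := h2 hst
        exact hφ.glue hψ hrs hst (hW s)
      · obtain ⟨φ, hφ⟩ := h1 hrs
        exact ⟨φ, hφ.mono le_rfl hst⟩
    · obtain ⟨ψ, hψ⟩ := h2 (hrs.trans hrt)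
      exact ⟨ψ, hψ.mono hrs le_rfl⟩
  · intro t₀
    obtain ⟨i, hi⟩ := L.exists_mem_dom (hW t₀)
    have hopen : IsOpen (γ ⁻¹' L.dom i) := (L.isOpen_dom i).preimage hγ.continuous
    obtain ⟨ε, hε, hball⟩ := Metric.isOpen_iff.1 hopen t₀ hi
    have key : ∀ s ∈ Metric.ball t₀ ε, ∀ t ∈ Metric.ball t₀ ε, s ≤ t →
        ∃ φ, L.IsTransport γ s t φ := by
      intro s hs t ht hst
      have hsub : ∀ τ ∈ Icc s t, τ ∈ Metric.ball t₀ ε :=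
        fun τ hτ => (convex_ball t₀ ε).ordConnected.out hs ht hτ
      have hu : ∀ τ ∈ Icc s t, HasFDerivAt (fun τ => ∫ x in s..τ, pullOne (L.A i) γ x 1)
          (pullOne (L.A i) γ τ) τ := by
        intro τ hτ
        refine L.hasFDerivAt_integral_pullOne hγ fun x hx => hball (hsub x ?_)
        rw [uIcc_of_le hτ.1] at hx
        exact ⟨hx.1, hx.2.trans hτ.2⟩
      refine ⟨fun j τ => L.g j i (γ τ) *
        Circle.exp (2 * Real.pi * ∫ x in s..τ, pullOne (L.A i) γ x 1), ⟨?_, ?_⟩⟩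
      · intro j k τ hτ hj hk
        rw [← mul_assoc, L.cocycle j k i (γ τ) ⟨⟨hj, hk⟩, hball (hsub τ hτ)⟩]
      · intro j τ hτ hj
        have h1 := L.hasDLogWithinAt_g j i (s := Icc s t)
          ((hγ.contMDiffAt (x := τ)).mdifferentiableAt (by simp)) hj (hball (hsub τ hτ))
        exact (h1.mul (hasDLogWithinAt_exp (hu τ hτ).hasFDerivWithinAt)).congr_form
          (sub_add_cancel _ _)
    have hmem : Metric.ball t₀ ε ∈ 𝓝 t₀ := Metric.ball_mem_nhds _ hε
    filter_upwards [hmem] with s hs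
    exact ⟨key t₀ (Metric.mem_ball_self hε) s hs, key s hs t₀ (Metric.mem_ball_self hε)⟩

end LineBundleWithConnection

end Transport

/-! ### Holonomy around loops and its variation -/

section Holonomy

variable {V : Type*} [NormedAddCommGroup V] [NormedSpace ℝ V]

/-- First variation of the integral of a `1`-form over a segment: boundary terms plus the integral
of the contraction of the exterior derivative with the direction `e` of the segment, which is
assumed to be the same form `κ` along the segment. -/
lemma hasFDerivAt_integral_line {a : V → V →L[ℝ] ℝ} {O : Set V} (hO : IsOpen O)
    (ha : ∀ v ∈ O, ContDiffAt ℝ ∞ a v) {y₀ e : V} {s t : ℝ}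
    (hst : ∀ τ ∈ uIcc s t, y₀ + τ • e ∈ O) {κ : V →L[ℝ] ℝ}
    (hκ : ∀ τ ∈ uIcc s t, ∀ v,
      fderiv ℝ a (y₀ + τ • e) v e - fderiv ℝ a (y₀ + τ • e) e v = κ v) :
    HasFDerivAt (fun y => ∫ τ in s..t, a (y + τ • e) e)
      (a (y₀ + t • e) - a (y₀ + s • e) + (t - s) • κ) y₀ := by
  have hac : ContinuousOn a O := fun v hv => (ha v hv).continuousAt.continuousWithinAt
  have hdc : ContinuousOn (fderiv ℝ a) O := fun v hv =>
    ((ha v hv).fderiv_right (m := ∞) (by simp)).continuousAt.continuousWithinAt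
  have hnc : ContinuousOn (fun v => ‖fderiv ℝ a v‖) O :=
    ContinuousOn.norm (E := V →L[ℝ] V →L[ℝ] ℝ) hdc
  -- `C + 1` bounds the derivative of `a` near the compact segment, hence near all segments close
  -- to it; this is the domination needed to differentiate under the integral sign
  set K : Set V := (fun τ : ℝ => y₀ + τ • e) '' uIcc s t
  have hK : IsCompact K := isCompact_uIcc.image (by fun_prop)
  have hKO : K ⊆ O := by rintro _ ⟨τ, hτ, rfl⟩; exact hst τ hτ
  obtain ⟨C, hC⟩ := hK.exists_bound_of_continuousOn (hnc.mono hKO)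
  set O' : Set V := O ∩ (fun v => ‖fderiv ℝ a v‖) ⁻¹' Iio (C + 1)
  have hO' : IsOpen O' := hnc.isOpen_inter_preimage hO isOpen_Iio
  have hKO' : K ⊆ O' := fun v hv =>
    ⟨hKO hv, ((Real.le_norm_self _).trans (hC v hv)).trans_lt (lt_add_one C)⟩
  obtain ⟨δ, hδ, hthick⟩ := hK.exists_thickening_subset_open hO' hKO'
  have hmem : ∀ y ∈ Metric.ball y₀ δ, ∀ τ ∈ uIcc s t, y + τ • e ∈ O' := by
    intro y hy τ hτ
    refine hthick (Metric.mem_thickening_iff.2 ⟨y₀ + τ • e, ⟨τ, hτ, rfl⟩, ?_⟩)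
    simpa [dist_eq_norm] using hy
  have hint : ∀ y ∈ Metric.ball y₀ δ, ContinuousOn (fun τ : ℝ => a (y + τ • e) e) (uIcc s t) := by
    intro y hy
    refine ContinuousOn.clm_apply ?_ continuousOn_const
    exact hac.comp (by fun_prop) fun τ hτ => (hmem y hy τ hτ).1
  have hint' : ContinuousOn (fun τ : ℝ => (fderiv ℝ a (y₀ + τ • e)).flip e) (uIcc s t) := by
    have h1 : ContinuousOn (fun τ : ℝ => fderiv ℝ a (y₀ + τ • e)) (uIcc s t) :=
      hdc.comp (by fun_prop) fun τ hτ => hst τ hτ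
    have h2 : Continuous (fun f : V →L[ℝ] V →L[ℝ] ℝ => f.flip e) :=
      (ContinuousLinearMap.apply ℝ (V →L[ℝ] ℝ) e).continuous.comp
        (ContinuousLinearMap.flipₗᵢ ℝ V V ℝ).continuous
    exact h2.comp_continuousOn h1
  have key := (intervalIntegral.hasFDerivAt_integral_of_dominated_of_fderiv_le
    (F := fun (y : V) (τ : ℝ) => a (y + τ • e) e)
    (F' := fun (y : V) (τ : ℝ) => (fderiv ℝ a (y + τ • e)).flip e)
    (bound := fun _ => (C + 1) * ‖e‖) (μ := MeasureTheory.volume) (a := s) (b := t)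
    (Metric.ball_mem_nhds y₀ hδ)
    (by
      filter_upwards [Metric.ball_mem_nhds y₀ hδ] with y hy
      exact ((hint y hy).mono uIoc_subset_uIcc).aestronglyMeasurable measurableSet_uIoc)
    ((hint y₀ (Metric.mem_ball_self hδ)).intervalIntegrable)
    ((hint'.mono uIoc_subset_uIcc).aestronglyMeasurable measurableSet_uIoc)
    (by
      refine Filter.Eventually.of_forall fun τ hτ y hy => ?_
      have h1 := (hmem y hy τ (uIoc_subset_uIcc hτ)).2
      refine ((fderiv ℝ a (y + τ • e)).flip.le_opNorm e).trans ?_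
      rw [ContinuousLinearMap.opNorm_flip]
      exact mul_le_mul_of_nonneg_right (le_of_lt h1) (norm_nonneg _))
    intervalIntegrable_const
    (by
      refine Filter.Eventually.of_forall fun τ hτ y hy => ?_
      have h1 := ((ha _ (hmem y hy τ (uIoc_subset_uIcc hτ)).1).differentiableAt
        (by simp)).hasFDerivAt
      have h2 : HasFDerivAt (fun y : V => y + τ • e) (ContinuousLinearMap.id ℝ V) y :=
        (hasFDerivAt_id y).add_const _
      have h3 := (h1.comp y h2).clm_apply (hasFDerivAt_const e y)
      refine h3.congr_fderiv ?_
      ext v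
      simp))
  refine key.congr_fderiv ?_
  -- by the assumption on `κ`, the integrand is the derivative of `τ ↦ a (y₀ + τ e) + τ κ`
  have hFTC : ∫ τ in s..t, (fderiv ℝ a (y₀ + τ • e)).flip e =
      (a (y₀ + t • e) + t • κ) - (a (y₀ + s • e) + s • κ) := by
    refine intervalIntegral.integral_eq_sub_of_hasDerivAt
      (f := fun τ : ℝ => a (y₀ + τ • e) + τ • κ) ?_ hint'.intervalIntegrable
    intro τ hτ
    have h1 := ((ha _ (hst τ hτ)).differentiableAt (by simp)).hasFDerivAt
    have h2 : HasDerivAt (fun τ : ℝ => y₀ + τ • e) e τ := by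
      simpa using ((hasDerivAt_id τ).smul_const e).const_add y₀
    have h3 := h1.comp_hasDerivAt τ h2
    have h4 : HasDerivAt (fun τ : ℝ => τ • κ) κ τ := by
      simpa using (hasDerivAt_id τ).smul_const κ
    have h5 : HasDerivAt (fun τ : ℝ => a (y₀ + τ • e) + τ • κ)
      (fderiv ℝ a (y₀ + τ • e) e + κ) τ := h3.add h4
    refine h5.congr_deriv ?_
    ext v
    have := hκ τ hτ v
    simp only [_root_.add_apply, ContinuousLinearMap.flip_apply]
    linarith
  rw [hFTC]
  ext v
  simp only [_root_.add_apply, _root_.sub_apply, _root_.smul_apply, smul_eq_mul]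
  ring

variable {E : Type*} [NormedAddCommGroup E] [NormedSpace ℝ E]
  {X : Type*} [TopologicalSpace X] [ChartedSpace E X] {W : Set X}

/-- Circle-valued functions, each defined and locally constant on an open part of an interval,
which agree on overlaps and whose domains cover the interval, have a common constant value. -/
lemma eq_of_locally_constant_family {K : Type*} {p : K → ℝ → Prop} {U : K → ℝ → Circle} {a b : ℝ}
    (hex : ∀ t ∈ Icc a b, ∃ k, p k t)
    (hopen : ∀ k, ∀ t ∈ Icc a b, p k t → ∀ᶠ t' in 𝓝 t, p k t')
    (heq : ∀ k l, ∀ t ∈ Icc a b, p k t → p l t → U k t = U l t)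
    (hd : ∀ k, ∀ t ∈ Icc a b, p k t → HasDLogWithinAt (U k) 0 (Icc a b) t)
    {s t : ℝ} (hs : s ∈ Icc a b) (ht : t ∈ Icc a b) {k l : K} (hk : p k s) (hl : p l t) :
    U k s = U l t := by
  classical
  have hex' : ∀ t, ∃ k, t ∈ Icc a b → p k t := fun t => by
    by_cases h : t ∈ Icc a b
    · obtain ⟨k, hk⟩ := hex t h; exact ⟨k, fun _ => hk⟩
    · exact ⟨k, fun h' => absurd h' h⟩
  choose κ hκ using hex'
  have h := eq_of_hasDLogWithinAt_zero (f := fun t => U (κ t) t) (a := a) (b := b) (by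
    intro t ht
    refine (hd (κ t) t ht (hκ t ht)).congr' ?_ rfl
    filter_upwards [self_mem_nhdsWithin,
      (hopen (κ t) t ht (hκ t ht)).filter_mono nhdsWithin_le_nhds] with t' ht' h
    exact heq _ _ t' ht' (hκ t' ht') h) hs ht
  rw [heq k (κ s) s hs hk (hκ s hs), heq l (κ t) t ht hl (hκ t ht)]
  exact h

namespace LineBundleWithConnection

variable {L : LineBundleWithConnection.{w} (E := E) W} {γ : ℝ → X} {a b : ℝ}

lemma eventually_mem_dom (L : LineBundleWithConnection.{w} (E := E) W) (hγ : Continuous γ)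
    {i : L.J} {t : ℝ} (h : γ t ∈ L.dom i) : ∀ᶠ t' in 𝓝 t, γ t' ∈ L.dom i :=
  hγ.continuousAt.preimage_mem_nhds ((L.isOpen_dom i).mem_nhds h)

/-- Two transports along the same curve differ by a constant factor. -/
lemma IsTransport.div_eq_div {φ ψ : L.J → ℝ → Circle} (hφ : L.IsTransport γ a b φ)
    (hψ : L.IsTransport γ a b ψ) (hγ : Continuous γ) (hW : ∀ t, γ t ∈ W) {s t : ℝ}
    (hs : s ∈ Icc a b) (ht : t ∈ Icc a b) {i j : L.J} (hi : γ s ∈ L.dom i) (hj : γ t ∈ L.dom j) :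
    φ i s / ψ i s = φ j t / ψ j t := by
  refine eq_of_locally_constant_family (p := fun i t => γ t ∈ L.dom i)
    (U := fun i t => φ i t / ψ i t) (fun t _ => L.exists_mem_dom (hW t))
    (fun k t _ h => L.eventually_mem_dom hγ h) ?_ ?_ hs ht hi hj
  · intro i j t ht hi hj
    rw [hφ.change i j t ht hi hj, hψ.change i j t ht hi hj, mul_div_mul_left_eq_div]
  · intro i t ht hi
    exact ((hφ.dlog i t ht hi).div (hψ.dlog i t ht hi)).congr_form (sub_self _)

open Classical in
/-- The holonomy of a line bundle with connection around the loop `γ`, `0 ≤ t ≤ 1`, as the ratio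
of the final and the initial value of a solution of the parallel transport equation; the value is
junk if `γ 1 ≠ γ 0`. -/
def hol (L : LineBundleWithConnection.{w} (E := E) W) (γ : ℝ → X) : Circle :=
  if h : (∃ φ, L.IsTransport γ 0 1 φ) ∧ ∃ i, γ 0 ∈ L.dom i then
    h.1.choose h.2.choose 1 / h.1.choose h.2.choose 0 else 1

lemma hol_eq {φ : L.J → ℝ → Circle} (hφ : L.IsTransport γ 0 1 φ) (hγ : Continuous γ)
    (hW : ∀ t, γ t ∈ W) (hloop : γ 1 = γ 0) {i : L.J} (hi : γ 0 ∈ L.dom i) :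
    L.hol γ = φ i 1 / φ i 0 := by
  have h : (∃ φ, L.IsTransport γ 0 1 φ) ∧ ∃ i, γ 0 ∈ L.dom i := ⟨⟨φ, hφ⟩, i, hi⟩
  have h0 : (0 : ℝ) ∈ Icc (0 : ℝ) 1 := ⟨le_rfl, zero_le_one⟩
  have h1 : (1 : ℝ) ∈ Icc (0 : ℝ) 1 := ⟨zero_le_one, le_rfl⟩
  have hψ := h.1.choose_spec
  have hj := h.2.choose_spec
  unfold hol
  rw [dif_pos h]
  set ψ := h.1.choose
  set j := h.2.choose
  have hi1 : γ 1 ∈ L.dom i := hloop ▸ hi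
  have hj1 : γ 1 ∈ L.dom j := hloop ▸ hj
  rw [hψ.change j i 1 h1 hj1 hi1, hψ.change j i 0 h0 hj hi, hloop, mul_div_mul_left_eq_div]
  have := hφ.div_eq_div hψ hγ hW h0 h1 hi hi1
  rw [div_eq_div_iff_mul_eq_mul] at this ⊢
  rw [mul_comm, ← this, mul_comm]

variable [IsManifold 𝓘(ℝ, E) ∞ X]

lemma IsTransport.div_eq_exp {φ : L.J → ℝ → Circle} (hφ : L.IsTransport γ a b φ)
    (hγ : ContMDiff 𝓘(ℝ, ℝ) 𝓘(ℝ, E) ∞ γ) {s t : ℝ} (hs : s ∈ Icc a b) (ht : t ∈ Icc a b)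
    {i : L.J} (hi : ∀ τ ∈ uIcc s t, γ τ ∈ L.dom i) :
    φ i t / φ i s = Circle.exp (2 * Real.pi * ∫ τ in s..t, pullOne (L.A i) γ τ 1) := by
  have hsub : uIcc s t ⊆ Icc a b := Icc_subset_Icc (le_min hs.1 ht.1) (max_le hs.2 ht.2)
  have h := eq_of_hasDLogWithinAt_zero (a := min s t) (b := max s t)
    (f := fun τ => φ i τ / Circle.exp (2 * Real.pi * ∫ x in s..τ, pullOne (L.A i) γ x 1)) (by
      intro τ hτ
      have h1 := (hφ.dlog i τ (hsub hτ) (hi τ hτ)).mono hsub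
      have h2 := L.hasFDerivAt_integral_pullOne hγ (i := i) (s := s) (τ := τ) fun x hx =>
        hi x (uIcc_subset_uIcc left_mem_uIcc hτ hx)
      exact (h1.div (hasDLogWithinAt_exp h2.hasFDerivWithinAt)).congr_form (sub_self _))
    (s := s) (t := t) left_mem_uIcc right_mem_uIcc
  simp only [intervalIntegral.integral_same, mul_zero, Circle.exp_zero, div_one] at h
  rw [h, div_div_cancel]

section Variation

variable {Γ : V → X} {Ω : Set V} {e : V}

lemma pullOne_line (η : OneForm E X) {y : V} {t : ℝ}
    (h : MDifferentiableAt 𝓘(ℝ, V) 𝓘(ℝ, E) Γ (y + t • e)) :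
    pullOne η (fun t : ℝ => Γ (y + t • e)) t 1 = pullOne η Γ (y + t • e) e := by
  have h2 : HasDerivAt (fun τ : ℝ => y + τ • e) e t := by
    simpa using ((hasDerivAt_id t).smul_const e).const_add y
  have := pullOne_comp η (k := fun t : ℝ => y + t • e) h h2.differentiableAt
  have h3 : pullOne η (fun t : ℝ => Γ (y + t • e)) t = _ := this
  rw [h3]
  simp [h2.hasFDerivAt.fderiv]

/-- The logarithmic derivative of parallel transport along parallel lines, with respect to the
line, when the contraction of the curvature with the direction of the lines is the same form `κ`
at all points of the line. -/
lemma hasDLogWithinAt_transport (hΩ : IsOpen Ω)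
    (hΓ : ∀ y ∈ Ω, ContMDiffAt 𝓘(ℝ, V) 𝓘(ℝ, E) ∞ Γ y)
    (hΩe : ∀ y ∈ Ω, ∀ t : ℝ, y + t • e ∈ Ω) (hW : ∀ y ∈ Ω, Γ y ∈ W) {y₀ : V} (hy₀ : y₀ ∈ Ω)
    {κ : V →L[ℝ] ℝ}
    (hκ : ∀ (t : ℝ) i, Γ (y₀ + t • e) ∈ L.dom i → ∀ v,
      fderiv ℝ (pullOne (L.A i) Γ) (y₀ + t • e) v e
        - fderiv ℝ (pullOne (L.A i) Γ) (y₀ + t • e) e v = κ v)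
    {φ : V → L.J → ℝ → Circle}
    (hφ : ∀ y ∈ Ω, L.IsTransport (fun t => Γ (y + t • e)) 0 1 (φ y)) (s t : Icc (0 : ℝ) 1) :
    ∀ i j, Γ (y₀ + (s : ℝ) • e) ∈ L.dom i → Γ (y₀ + (t : ℝ) • e) ∈ L.dom j →
      HasDLogWithinAt (fun y => φ y j t / φ y i s)
        (pullOne (L.A j) Γ (y₀ + (t : ℝ) • e) - pullOne (L.A i) Γ (y₀ + (s : ℝ) • e)
          + ((t : ℝ) - s) • κ) univ y₀ := by
  -- the claim is reflexive and transitive in `(s, t)`, so it suffices to prove it locally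
  revert s t
  refine rel_of_local ?_ ?_
  · intro r s t h1 h2 i j hi hj
    obtain ⟨k, hk⟩ := L.exists_mem_dom (hW _ (hΩe _ hy₀ s))
    refine (((h2 k j hk hj).mul (h1 i k hi hk)).congr' ?_ ?_).congr_form ?_
    · exact Filter.Eventually.of_forall fun y => (div_mul_div_cancel _ _ _).symm
    · exact (div_mul_div_cancel _ _ _).symm
    · ext v
      simp only [_root_.add_apply, _root_.sub_apply, _root_.smul_apply, smul_eq_mul]
      ring
  · intro t₀
    obtain ⟨i₀, hi₀⟩ := L.exists_mem_dom (hW _ (hΩe _ hy₀ t₀))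
    set O : Set V := Ω ∩ Γ ⁻¹' L.dom i₀ with hO
    have hOo : IsOpen O := ContinuousOn.isOpen_inter_preimage
      (fun y hy => (hΓ y hy).continuousAt.continuousWithinAt) hΩ (L.isOpen_dom i₀)
    have hcm : Continuous (fun q : V × ℝ => q.1 + q.2 • e) := by fun_prop
    have hnh : (fun q : V × ℝ => q.1 + q.2 • e) ⁻¹' O ∈ 𝓝 (y₀, (t₀ : ℝ)) :=
      (hOo.preimage hcm).mem_nhds ⟨hΩe _ hy₀ t₀, hi₀⟩
    obtain ⟨δ, hδ, hball⟩ := Metric.mem_nhds_iff.1 hnh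
    have hO' : ∀ y ∈ Metric.ball y₀ δ, ∀ τ ∈ Metric.ball (t₀ : ℝ) δ, y + τ • e ∈ O := by
      intro y hy τ hτ
      have : (y, τ) ∈ Metric.ball (y₀, (t₀ : ℝ)) δ := by
        rw [← ball_prod_same]; exact ⟨hy, hτ⟩
      exact hball this
    have key : ∀ s t : Icc (0 : ℝ) 1, (s : ℝ) ∈ Metric.ball (t₀ : ℝ) δ →
        (t : ℝ) ∈ Metric.ball (t₀ : ℝ) δ → ∀ i j, Γ (y₀ + (s : ℝ) • e) ∈ L.dom i →
        Γ (y₀ + (t : ℝ) • e) ∈ L.dom j → HasDLogWithinAt (fun y => φ y j t / φ y i s)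
        (pullOne (L.A j) Γ (y₀ + (t : ℝ) • e) - pullOne (L.A i) Γ (y₀ + (s : ℝ) • e)
          + ((t : ℝ) - s) • κ) univ y₀ := by
      intro s t hs ht i j hi hj
      have hst : ∀ τ ∈ uIcc (s : ℝ) t, τ ∈ Metric.ball (t₀ : ℝ) δ := fun τ hτ =>
        (convex_ball (t₀ : ℝ) δ).ordConnected.uIcc_subset hs ht hτ
      have hyb : Metric.ball y₀ δ ∈ 𝓝 y₀ := Metric.ball_mem_nhds _ hδ
      have hline : ∀ y ∈ Ω, ContMDiff 𝓘(ℝ, ℝ) 𝓘(ℝ, E) ∞ (fun t : ℝ => Γ (y + t • e)) := by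
        intro y hy t
        have h1 : ContMDiffAt 𝓘(ℝ, ℝ) 𝓘(ℝ, V) ∞ (fun t : ℝ => y + t • e) t := by
          refine ContDiffAt.contMDiffAt ?_
          fun_prop
        exact (hΓ _ (hΩe y hy t)).comp t h1
      -- on the frame `i₀`, transport is the exponential of an integral
      have h0 : HasDLogWithinAt (fun y => φ y i₀ t / φ y i₀ s)
          (pullOne (L.A i₀) Γ (y₀ + (t : ℝ) • e) - pullOne (L.A i₀) Γ (y₀ + (s : ℝ) • e)
            + ((t : ℝ) - s) • κ) univ y₀ := by
        have h1 := hasFDerivAt_integral_line hOo (a := pullOne (L.A i₀) Γ)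
          (fun v hv => (L.smooth_A i₀).contDiffAt_pullOne (hΓ v hv.1) hv.2) (y₀ := y₀) (e := e)
          (s := s) (t := t) (fun τ hτ => hO' y₀ (Metric.mem_ball_self hδ) τ (hst τ hτ)) (κ := κ)
          (fun τ hτ v => hκ τ i₀ (hO' y₀ (Metric.mem_ball_self hδ) τ (hst τ hτ)).2 v)
        have h2 : ∀ y ∈ Metric.ball y₀ δ, y ∈ Ω → φ y i₀ t / φ y i₀ s =
            Circle.exp (2 * Real.pi * ∫ τ in (s : ℝ)..t, pullOne (L.A i₀) Γ (y + τ • e) e) := by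
          intro y hy hyΩ
          rw [(hφ y hyΩ).div_eq_exp (hline y hyΩ) s.2 t.2
            (fun τ hτ => (hO' y hy τ (hst τ hτ)).2)]
          congr 2
          refine intervalIntegral.integral_congr fun τ _ => ?_
          exact pullOne_line _ ((hΓ _ (hΩe y hyΩ τ)).mdifferentiableAt (by simp))
        refine (hasDLogWithinAt_exp (s := univ) h1.hasFDerivWithinAt).congr' ?_
          (h2 y₀ (Metric.mem_ball_self hδ) hy₀)
        rw [nhdsWithin_univ]
        filter_upwards [hyb, hΩ.mem_nhds hy₀] with y hy hyΩ using h2 y hy hyΩ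
      have hshift : ∀ τ : ℝ, HasFDerivAt (fun y : V => y + τ • e) (ContinuousLinearMap.id ℝ V) y₀ :=
        fun τ => (hasFDerivAt_id y₀).add_const _
      have hg : ∀ (k : L.J) (τ : ℝ), Γ (y₀ + τ • e) ∈ L.dom k → Γ (y₀ + τ • e) ∈ L.dom i₀ →
          HasDLogWithinAt (fun y => L.g k i₀ (Γ (y + τ • e)))
            (pullOne (L.A k) Γ (y₀ + τ • e) - pullOne (L.A i₀) Γ (y₀ + τ • e)) univ y₀ := by
        intro k τ hk hk0
        have h1 := L.hasDLogWithinAt_g k i₀ (s := univ)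
          ((hΓ _ (hΩe _ hy₀ τ)).mdifferentiableAt (by simp)) hk hk0
        have h2 := HasDLogWithinAt.comp (f := fun v => L.g k i₀ (Γ v))
          (k := fun y : V => y + τ • e) h1 (hshift τ).hasFDerivWithinAt (mapsTo_univ univ univ)
        exact h2.congr_form (ContinuousLinearMap.comp_id _)
      have hs0 := (hO' y₀ (Metric.mem_ball_self hδ) s hs).2
      have ht0 := (hO' y₀ (Metric.mem_ball_self hδ) t ht).2
      have hev : ∀ (k : L.J) (τ : Icc (0 : ℝ) 1), Γ (y₀ + (τ : ℝ) • e) ∈ L.dom k →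
          Γ (y₀ + (τ : ℝ) • e) ∈ L.dom i₀ →
          ∀ᶠ y in 𝓝 y₀, φ y k τ = L.g k i₀ (Γ (y + (τ : ℝ) • e)) * φ y i₀ τ := by
        intro k τ hk hk0
        have hc : ContinuousAt (fun y => Γ (y + (τ : ℝ) • e)) y₀ :=
          ContinuousAt.comp (g := Γ) (hΓ _ (hΩe _ hy₀ τ)).continuousAt (hshift τ).continuousAt
        filter_upwards [hΩ.mem_nhds hy₀, hc.preimage_mem_nhds ((L.isOpen_dom k).mem_nhds hk),
          hc.preimage_mem_nhds ((L.isOpen_dom i₀).mem_nhds hk0)] with y h1 h2 h3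
        exact (hφ y h1).change k i₀ τ τ.2 h2 h3
      have hfin : ∀ᶠ y in 𝓝 y₀, φ y j t / φ y i s = L.g j i₀ (Γ (y + (t : ℝ) • e)) *
          (φ y i₀ t / φ y i₀ s) / L.g i i₀ (Γ (y + (s : ℝ) • e)) := by
        filter_upwards [hev i s hi hs0, hev j t hj ht0] with y h1 h2
        rw [h1, h2, mul_comm (L.g i i₀ _), ← mul_div_assoc, div_div]
      refine ((((hg j t hj ht0).mul h0).div (hg i s hi hs0)).congr' ?_ hfin.self_of_nhds).congr_form
        ?_
      · rw [nhdsWithin_univ]; exact hfin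
      · abel
    have hmem : {s : Icc (0 : ℝ) 1 | (s : ℝ) ∈ Metric.ball (t₀ : ℝ) δ} ∈ 𝓝 t₀ :=
      continuous_subtype_val.continuousAt.preimage_mem_nhds (Metric.ball_mem_nhds _ hδ)
    filter_upwards [hmem] with s hs
    exact ⟨key t₀ s (Metric.mem_ball_self hδ) hs, key s t₀ hs (Metric.mem_ball_self hδ)⟩

/-- The logarithmic derivative of the holonomy around loops which are translates of each other is
the contraction of the curvature with the direction of translation. -/
lemma hasDLogWithinAt_hol {F : TwoForm E X} (hF : ∀ i, ∀ x ∈ L.dom i, ∀ v w,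
      F x v w = extDerivOne (L.A i) x v w) (hΩ : IsOpen Ω)
    (hΓ : ∀ y ∈ Ω, ContMDiffAt 𝓘(ℝ, V) 𝓘(ℝ, E) ∞ Γ y)
    (hΩe : ∀ y ∈ Ω, ∀ t : ℝ, y + t • e ∈ Ω) (hW : ∀ y ∈ Ω, Γ y ∈ W)
    (hper : ∀ y, Γ (y + e) = Γ y) {y₀ : V} (hy₀ : y₀ ∈ Ω)
    {κ : V →L[ℝ] ℝ} (hκ : ∀ (t : ℝ) v, pullTwo F Γ (y₀ + t • e) v e = κ v) :
    HasDLogWithinAt (fun y => L.hol (fun t => Γ (y + t • e))) κ univ y₀ := by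
  have hline : ∀ y ∈ Ω, ContMDiff 𝓘(ℝ, ℝ) 𝓘(ℝ, E) ∞ (fun t : ℝ => Γ (y + t • e)) := by
    intro y hy t
    have h1 : ContMDiffAt 𝓘(ℝ, ℝ) 𝓘(ℝ, V) ∞ (fun t : ℝ => y + t • e) t := by
      refine ContDiffAt.contMDiffAt ?_
      fun_prop
    exact (hΓ _ (hΩe y hy t)).comp t h1
  have hex : ∀ y : V, ∃ φ : L.J → ℝ → Circle, y ∈ Ω →
      L.IsTransport (fun t => Γ (y + t • e)) 0 1 φ := by
    intro y
    by_cases hy : y ∈ Ω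
    · obtain ⟨φ, hφ⟩ := L.exists_isTransport (hline y hy) (fun t => hW _ (hΩe y hy t)) 0 1
      exact ⟨φ, fun _ => hφ⟩
    · exact ⟨fun _ _ => 1, fun h => absurd h hy⟩
  choose φ hφ using hex
  obtain ⟨i, hi⟩ := L.exists_mem_dom (hW _ hy₀)
  have h := hasDLogWithinAt_transport (L := L) hΩ hΓ hΩe hW hy₀ (κ := κ) (by
    intro t i hi v
    rw [← hκ t v, pullTwo_apply, hF i _ hi,
      extDerivOne_mfderiv ((L.smooth_A i) _ hi) (hΓ _ (hΩe _ hy₀ t))]) hφ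
    ⟨0, le_rfl, zero_le_one⟩ ⟨1, zero_le_one, le_rfl⟩ i i (by simpa using hi)
    (by simpa [hper] using hi)
  -- the boundary terms at the two ends of a loop cancel
  have hform : pullOne (L.A i) Γ (y₀ + e) = pullOne (L.A i) Γ y₀ := by
    have h2 : HasFDerivAt (fun y : V => y + e) (ContinuousLinearMap.id ℝ V) y₀ :=
      (hasFDerivAt_id y₀).add_const _
    have h1 := pullOne_comp (L.A i) (g := Γ) (k := fun y : V => y + e) (v := y₀)
      ((hΓ _ (by simpa using hΩe _ hy₀ 1)).mdifferentiableAt (by simp)) h2.differentiableAt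
    have h3 : Γ ∘ (fun y : V => y + e) = Γ := funext hper
    rw [h3, h2.fderiv] at h1
    rw [h1]; rfl
  have heq : ∀ y ∈ Ω, Γ y ∈ L.dom i →
      L.hol (fun t => Γ (y + t • e)) = φ y i 1 / φ y i 0 := by
    intro y hy hyi
    exact hol_eq (hφ y hy) (hline y hy).continuous (fun t => hW _ (hΩe y hy t))
      (by simp [hper]) (by simpa using hyi)
  refine (h.congr' ?_ (heq y₀ hy₀ hi)).congr_form ?_
  · rw [nhdsWithin_univ]
    filter_upwards [hΩ.mem_nhds hy₀,
      (hΓ _ hy₀).continuousAt.preimage_mem_nhds ((L.isOpen_dom i).mem_nhds hi)] with y h1 h2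
    exact heq y h1 h2
  · simp [hform]

end Variation

end LineBundleWithConnection

namespace GerbeWithConnection

variable [IsManifold 𝓘(ℝ, E) ∞ X] {ι : Type*} {W : ι → Set X}
  (𝒢 : GerbeWithConnection.{w} (E := E) W)
  {γ : ℝ → X} (hγ : ContMDiff 𝓘(ℝ, ℝ) 𝓘(ℝ, E) ∞ γ) (hloop : γ 1 = γ 0)

include hγ hloop in
/-- The isomorphism `L_{αβ} ≅ L_{βα}^*` being flat, the product of the components of parallel
transport in the two bundles, divided by its component `r`, is constant. -/
lemma hol_mul_hol_swap {α β : ι} (hα : ∀ t, γ t ∈ W α) (hβ : ∀ t, γ t ∈ W β) :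
    (𝒢.L α β).hol γ * (𝒢.L β α).hol γ = 1 := by
  have hW : ∀ t, γ t ∈ W α ∩ W β := fun t => ⟨hα t, hβ t⟩
  have hW' : ∀ t, γ t ∈ W β ∩ W α := fun t => ⟨hβ t, hα t⟩
  obtain ⟨φ, hφ⟩ := (𝒢.L α β).exists_isTransport hγ hW 0 1
  obtain ⟨ψ, hψ⟩ := (𝒢.L β α).exists_isTransport hγ hW' 0 1
  obtain ⟨i, hi⟩ := (𝒢.L α β).exists_mem_dom (hW 0)
  obtain ⟨j, hj⟩ := (𝒢.L β α).exists_mem_dom (hW' 0)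
  rw [LineBundleWithConnection.hol_eq hφ hγ.continuous hW hloop hi,
    LineBundleWithConnection.hol_eq hψ hγ.continuous hW' hloop hj]
  have hi1 : γ 1 ∈ (𝒢.L α β).dom i := hloop ▸ hi
  have hj1 : γ 1 ∈ (𝒢.L β α).dom j := hloop ▸ hj
  have h0 : (0 : ℝ) ∈ Icc (0 : ℝ) 1 := ⟨le_rfl, zero_le_one⟩
  have h1 : (1 : ℝ) ∈ Icc (0 : ℝ) 1 := ⟨zero_le_one, le_rfl⟩
  have key := eq_of_locally_constant_family (K := (𝒢.L α β).J × (𝒢.L β α).J)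
    (p := fun k t => γ t ∈ (𝒢.L α β).dom k.1 ∧ γ t ∈ (𝒢.L β α).dom k.2)
    (U := fun k t => φ k.1 t * ψ k.2 t / 𝒢.r α β k.1 k.2 (γ t)) (a := 0) (b := 1)
    (by
      intro t _
      obtain ⟨i, hi⟩ := (𝒢.L α β).exists_mem_dom (hW t)
      obtain ⟨j, hj⟩ := (𝒢.L β α).exists_mem_dom (hW' t)
      exact ⟨(i, j), hi, hj⟩)
    (fun k t _ h => ((𝒢.L α β).eventually_mem_dom hγ.continuous h.1).and
      ((𝒢.L β α).eventually_mem_dom hγ.continuous h.2))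
    (by
      rintro ⟨i, j⟩ ⟨i', j'⟩ t ht ⟨h1, h2⟩ ⟨h3, h4⟩
      simp only
      rw [hφ.change i i' t ht h1 h3, hψ.change j j' t ht h2 h4,
        𝒢.frame_r α β i' i j' j (γ t) ⟨⟨h3, h1⟩, ⟨h4, h2⟩⟩, mul_mul_mul_comm,
        mul_div_mul_left_eq_div])
    (by
      rintro ⟨i, j⟩ t ht ⟨h1, h2⟩
      have hr := (𝒢.smooth_r α β i j).hasDLogWithinAt (s := Icc 0 1) (v := t) (g := γ)
        (ℓ := pullOne ((𝒢.L α β).A i) γ t + pullOne ((𝒢.L β α).A j) γ t)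
        (((𝒢.L α β).isOpen_dom i).inter ((𝒢.L β α).isOpen_dom j))
        ((hγ t).mdifferentiableAt (by simp)) ⟨h1, h2⟩
        (fun u => 𝒢.flat_r α β i j _ ⟨h1, h2⟩ _)
      exact (((hφ.dlog i t ht h1).mul (hψ.dlog j t ht h2)).div hr).congr_form (sub_self _))
    h1 h0 (k := (i, j)) (l := (i, j)) ⟨hi1, hj1⟩ ⟨hi, hj⟩
  simp only [hloop] at key
  rw [div_left_inj] at key
  rw [div_mul_div_comm, key, div_self']

include hγ hloop in
/-- The holonomies multiply to `1` because `L_{αβ} ⊗ L_{βδ} ⊗ L_{δα}` has a flat section. -/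
lemma hol_mul_hol_mul_hol {α β δ : ι} (hα : ∀ t, γ t ∈ W α) (hβ : ∀ t, γ t ∈ W β)
    (hδ : ∀ t, γ t ∈ W δ) :
    (𝒢.L α β).hol γ * (𝒢.L β δ).hol γ * (𝒢.L δ α).hol γ = 1 := by
  have hW₁ : ∀ t, γ t ∈ W α ∩ W β := fun t => ⟨hα t, hβ t⟩
  have hW₂ : ∀ t, γ t ∈ W β ∩ W δ := fun t => ⟨hβ t, hδ t⟩
  have hW₃ : ∀ t, γ t ∈ W δ ∩ W α := fun t => ⟨hδ t, hα t⟩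
  obtain ⟨φ, hφ⟩ := (𝒢.L α β).exists_isTransport hγ hW₁ 0 1
  obtain ⟨ψ, hψ⟩ := (𝒢.L β δ).exists_isTransport hγ hW₂ 0 1
  obtain ⟨χ, hχ⟩ := (𝒢.L δ α).exists_isTransport hγ hW₃ 0 1
  obtain ⟨i, hi⟩ := (𝒢.L α β).exists_mem_dom (hW₁ 0)
  obtain ⟨j, hj⟩ := (𝒢.L β δ).exists_mem_dom (hW₂ 0)
  obtain ⟨k, hk⟩ := (𝒢.L δ α).exists_mem_dom (hW₃ 0)
  rw [LineBundleWithConnection.hol_eq hφ hγ.continuous hW₁ hloop hi,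
    LineBundleWithConnection.hol_eq hψ hγ.continuous hW₂ hloop hj,
    LineBundleWithConnection.hol_eq hχ hγ.continuous hW₃ hloop hk]
  have hi1 : γ 1 ∈ (𝒢.L α β).dom i := hloop ▸ hi
  have hj1 : γ 1 ∈ (𝒢.L β δ).dom j := hloop ▸ hj
  have hk1 : γ 1 ∈ (𝒢.L δ α).dom k := hloop ▸ hk
  have h0 : (0 : ℝ) ∈ Icc (0 : ℝ) 1 := ⟨le_rfl, zero_le_one⟩
  have h1 : (1 : ℝ) ∈ Icc (0 : ℝ) 1 := ⟨zero_le_one, le_rfl⟩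
  have hcomm : ∀ a b c x y z d : Circle,
      a * x * (b * y) * (c * z) / (a * b * c * d) = x * y * z / d := by
    intro a b c x y z d
    rw [mul_mul_mul_comm a x b y, mul_mul_mul_comm (a * b), mul_div_mul_left_eq_div]
  have key := eq_of_locally_constant_family (K := (𝒢.L α β).J × (𝒢.L β δ).J × (𝒢.L δ α).J)
    (p := fun k t => γ t ∈ (𝒢.L α β).dom k.1 ∧ γ t ∈ (𝒢.L β δ).dom k.2.1 ∧
      γ t ∈ (𝒢.L δ α).dom k.2.2)
    (U := fun k t => φ k.1 t * ψ k.2.1 t * χ k.2.2 t / 𝒢.f α β δ k.1 k.2.1 k.2.2 (γ t))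
    (a := 0) (b := 1)
    (by
      intro t _
      obtain ⟨i, hi⟩ := (𝒢.L α β).exists_mem_dom (hW₁ t)
      obtain ⟨j, hj⟩ := (𝒢.L β δ).exists_mem_dom (hW₂ t)
      obtain ⟨k, hk⟩ := (𝒢.L δ α).exists_mem_dom (hW₃ t)
      exact ⟨(i, j, k), hi, hj, hk⟩)
    (fun k t _ h => ((𝒢.L α β).eventually_mem_dom hγ.continuous h.1).and
      (((𝒢.L β δ).eventually_mem_dom hγ.continuous h.2.1).and
        ((𝒢.L δ α).eventually_mem_dom hγ.continuous h.2.2)))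
    (by
      rintro ⟨i, j, k⟩ ⟨i', j', k'⟩ t ht ⟨h1, h2, h3⟩ ⟨h4, h5, h6⟩
      simp only
      rw [hφ.change i i' t ht h1 h4, hψ.change j j' t ht h2 h5, hχ.change k k' t ht h3 h6,
        𝒢.frame_f α β δ i' i j' j k' k (γ t) ⟨⟨⟨h4, h1⟩, ⟨h5, h2⟩⟩, ⟨h6, h3⟩⟩,
        hcomm])
    (by
      rintro ⟨i, j, k⟩ t ht ⟨h1, h2, h3⟩
      have hr := (𝒢.smooth_f α β δ i j k).hasDLogWithinAt (s := Icc 0 1) (v := t) (g := γ)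
        (ℓ := pullOne ((𝒢.L α β).A i) γ t + pullOne ((𝒢.L β δ).A j) γ t
          + pullOne ((𝒢.L δ α).A k) γ t)
        ((((𝒢.L α β).isOpen_dom i).inter ((𝒢.L β δ).isOpen_dom j)).inter
          ((𝒢.L δ α).isOpen_dom k))
        ((hγ t).mdifferentiableAt (by simp)) ⟨⟨h1, h2⟩, h3⟩
        (fun u => 𝒢.flat_f α β δ i j k _ ⟨⟨h1, h2⟩, h3⟩ _)
      exact ((((hφ.dlog i t ht h1).mul (hψ.dlog j t ht h2)).mul (hχ.dlog k t ht h3)).div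
        hr).congr_form (sub_self _))
    h1 h0 (k := (i, j, k)) (l := (i, j, k)) ⟨hi1, hj1, hk1⟩ ⟨hi, hj, hk⟩
  simp only [hloop] at key
  rw [div_left_inj] at key
  rw [div_mul_div_comm, div_mul_div_comm, key, div_self']

include hγ hloop in
lemma hol_self {α : ι} (hα : ∀ t, γ t ∈ W α) : (𝒢.L α α).hol γ = 1 := by
  have h1 := 𝒢.hol_mul_hol_swap hγ hloop hα hα
  have h2 := 𝒢.hol_mul_hol_mul_hol hγ hloop hα hα hα
  rwa [h1, one_mul] at h2

end GerbeWithConnection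

end Holonomy

/-! ### The torus action and its differential -/

section TorusPoints

variable {n : ℕ}

lemma torusPt_zero : torusPt (0 : Fin n → ℝ) = 0 := by
  funext i; simp [torusPt]

lemma torusPt_add (a b : Fin n → ℝ) : torusPt (a + b) = torusPt a + torusPt b := by
  funext i; simp [torusPt]

lemma exists_torusPt_eq (t : Fin n → UnitAddCircle) : ∃ θ : Fin n → ℝ, torusPt θ = t := by
  choose θ hθ using fun i => QuotientAddGroup.mk_surjective (t i)
  exact ⟨θ, funext hθ⟩

lemma coe_unitAddCircle_eq_iff {a b : ℝ} :
    (a : UnitAddCircle) = b ↔ ∃ k : ℤ, a = b + k := by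
  rw [QuotientAddGroup.eq_iff_sub_mem, AddSubgroup.mem_zmultiples_iff]
  simp only [zsmul_eq_mul, mul_one]
  exact exists_congr fun k => ⟨fun h => by rw [h]; ring, fun h => by rw [h]; ring⟩

lemma torusPt_eq_iff {a b : Fin n → ℝ} : torusPt a = torusPt b ↔ EqModInt a b := by
  rw [funext_iff]
  simp only [torusPt, coe_unitAddCircle_eq_iff, EqModInt]
  exact ⟨fun h => ⟨fun i => (h i).choose, fun i => (h i).choose_spec⟩,
    fun ⟨k, hk⟩ i => ⟨k i, hk i⟩⟩

lemma torusPt_single_one (I : Fin n) : torusPt (Pi.single I 1 : Fin n → ℝ) = 0 := by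
  rw [← torusPt_zero, torusPt_eq_iff]
  refine ⟨Pi.single I 1, fun i => ?_⟩
  by_cases h : i = I
  · subst h; simp
  · simp [h]

end TorusPoints

section Chain

variable (E : Type*) [NormedAddCommGroup E] [NormedSpace ℝ E]
  {M : Type*} [TopologicalSpace M] [ChartedSpace E M]
  (E' : Type*) [NormedAddCommGroup E'] [NormedSpace ℝ E']
  {X : Type*} [TopologicalSpace X] [ChartedSpace E' X]
  {F : Type*} [NormedAddCommGroup F] [NormedSpace ℝ F]
  {Y : Type*} [TopologicalSpace Y] [ChartedSpace F Y]

/-- The differential of a map between manifolds, as a linear map between the model spaces. -/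
def tmap (f : M → X) (x : M) : E →L[ℝ] E' := mfderiv 𝓘(ℝ, E) 𝓘(ℝ, E') f x

variable {E E'}

lemma tmap_comp {g : X → Y} {f : M → X} {x : M}
    (hg : MDifferentiableAt 𝓘(ℝ, E') 𝓘(ℝ, F) g (f x))
    (hf : MDifferentiableAt 𝓘(ℝ, E) 𝓘(ℝ, E') f x) :
    tmap E F (fun x => g (f x)) x = (tmap E' F g (f x)).comp (tmap E E' f x) :=
  mfderiv_comp x hg hf

lemma tmap_comp_apply {g : X → Y} {f : M → X} {x : M}
    (hg : MDifferentiableAt 𝓘(ℝ, E') 𝓘(ℝ, F) g (f x))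
    (hf : MDifferentiableAt 𝓘(ℝ, E) 𝓘(ℝ, E') f x) (v : E) :
    tmap E F (fun x => g (f x)) x v = tmap E' F g (f x) (tmap E E' f x v) := by
  rw [tmap_comp hg hf]; rfl

lemma tmap_congr {f f' : M → X} {x : M} (h : f =ᶠ[𝓝 x] f') : tmap E E' f x = tmap E E' f' x :=
  h.mfderiv_eq

lemma tmap_of_hasFDerivAt {k : E → E'} {v : E} {D : E →L[ℝ] E'} (hk : HasFDerivAt k D v) :
    tmap E E' k v = D := by
  rw [tmap, mfderiv_eq_fderiv, hk.fderiv]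

lemma tmap_const (c : X) (x : M) : tmap E E' (fun _ : M => c) x = 0 := mfderiv_const

lemma tmap_id (x : M) : tmap E E (fun x : M => x) x = ContinuousLinearMap.id ℝ E := mfderiv_id

variable {V : Type*} [NormedAddCommGroup V] [NormedSpace ℝ V]

variable (E E') in
/-- The differential of a family of maps `Ψ x : V → X` with respect to both arguments. -/
def dPair (Ψ : M → V → X) (x : M) (w : V) : E × V →L[ℝ] E' :=
  mfderiv (𝓘(ℝ, E).prod 𝓘(ℝ, V)) 𝓘(ℝ, E') (fun q : M × V => Ψ q.1 q.2) (x, w)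

lemma dPair_apply {Ψ : M → V → X} {x : M} {w : V}
    (h : MDifferentiableAt (𝓘(ℝ, E).prod 𝓘(ℝ, V)) 𝓘(ℝ, E') (fun q : M × V => Ψ q.1 q.2) (x, w))
    (v : E) (t : V) :
    dPair E E' Ψ x w (v, t) = tmap E E' (fun z => Ψ z w) x v + tmap V E' (Ψ x) w t :=
  mfderiv_prod_eq_add_apply (p := (x, w)) (v := (v, t)) h

lemma tmap_comp_pair {Ψ : M → V → X} {b : M → V} {x : M}
    (h : MDifferentiableAt (𝓘(ℝ, E).prod 𝓘(ℝ, V)) 𝓘(ℝ, E') (fun q : M × V => Ψ q.1 q.2) (x, b x))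
    (hb : MDifferentiableAt 𝓘(ℝ, E) 𝓘(ℝ, V) b x) (v : E) :
    tmap E E' (fun z => Ψ z (b z)) x v = dPair E E' Ψ x (b x) (v, tmap E V b x v) := by
  have h4 := mfderiv_comp x (f := fun x => (x, b x)) (g := fun q : M × V => Ψ q.1 q.2)
    h (mdifferentiableAt_id.prodMk hb)
  have h5 := mfderiv_prodMk (f := fun x : M => x) (I := 𝓘(ℝ, E)) (I' := 𝓘(ℝ, E))
    mdifferentiableAt_id hb
  rw [h5] at h4
  refine (DFunLike.congr_fun h4 v).trans ?_
  have h6 : mfderiv 𝓘(ℝ, E) 𝓘(ℝ, E) (fun x : M => x) x v = v :=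
    DFunLike.congr_fun (mfderiv_id (x := x)) v
  exact congrArg (fun z : E => dPair E E' Ψ x (b x) (z, tmap E V b x v)) h6

end Chain

variable {n : ℕ}
  {E : Type*} [NormedAddCommGroup E] [NormedSpace ℝ E]
  {M : Type*} [TopologicalSpace M] [ChartedSpace E M]
  {E' : Type*} [NormedAddCommGroup E'] [NormedSpace ℝ E']
  {X : Type*} [TopologicalSpace X] [ChartedSpace E' X]
  [AddAction (Fin n → UnitAddCircle) X] {ι : Type*}
  {V : Type*} [NormedAddCommGroup V] [NormedSpace ℝ V]

/-- The infinitesimal torus action at `x`: the vector `t ∈ ℝⁿ` is sent to `∑ t_J ∂/∂θ_J`. -/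
def fundMap (x : X) : (Fin n → ℝ) →L[ℝ] E' :=
  tmap (Fin n → ℝ) E' (fun θ : Fin n → ℝ => torusPt θ +ᵥ x) 0

lemma fundMap_eq_sum (x : X) (t : Fin n → ℝ) :
    fundMap (E' := E') x t = ∑ J, t J • fundMap (E' := E') x (Pi.single J 1) := by
  conv_lhs => rw [pi_eq_sum_univ' t]
  rw [map_sum]
  refine Finset.sum_congr rfl fun J _ => ?_
  rw [map_smul]

/-- The map `(v, θ) ↦ θ + g v` obtained from `g : V → X` by letting the torus act. -/
def torusFlow (g : V → X) (q : V × (Fin n → ℝ)) : X := torusPt q.2 +ᵥ g q.1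

lemma torusFlow_add (g : V → X) (q : V × (Fin n → ℝ)) (s : Fin n → ℝ) :
    torusFlow g (q + (0, s)) = torusPt s +ᵥ torusFlow g q := by
  simp only [torusFlow, Prod.fst_add, Prod.snd_add, add_zero, torusPt_add, vadd_vadd]
  rw [add_comm]

lemma torusFlow_zero (g : V → X) (v : V) : torusFlow g (v, (0 : Fin n → ℝ)) = g v := by
  simp [torusFlow, torusPt_zero]

namespace PrincipalTorusBundle

variable (P : PrincipalTorusBundle n E M E' X ι)

include P in
lemma contMDiff_vadd (t : Fin n → UnitAddCircle) :
    ContMDiff 𝓘(ℝ, E') 𝓘(ℝ, E') ∞ (fun y : X => t +ᵥ y) := by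
  obtain ⟨θ, rfl⟩ := exists_torusPt_eq t
  exact P.smooth_action.comp (contMDiff_const.prodMk contMDiff_id)

include P in
lemma contMDiff_orbit (x : X) :
    ContMDiff 𝓘(ℝ, Fin n → ℝ) 𝓘(ℝ, E') ∞ (fun θ : Fin n → ℝ => torusPt θ +ᵥ x) :=
  P.smooth_action.comp (contMDiff_id.prodMk contMDiff_const)

include P in
lemma mdifferentiableAt_orbit (x : X) (θ : Fin n → ℝ) :
    MDifferentiableAt 𝓘(ℝ, Fin n → ℝ) 𝓘(ℝ, E') (fun θ : Fin n → ℝ => torusPt θ +ᵥ x) θ :=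
  (P.contMDiff_orbit x θ).mdifferentiableAt (by simp)

include P in
lemma contMDiffAt_torusFlow {g : V → X} {q : V × (Fin n → ℝ)}
    (hg : ContMDiffAt 𝓘(ℝ, V) 𝓘(ℝ, E') ∞ g q.1) :
    ContMDiffAt 𝓘(ℝ, V × (Fin n → ℝ)) 𝓘(ℝ, E') ∞
      (torusFlow (n := n) g) q := by
  have h1 : ContMDiffAt 𝓘(ℝ, V × (Fin n → ℝ)) 𝓘(ℝ, V) ∞ Prod.fst q :=
    contDiffAt_fst.contMDiffAt
  have h2 : ContMDiffAt 𝓘(ℝ, V × (Fin n → ℝ)) 𝓘(ℝ, Fin n → ℝ) ∞ Prod.snd q :=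
    contDiffAt_snd.contMDiffAt
  exact P.smooth_action.contMDiffAt.comp q (h2.prodMk (hg.comp q h1))

include P in
lemma mdifferentiableAt_vadd (t : Fin n → UnitAddCircle) (x : X) :
    MDifferentiableAt 𝓘(ℝ, E') 𝓘(ℝ, E') (fun y : X => t +ᵥ y) x :=
  (P.contMDiff_vadd t x).mdifferentiableAt (by simp)

include P in
lemma tmap_vadd_fundMap (t : Fin n → UnitAddCircle) (x : X) (s : Fin n → ℝ) :
    tmap E' E' (fun y : X => t +ᵥ y) x (fundMap x s) = fundMap (t +ᵥ x) s := by
  have h0 : torusPt (0 : Fin n → ℝ) +ᵥ x = x := by rw [torusPt_zero, zero_vadd]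
  have h1 := tmap_comp_apply (x := (0 : Fin n → ℝ)) (P.mdifferentiableAt_vadd t _)
    (P.mdifferentiableAt_orbit x 0) s
  have h2 : (fun θ : Fin n → ℝ => t +ᵥ (torusPt θ +ᵥ x)) =
      fun θ : Fin n → ℝ => torusPt θ +ᵥ (t +ᵥ x) := by
    funext θ; simp only [vadd_vadd, add_comm]
  rw [h2, h0] at h1
  exact h1.symm

include P in
/-- The differential of the torus flow of `g` at `θ = 0`. -/
lemma tmap_torusFlow {g : V → X} {v : V} (hg : ContMDiffAt 𝓘(ℝ, V) 𝓘(ℝ, E') ∞ g v)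
    (u : V) (t : Fin n → ℝ) :
    tmap (V × (Fin n → ℝ)) E' (torusFlow (n := n) g) (v, 0) (u, t) =
      tmap V E' g v u + fundMap (g v) t := by
  have hG : MDifferentiableAt 𝓘(ℝ, V × (Fin n → ℝ)) 𝓘(ℝ, E') (torusFlow g)
      (v, (0 : Fin n → ℝ)) :=
    (P.contMDiffAt_torusFlow (q := (v, 0)) hg).mdifferentiableAt (by simp)
  have h1 : HasFDerivAt (fun v : V => (v, (0 : Fin n → ℝ)))
      (ContinuousLinearMap.inl ℝ V (Fin n → ℝ)) v :=
    (hasFDerivAt_id v).prodMk (hasFDerivAt_const (0 : Fin n → ℝ) v)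
  have h2 : HasFDerivAt (fun θ : Fin n → ℝ => (v, θ))
      (ContinuousLinearMap.inr ℝ V (Fin n → ℝ)) 0 :=
    (hasFDerivAt_const v (0 : Fin n → ℝ)).prodMk (hasFDerivAt_id _)
  have h3 := tmap_comp_apply (g := torusFlow g) (f := fun v : V => (v, (0 : Fin n → ℝ))) (x := v)
    hG h1.differentiableAt.mdifferentiableAt u
  have h4 := tmap_comp_apply (g := torusFlow g) (f := fun θ : Fin n → ℝ => (v, θ)) (x := 0)
    hG h2.differentiableAt.mdifferentiableAt t
  have h5 : (fun v : V => torusFlow g (v, (0 : Fin n → ℝ))) = g :=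
    funext fun v => torusFlow_zero g v
  rw [h5, tmap_of_hasFDerivAt h1] at h3
  rw [tmap_of_hasFDerivAt h2] at h4
  have h6 : fundMap (E' := E') (g v) t = _ := h4
  rw [h3, h6, ← map_add]
  congr 1
  simp

include P in
lemma tmap_orbit (x : X) (θ t : Fin n → ℝ) :
    tmap (Fin n → ℝ) E' (fun θ : Fin n → ℝ => torusPt θ +ᵥ x) θ t =
      fundMap (torusPt θ +ᵥ x) t := by
  have h1 : HasFDerivAt (fun s : Fin n → ℝ => s - θ) (ContinuousLinearMap.id ℝ (Fin n → ℝ)) θ :=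
    (hasFDerivAt_id θ).sub_const θ
  have h2 := tmap_comp_apply (g := fun s : Fin n → ℝ => torusPt s +ᵥ (torusPt θ +ᵥ x))
    (f := fun s : Fin n → ℝ => s - θ) (x := θ)
    (P.mdifferentiableAt_orbit _ _) h1.differentiableAt.mdifferentiableAt t
  have h3 : (fun s : Fin n → ℝ => torusPt (s - θ) +ᵥ (torusPt θ +ᵥ x)) =
      fun s => torusPt s +ᵥ x := by
    funext s; rw [vadd_vadd, ← torusPt_add, sub_add_cancel]
  rw [h3, tmap_of_hasFDerivAt h1, sub_self] at h2
  exact h2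

lemma proj_coord {α : ι} {x : M} (hx : x ∈ P.U α) (θ : Fin n → ℝ) :
    P.proj (P.coord α x θ) = x := (P.chart α).proj_apply x hx θ

lemma proj_sec {α : ι} {x : M} (hx : x ∈ P.U α) : P.proj (P.sec α x) = x := by
  have := P.proj_coord hx 0
  rwa [coord, torusPt_zero, zero_vadd] at this

lemma sec_mem_patch {α : ι} {x : M} (hx : x ∈ P.U α) : P.sec α x ∈ P.patch α := by
  rw [patch, mem_preimage, P.proj_sec hx]; exact hx

lemma vadd_mem_patch {α : ι} (t : Fin n → UnitAddCircle) {y : X} (hy : y ∈ P.patch α) :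
    t +ᵥ y ∈ P.patch α := by
  rw [patch, mem_preimage, P.proj_vadd]; exact hy

lemma coord_eq_coord {α β : ι} {x : M} (hx : x ∈ P.U α ∩ P.U β) (θ : Fin n → ℝ) :
    P.coord α x θ = P.coord β x (θ + P.lam α β x) := by
  rw [coord, coord, P.lam_spec α β x hx, vadd_vadd, torusPt_add]

lemma contMDiffAt_coord {α : ι} {x : M} (hx : x ∈ P.U α) (θ : Fin n → ℝ) :
    ContMDiffAt (𝓘(ℝ, E).prod 𝓘(ℝ, Fin n → ℝ)) 𝓘(ℝ, E') ∞
      (fun q : M × (Fin n → ℝ) => P.coord α q.1 q.2) (x, θ) :=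
  ((P.chart α).localDiffeo ⟨(x, θ), hx, mem_univ θ⟩).contMDiffAt

lemma contMDiffAt_sec {α : ι} {x : M} (hx : x ∈ P.U α) :
    ContMDiffAt 𝓘(ℝ, E) 𝓘(ℝ, E') ∞ (P.sec α) x := by
  have h := (P.contMDiffAt_coord hx 0).comp x
    (contMDiffAt_id.prodMk (contMDiffAt_const (c := (0 : Fin n → ℝ))))
  have h2 : (fun q : M × (Fin n → ℝ) => P.coord α q.1 q.2) ∘ (fun x : M => (x, (0 : Fin n → ℝ)))
      = P.sec α := by
    funext z; simp [coord, torusPt_zero]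
  exact h2 ▸ h

lemma mdifferentiableAt_sec {α : ι} {x : M} (hx : x ∈ P.U α) :
    MDifferentiableAt 𝓘(ℝ, E) 𝓘(ℝ, E') (P.sec α) x :=
  (P.contMDiffAt_sec hx).mdifferentiableAt (by simp)

/-- The differential of the coordinates at `(x, θ)`. -/
lemma dPair_coord {α : ι} {x : M} (hx : x ∈ P.U α) (θ : Fin n → ℝ) (v : E) (t : Fin n → ℝ) :
    dPair E E' (P.coord α) x θ (v, t) =
    tmap E' E' (fun y : X => torusPt θ +ᵥ y) (P.sec α x)
      (tmap E E' (P.sec α) x v + fundMap (P.sec α x) t) := by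
  have h1 := dPair_apply ((P.contMDiffAt_coord hx θ).mdifferentiableAt (by simp)) v t
  have h2 : tmap E E' (fun z => P.coord α z θ) x v = _ :=
    tmap_comp_apply (P.mdifferentiableAt_vadd (torusPt θ) (P.sec α x))
      (P.mdifferentiableAt_sec hx) v
  rw [map_add, P.tmap_vadd_fundMap, ← P.tmap_orbit, ← h2]
  exact h1

lemma tmap_proj_sec {α : ι} {x : M} (hx : x ∈ P.U α) (v : E) :
    tmap E' E P.proj (P.sec α x) (tmap E E' (P.sec α) x v) = v := by
  rw [← tmap_comp_apply ((P.smooth_proj (P.sec α x)).mdifferentiableAt (by simp))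
    (P.mdifferentiableAt_sec hx)]
  have h2 : (fun x => P.proj (P.sec α x)) =ᶠ[𝓝 x] fun x => x := by
    filter_upwards [(P.isOpen_U α).mem_nhds hx] with z hz using P.proj_sec hz
  rw [tmap_congr h2, tmap_id]
  rfl

lemma tmap_proj_fundMap (x : X) (t : Fin n → ℝ) :
    tmap E' E P.proj x (fundMap x t) = 0 := by
  have h0 : torusPt (0 : Fin n → ℝ) +ᵥ x = x := by rw [torusPt_zero, zero_vadd]
  have h1 := tmap_comp_apply (x := (0 : Fin n → ℝ))
    ((P.smooth_proj _).mdifferentiableAt (by simp)) (P.mdifferentiableAt_orbit x 0) t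
  rw [h0] at h1
  have h2 : (fun θ : Fin n → ℝ => P.proj (torusPt θ +ᵥ x)) = fun _ => P.proj x := by
    funext θ; exact P.proj_vadd _ _
  rw [h2, tmap_const] at h1
  exact h1.symm

lemma tmap_proj_vadd (t : Fin n → UnitAddCircle) (x : X) (v : E') :
    tmap E' E P.proj (t +ᵥ x) (tmap E' E' (fun y : X => t +ᵥ y) x v) = tmap E' E P.proj x v := by
  rw [← tmap_comp_apply ((P.smooth_proj (t +ᵥ x)).mdifferentiableAt (by simp))
    (P.mdifferentiableAt_vadd t x)]
  have h2 : (fun y : X => P.proj (t +ᵥ y)) = P.proj := funext fun y => P.proj_vadd _ _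
  rw [h2]

/-- Every tangent vector of `X` over `U α` is, up to the torus action, the sum of a vector tangent
to the section `sec α` and a vertical one. -/
lemma exists_eq_coord {α : ι} {y : X} (hy : y ∈ P.patch α) :
    ∃ θ : Fin n → ℝ, y = torusPt θ +ᵥ P.sec α (P.proj y) ∧
      ∀ v : E', ∃ (u : E) (t : Fin n → ℝ),
        v = tmap E' E' (fun y : X => torusPt θ +ᵥ y) (P.sec α (P.proj y))
          (tmap E E' (P.sec α) (P.proj y) u + fundMap (P.sec α (P.proj y)) t) := by
  obtain ⟨θ, hθ⟩ := (P.chart α).exists_coord y hy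
  refine ⟨θ, hθ.symm, fun v => ?_⟩
  have hl := (P.chart α).localDiffeo ⟨(P.proj y, θ), hy, mem_univ θ⟩
  obtain ⟨⟨u, t⟩, hut⟩ := (hl.mfderivToContinuousLinearEquiv (by simp)).surjective v
  exact ⟨u, t, hut.symm.trans (P.dPair_coord hy θ u t)⟩

end PrincipalTorusBundle

/-! ### Local connection forms and horizontal lifts -/

section ConnectionForms

variable {P : PrincipalTorusBundle n E M E' X ι} (Θ : TorusConnection P)

namespace TorusConnection

lemma form_fundMap (I : Fin n) (x : X) (t : Fin n → ℝ) :
    Θ.form I x (fundMap (E' := E') x t) = t I := by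
  have h : Θ.form I x (∑ J, t J • fundMap (E' := E') x (Pi.single J 1)) =
      ∑ J, t J * Θ.form I x (fundVec J x) := by
    refine (map_sum (Θ.form I x) _ _).trans (Finset.sum_congr rfl fun J _ => ?_)
    exact map_smul (Θ.form I x) _ _
  refine (congrArg (fun z : E' => Θ.form I x z) (fundMap_eq_sum x t)).trans (h.trans ?_)
  simp [Θ.vertical]

/-- The local connection form `A_α = sec_α^* Θ`. -/
def potential (α : ι) (I : Fin n) : OneForm E M := fun x =>
  (Θ.form I (P.sec α x)).comp (mfderiv 𝓘(ℝ, E) 𝓘(ℝ, E') (P.sec α) x)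

lemma form_vadd (I : Fin n) (α : ι) (x : M) (θ : Fin n → ℝ) (u : E) (t : Fin n → ℝ) :
    Θ.form I (torusPt θ +ᵥ P.sec α x)
      (tmap E' E' (fun y : X => torusPt θ +ᵥ y) (P.sec α x)
          (tmap E E' (P.sec α) x u + fundMap (P.sec α x) t)) =
      t I + Θ.potential α I x u := by
  let z : E' := tmap E E' (P.sec α) x u + fundMap (P.sec α x) t
  refine (Θ.invariant I (torusPt θ) (P.sec α x) z).trans ?_
  refine (map_add (Θ.form I (P.sec α x)) _ _).trans ?_
  rw [Θ.form_fundMap, add_comm]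
  rfl

lemma isLocallyCoordPlus (α : ι) (I : Fin n) :
    IsLocallyCoordPlus (P.U α) (P.coord α) I (Θ.potential α I) (Θ.form I) := by
  intro x hx w v t
  refine Eq.trans ?_ (Θ.form_vadd I α x w v t)
  exact congrArg (fun z : E' => Θ.form I (P.coord α x w) z) (P.dPair_coord hx w v t)

/-- The values at `x` of the local connection form, as a linear map to `ℝⁿ`. -/
def potentialMap (α : ι) (x : M) : E →L[ℝ] (Fin n → ℝ) :=
  ContinuousLinearMap.pi fun J => (Θ.potential α J x : E →L[ℝ] ℝ)

/-- The horizontal lift of a tangent vector of `M` to the point `sec α x`. -/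
def lift (α : ι) (x : M) : E →L[ℝ] E' :=
  tmap E E' (P.sec α) x - (fundMap (P.sec α x)).comp (Θ.potentialMap α x)

lemma tmap_sec_add (α : ι) (x : M) (u : E) (t : Fin n → ℝ) :
    tmap E E' (P.sec α) x u + fundMap (P.sec α x) t =
      Θ.lift α x u + fundMap (P.sec α x) (t + Θ.potentialMap α x u) := by
  rw [map_add, lift]
  simp only [_root_.sub_apply, ContinuousLinearMap.comp_apply]
  abel

end TorusConnection

end ConnectionForms

/-! ### Reduction of invariant two-forms to the base -/

section ModelForms

variable {E : Type*} [NormedAddCommGroup E] [NormedSpace ℝ E]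
  {X : Type*} [TopologicalSpace X] [ChartedSpace E X]
  {V : Type*} [NormedAddCommGroup V] [NormedSpace ℝ V]

/-- The value of a `1`-form at a point, as a linear form on the model space. -/
def formAt (η : OneForm E X) (x : X) : E →L[ℝ] ℝ := η x

/-- The value of a `2`-form at a point, as a bilinear form on the model space. -/
def bilinAt (B : TwoForm E X) (x : X) : E →L[ℝ] E →L[ℝ] ℝ := B x

lemma pullOne_eq_formAt (η : OneForm E X) (g : V → X) (v u : V) :
    pullOne η g v u = formAt η (g v) (tmap V E g v u) := rfl

lemma pullTwo_eq_bilinAt (B : TwoForm E X) (g : V → X) (v u u' : V) :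
    pullTwo B g v u u' = bilinAt B (g v) (tmap V E g v u) (tmap V E g v u') := rfl

lemma IsSmoothTwoFormOn.bilinAt_self {B : TwoForm E X} {U : Set X} (hB : IsSmoothTwoFormOn B U)
    {x : X} (hx : x ∈ U) (v : E) : bilinAt B x v v = 0 := hB.alternating x hx v

lemma IsSmoothTwoFormOn.bilinAt_swap {B : TwoForm E X} {U : Set X} (hB : IsSmoothTwoFormOn B U)
    {x : X} (hx : x ∈ U) (v w : E) : bilinAt B x v w = -bilinAt B x w v := by
  have h := hB.bilinAt_self hx (v + w)
  simp only [map_add, _root_.add_apply] at h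
  rw [hB.bilinAt_self hx, hB.bilinAt_self hx] at h
  linarith

end ModelForms

variable {n : ℕ}
  {E : Type*} [NormedAddCommGroup E] [NormedSpace ℝ E]
  {M : Type*} [TopologicalSpace M] [ChartedSpace E M]
  {E' : Type*} [NormedAddCommGroup E'] [NormedSpace ℝ E']
  {X : Type*} [TopologicalSpace X] [ChartedSpace E' X]
  [AddAction (Fin n → UnitAddCircle) X] {ι : Type*}
  {V : Type*} [NormedAddCommGroup V] [NormedSpace ℝ V]

section ReducedForms

variable {P : PrincipalTorusBundle n E M E' X ι} (Θ : TorusConnection P)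
  (𝒢 : GerbeWithConnection.{w} (E := E') P.patch)

lemma IsTorusInvariant.bilinAt_vadd {𝒢 : GerbeWithConnection.{w} (E := E') P.patch}
    (h𝒢 : IsTorusInvariant P 𝒢) {α : ι}
    (t : Fin n → UnitAddCircle) {x : X} (hx : x ∈ P.patch α) (v w : E') :
    bilinAt (𝒢.B α) (t +ᵥ x) (tmap E' E' (fun y : X => t +ᵥ y) x v)
      (tmap E' E' (fun y : X => t +ᵥ y) x w) = bilinAt (𝒢.B α) x v w :=
  h𝒢 α t x hx v w

/-- The matrix `B_{0α}`: the values of `B_α` on the fundamental vector fields along `sec α`. -/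
def red₀ (α : ι) (x : M) : Matrix (Fin n) (Fin n) ℝ := Matrix.of fun I J =>
  bilinAt (𝒢.B α) (P.sec α x) (fundMap (P.sec α x) (Pi.single I 1))
    (fundMap (P.sec α x) (Pi.single J 1))

/-- The forms `B_{1α}^I`: one horizontal argument and one fundamental vector field. -/
def red₁ (α : ι) (I : Fin n) : OneForm E M := fun x =>
  ((bilinAt (𝒢.B α) (P.sec α x)).flip (fundMap (P.sec α x) (Pi.single I 1))).comp (Θ.lift α x)

/-- The form `B_{2α}`: two horizontal arguments. -/
def red₂ (α : ι) : TwoForm E M := fun x =>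
  let b : E →L[ℝ] E →L[ℝ] ℝ :=
    (bilinAt (𝒢.B α) (P.sec α x)).bilinearComp (Θ.lift α x) (Θ.lift α x)
  b

lemma red₀_apply (α : ι) (x : M) (I J : Fin n) :
    red₀ 𝒢 α x I J = bilinAt (𝒢.B α) (P.sec α x) (fundMap (P.sec α x) (Pi.single I 1))
      (fundMap (P.sec α x) (Pi.single J 1)) := rfl

lemma red₂_apply (α : ι) (x : M) (u u' : E) :
    bilinAt (red₂ Θ 𝒢 α) x u u' =
      bilinAt (𝒢.B α) (P.sec α x) (Θ.lift α x u) (Θ.lift α x u') := rfl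

lemma red₀_skew {α : ι} {x : M} (hx : x ∈ P.U α) (I J : Fin n) :
    red₀ 𝒢 α x J I = -red₀ 𝒢 α x I J :=
  (𝒢.smooth_B α).bilinAt_swap (P.sec_mem_patch hx) _ _

/-- The components of an invariant form in vertical directions depend only on the base point. -/
lemma bilinAt_fundMap {𝒢 : GerbeWithConnection.{w} (E := E') P.patch}
    (h𝒢 : IsTorusInvariant P 𝒢) {α : ι} {y : X} (hy : y ∈ P.patch α) (I J : Fin n) :
    bilinAt (𝒢.B α) y (fundMap y (Pi.single I 1)) (fundMap y (Pi.single J 1)) =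
      red₀ 𝒢 α (P.proj y) I J := by
  obtain ⟨θ, hθ, -⟩ := P.exists_eq_coord hy
  have h := h𝒢.bilinAt_vadd (torusPt θ) (P.sec_mem_patch (α := α) (x := P.proj y) hy)
    (fundMap (P.sec α (P.proj y)) (Pi.single I 1)) (fundMap (P.sec α (P.proj y)) (Pi.single J 1))
  rw [P.tmap_vadd_fundMap, P.tmap_vadd_fundMap, ← hθ] at h
  exact h

lemma bilin_fundMap_right (b : E' →L[ℝ] ℝ) (x : X) (t : Fin n → ℝ) :
    b (fundMap x t) = ∑ J, t J * b (fundMap x (Pi.single J 1)) := by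
  rw [fundMap_eq_sum, map_sum]
  simp only [map_smul, smul_eq_mul]

lemma bilin_fundMap_left (b : E' →L[ℝ] E' →L[ℝ] ℝ) (x : X) (t : Fin n → ℝ) (v : E') :
    b (fundMap x t) v = ∑ J, t J * b (fundMap x (Pi.single J 1)) v :=
  bilin_fundMap_right (b.flip v) x t

/-- The decomposition `B_α = B_{2α} + B_{1α}^I ∧ Θ_I + ½ B_{0α}^{IJ} Θ_I ∧ Θ_J`. -/
lemma bilinAt_eq_red {𝒢 : GerbeWithConnection.{w} (E := E') P.patch}
    (h𝒢 : IsTorusInvariant P 𝒢) {α : ι} {y : X} (hy : y ∈ P.patch α) (v w : E') :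
    bilinAt (𝒢.B α) y v w =
      bilinAt (red₂ Θ 𝒢 α) (P.proj y) (tmap E' E P.proj y v) (tmap E' E P.proj y w)
      + ∑ I, (formAt (red₁ Θ 𝒢 α I) (P.proj y) (tmap E' E P.proj y v) * formAt (Θ.form I) y w
          - formAt (red₁ Θ 𝒢 α I) (P.proj y) (tmap E' E P.proj y w) * formAt (Θ.form I) y v)
      + 1 / 2 * ∑ I, ∑ J, red₀ 𝒢 α (P.proj y) I J *
          (formAt (Θ.form I) y v * formAt (Θ.form J) y w
            - formAt (Θ.form I) y w * formAt (Θ.form J) y v) := by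
  -- write both vectors as translates of vectors at `sec α x`, and those as horizontal plus vertical
  obtain ⟨θ, hθ, hv⟩ := P.exists_eq_coord hy
  obtain ⟨u, t, rfl⟩ := hv v
  obtain ⟨u', t', rfl⟩ := hv w
  set x := P.proj y with hxdef
  have hx : x ∈ P.U α := hy
  clear_value x
  subst hθ
  have hform : ∀ I (u : E) (t : Fin n → ℝ), formAt (Θ.form I) (torusPt θ +ᵥ P.sec α x)
      (tmap E' E' (fun y : X => torusPt θ +ᵥ y) (P.sec α x)
        (tmap E E' (P.sec α) x u + fundMap (P.sec α x) t)) = (t + Θ.potentialMap α x u) I :=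
    fun I u t => Θ.form_vadd I α x θ u t
  have hproj : ∀ (u : E) (t : Fin n → ℝ), tmap E' E P.proj (torusPt θ +ᵥ P.sec α x)
      (tmap E' E' (fun y : X => torusPt θ +ᵥ y) (P.sec α x)
        (tmap E E' (P.sec α) x u + fundMap (P.sec α x) t)) = u := by
    intro u t
    rw [P.tmap_proj_vadd, map_add, P.tmap_proj_sec hx, P.tmap_proj_fundMap, add_zero]
  simp only [hform, hproj]
  rw [h𝒢.bilinAt_vadd _ (P.sec_mem_patch hx), Θ.tmap_sec_add, Θ.tmap_sec_add]
  generalize t + Θ.potentialMap α x u = s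
  generalize t' + Θ.potentialMap α x u' = s'
  simp only [map_add, _root_.add_apply]
  have hB := (𝒢.smooth_B α).bilinAt_swap (P.sec_mem_patch hx)
  have h1 : bilinAt (𝒢.B α) (P.sec α x) (Θ.lift α x u) (fundMap (P.sec α x) s') =
      ∑ I, formAt (red₁ Θ 𝒢 α I) x u * s' I := by
    rw [bilin_fundMap_right]
    exact Finset.sum_congr rfl fun I _ => mul_comm _ _
  have h2 : bilinAt (𝒢.B α) (P.sec α x) (fundMap (P.sec α x) s) (Θ.lift α x u') =
      -∑ I, formAt (red₁ Θ 𝒢 α I) x u' * s I := by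
    rw [hB, bilin_fundMap_right]
    exact congrArg _ (Finset.sum_congr rfl fun I _ => mul_comm _ _)
  have h3 : ∀ s s' : Fin n → ℝ,
      bilinAt (𝒢.B α) (P.sec α x) (fundMap (P.sec α x) s) (fundMap (P.sec α x) s') =
      ∑ I, ∑ J, red₀ 𝒢 α x I J * (s I * s' J) := by
    intro s s'
    rw [bilin_fundMap_left]
    refine Finset.sum_congr rfl fun I _ => ?_
    rw [bilin_fundMap_right, Finset.mul_sum]
    refine Finset.sum_congr rfl fun J _ => ?_
    rw [red₀_apply]; ring
  have h4 : ∑ I, ∑ J, red₀ 𝒢 α x I J * (s I * s' J - s' I * s J) =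
      2 * ∑ I, ∑ J, red₀ 𝒢 α x I J * (s I * s' J) := by
    simp only [mul_sub, Finset.sum_sub_distrib]
    rw [← h3 s s', ← h3 s' s, hB (fundMap (P.sec α x) s') (fundMap (P.sec α x) s)]
    ring
  rw [h4, h1, h2, h3, ← red₂_apply, Finset.sum_sub_distrib]
  ring

section Smooth

variable [IsManifold 𝓘(ℝ, E') ∞ X]

lemma contMDiffAt_sec_comp {α : ι} {k : V → M} {v : V}
    (hk : ContMDiffAt 𝓘(ℝ, V) 𝓘(ℝ, E) ∞ k v) (h₀ : k v ∈ P.U α) :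
    ContMDiffAt 𝓘(ℝ, V) 𝓘(ℝ, E') ∞ (fun v => P.sec α (k v)) v :=
  (P.contMDiffAt_sec h₀).comp v hk

/-- In a parametrization `k` of the base, horizontal lifts along `sec α` are images under the
torus flow of vectors `(u, -A_α u)`; this is the inclusion `u ↦ (u, -A_α u)`. -/
def liftParam (α : ι) (k : V → M) (v : V) : V →L[ℝ] V × (Fin n → ℝ) :=
  ContinuousLinearMap.inl ℝ V (Fin n → ℝ) - ∑ J : Fin n,
    (pullOne (Θ.form J) (fun v => P.sec α (k v)) v).smulRight
      ((0, Pi.single J 1) : V × (Fin n → ℝ))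

lemma contDiffAt_liftParam {α : ι} {k : V → M} {v₀ : V}
    (hk : ContMDiffAt 𝓘(ℝ, V) 𝓘(ℝ, E) ∞ k v₀) (h₀ : k v₀ ∈ P.U α) :
    ContDiffAt ℝ ∞ (liftParam Θ α k) v₀ := by
  refine contDiffAt_const.sub (ContDiffAt.sum fun J _ => ?_)
  have h := (Θ.smooth J).contDiffAt_pullOne (contMDiffAt_sec_comp hk h₀) (mem_univ _)
  exact (((ContinuousLinearMap.smulRightL ℝ V (V × (Fin n → ℝ))).flip
    (0, Pi.single J 1)).contDiff.contDiffAt).comp v₀ h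

lemma liftParam_apply (α : ι) (k : V → M) (v u : V) :
    liftParam Θ α k v u = (u, fun J => -pullOne (Θ.form J) (fun v => P.sec α (k v)) v u) := by
  refine Prod.ext ?_ (funext fun J => ?_)
  · simp [liftParam, Prod.fst_sum]
  · simp [liftParam, Prod.snd_sum, Finset.sum_apply, Pi.single_apply]

lemma tmap_liftParam {α : ι} {k : V → M} {v : V}
    (hk : ContMDiffAt 𝓘(ℝ, V) 𝓘(ℝ, E) ∞ k v) (h₀ : k v ∈ P.U α) (u : V) :
    tmap (V × (Fin n → ℝ)) E' (torusFlow (n := n) fun v => P.sec α (k v)) (v, 0)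
      (liftParam Θ α k v u) = Θ.lift α (k v) (tmap V E k v u) := by
  rw [liftParam_apply, P.tmap_torusFlow (contMDiffAt_sec_comp hk h₀)]
  have h1 := tmap_comp_apply (P.mdifferentiableAt_sec h₀) (hk.mdifferentiableAt (by simp)) u
  have h2 : (fun J => -pullOne (Θ.form J) (fun v => P.sec α (k v)) v u) =
      -Θ.potentialMap α (k v) (tmap V E k v u) := by
    funext J
    rw [pullOne_eq_formAt, h1]
    rfl
  rw [h1, h2, map_neg, ← sub_eq_add_neg]
  rfl

lemma tmap_torusFlow_single {α : ι} {k : V → M} {v : V}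
    (hk : ContMDiffAt 𝓘(ℝ, V) 𝓘(ℝ, E) ∞ k v) (h₀ : k v ∈ P.U α) (t : Fin n → ℝ) :
    tmap (V × (Fin n → ℝ)) E' (torusFlow (n := n) fun v => P.sec α (k v)) (v, 0) (0, t) =
      fundMap (P.sec α (k v)) t := by
  rw [P.tmap_torusFlow (contMDiffAt_sec_comp hk h₀), map_zero, zero_add]

/-- Pulling back along the torus flow of the section evaluates `B_α` on tangent vectors of the
section and on fundamental vector fields at the same time; the smoothness of the reduced forms follows. -/
lemma contDiffAt_pullTwo_torusFlow {α : ι} {k : V → M} {v₀ : V}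
    (hk : ContMDiffAt 𝓘(ℝ, V) 𝓘(ℝ, E) ∞ k v₀) (h₀ : k v₀ ∈ P.U α) :
    ContDiffAt ℝ ∞ (fun v => pullTwo (𝒢.B α) (torusFlow (n := n) fun v => P.sec α (k v))
      (v, (0 : Fin n → ℝ))) v₀ := by
  have h1 : ContMDiffAt 𝓘(ℝ, V × (Fin n → ℝ)) 𝓘(ℝ, E') ∞
      (torusFlow (n := n) fun v => P.sec α (k v)) (v₀, 0) :=
    P.contMDiffAt_torusFlow (contMDiffAt_sec_comp hk h₀)
  have h2 := (𝒢.smooth_B α).contDiffAt_pullTwo h1 (by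
    rw [torusFlow_zero]; exact P.sec_mem_patch h₀)
  exact ContDiffAt.comp v₀ h2 (contDiffAt_id.prodMk contDiffAt_const)

variable [IsManifold 𝓘(ℝ, E) ∞ M]

lemma eventually_extChartAt_symm {x₀ : M} {U : Set M} (hU : IsOpen U) (h₀ : x₀ ∈ U) :
    ∀ᶠ z in 𝓝 (extChartAt 𝓘(ℝ, E) x₀ x₀),
      ContMDiffAt 𝓘(ℝ, E) 𝓘(ℝ, E) ∞ (extChartAt 𝓘(ℝ, E) x₀).symm z ∧
        (extChartAt 𝓘(ℝ, E) x₀).symm z ∈ U := by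
  have h1 := (isOpen_extChartAt_target (I := 𝓘(ℝ, E)) x₀).mem_nhds (mem_extChartAt_target x₀)
  have h2 := (continuousAt_extChartAt_symm (I := 𝓘(ℝ, E)) x₀).preimage_mem_nhds
    (hU.mem_nhds (by rwa [extChartAt_to_inv]))
  filter_upwards [h1, h2] with z hz hz'
  exact ⟨(contMDiffOn_extChartAt_symm (n := ∞) x₀ z hz).contMDiffAt
    ((isOpen_extChartAt_target x₀).mem_nhds hz), hz'⟩

lemma smoothOneFormOn_potential (α : ι) (I : Fin n) :
    SmoothOneFormOn (Θ.potential α I) (P.U α) := by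
  intro x₀ hx
  obtain ⟨hk, h₀⟩ := (eventually_extChartAt_symm (E := E) (P.isOpen_U α) hx).self_of_nhds
  refine ((Θ.smooth I).contDiffAt_pullOne (contMDiffAt_sec_comp hk h₀)
    (mem_univ _)).congr_of_eventuallyEq ?_
  filter_upwards [eventually_extChartAt_symm (E := E) (P.isOpen_U α) hx] with z hz
  refine ContinuousLinearMap.ext fun u => ?_
  exact (congrArg (formAt (Θ.form I) _) (tmap_comp_apply (P.mdifferentiableAt_sec hz.2)
    (hz.1.mdifferentiableAt (by simp)) u)).symm

lemma smoothOneFormOn_red₁ (α : ι) (I : Fin n) : SmoothOneFormOn (red₁ Θ 𝒢 α I) (P.U α) := by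
  intro x₀ hx
  obtain ⟨hk, h₀⟩ := (eventually_extChartAt_symm (E := E) (P.isOpen_U α) hx).self_of_nhds
  have h1 := contDiffAt_pullTwo_torusFlow 𝒢 hk h₀
  have hK := contDiffAt_liftParam Θ hk h₀
  have hw := contDiffAt_const (𝕜 := ℝ) (n := ∞) (x := extChartAt 𝓘(ℝ, E) x₀ x₀)
    (c := ContinuousLinearMap.apply ℝ ℝ ((0, Pi.single I 1) : E × (Fin n → ℝ)))
  refine ((hw.clm_comp h1).clm_comp hK).congr_of_eventuallyEq ?_
  filter_upwards [eventually_extChartAt_symm (E := E) (P.isOpen_U α) hx] with z hz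
  refine ContinuousLinearMap.ext fun u => ?_
  rw [ContinuousLinearMap.comp_apply, ContinuousLinearMap.comp_apply,
    ContinuousLinearMap.apply_apply, pullTwo_eq_bilinAt, tmap_liftParam Θ hz.1 hz.2,
    tmap_torusFlow_single hz.1 hz.2, torusFlow_zero]
  rfl

lemma isSmoothTwoFormOn_red₂ (α : ι) : IsSmoothTwoFormOn (red₂ Θ 𝒢 α) (P.U α) := by
  refine ⟨fun x hx v => (𝒢.smooth_B α).bilinAt_self (P.sec_mem_patch hx) _, fun x₀ hx => ?_⟩
  obtain ⟨hk, h₀⟩ := (eventually_extChartAt_symm (E := E) (P.isOpen_U α) hx).self_of_nhds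
  refine ((contDiffAt_pullTwo_torusFlow 𝒢 hk h₀).bilinearComp_clm
    (contDiffAt_liftParam Θ hk h₀)).congr_of_eventuallyEq ?_
  filter_upwards [eventually_extChartAt_symm (E := E) (P.isOpen_U α) hx] with z hz
  refine ContinuousLinearMap.ext fun u => ContinuousLinearMap.ext fun u' => ?_
  rw [ContinuousLinearMap.bilinearComp_apply, pullTwo_eq_bilinAt, tmap_liftParam Θ hz.1 hz.2,
    tmap_liftParam Θ hz.1 hz.2, torusFlow_zero]
  rfl

lemma contMDiffOn_red₀ (α : ι) (I J : Fin n) :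
    ContMDiffOn 𝓘(ℝ, E) 𝓘(ℝ, ℝ) ∞ (fun x => red₀ 𝒢 α x I J) (P.U α) := by
  intro x₀ hx
  refine ContMDiffAt.contMDiffWithinAt ?_
  obtain ⟨hk, h₀⟩ := (eventually_extChartAt_symm (E := E) (P.isOpen_U α) hx).self_of_nhds
  have h1 := contDiffAt_pullTwo_torusFlow 𝒢 hk h₀
  have h2 : ContDiffAt ℝ ∞ _ _ :=
    (h1.clm_apply (contDiffAt_const (c := (0, Pi.single I 1)))).clm_apply
      (contDiffAt_const (c := (0, Pi.single J 1)))
  have h3 := h2.contMDiffAt.comp x₀ (contMDiffAt_extChartAt (n := ∞))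
  refine h3.congr_of_eventuallyEq ?_
  filter_upwards [(continuousAt_extChartAt (I := 𝓘(ℝ, E)) x₀).eventually
    (eventually_extChartAt_symm (E := E) (P.isOpen_U α) hx),
    (isOpen_extChartAt_source (I := 𝓘(ℝ, E)) x₀).mem_nhds (mem_extChartAt_source x₀)] with x hz hs
  rw [Function.comp_apply, pullTwo_eq_bilinAt, tmap_torusFlow_single hz.1 hz.2,
    tmap_torusFlow_single hz.1 hz.2, torusFlow_zero, (extChartAt 𝓘(ℝ, E) x₀).left_inv hs]
  rfl

end Smooth

end ReducedForms

/-! ### Real logarithms of circle-valued functions -/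

section RealLog

variable {V : Type*} [NormedAddCommGroup V] [NormedSpace ℝ V]

lemma circle_exp_eq_one_iff {a : ℝ} : Circle.exp (2 * Real.pi * a) = 1 ↔ ∃ k : ℤ, a = k := by
  rw [← Circle.exp_zero, Circle.exp_eq_exp]
  refine exists_congr fun k => ?_
  have := Real.pi_pos
  constructor
  · intro h
    have h2 : 2 * Real.pi * (a - k) = 0 := by linarith
    have h3 := (mul_eq_zero.1 h2).resolve_left (by positivity)
    linarith
  · rintro rfl; ring

/-- A continuous real logarithm of a differentiable circle-valued function is differentiable. -/
lemma hasFDerivAt_of_hasDLog {f : V → Circle} {ℓ : V →L[ℝ] ℝ} {v₀ : V} {u : V → ℝ}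
    (hf : HasDLogWithinAt f ℓ univ v₀) (hu : ContinuousAt u v₀)
    (hfu : ∀ᶠ v in 𝓝 v₀, Circle.exp (2 * Real.pi * u v) = f v) : HasFDerivAt u ℓ v₀ := by
  have h1 : HasFDerivAt (fun v => ((f v / f v₀ : Circle) : ℂ)) (twoPiIForm 1 ℓ) v₀ := by
    have := (hf.div (HasDLogWithinAt.const (f v₀))).hasFDerivAt (by simp)
    simpa using this
  have hone : ((f v₀ / f v₀ : Circle) : ℂ) = 1 := by simp
  have h2 : HasFDerivAt (fun v => Complex.log ((f v / f v₀ : Circle) : ℂ)) _ v₀ :=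
    ((Complex.hasStrictDerivAt_log (by rw [hone]; exact Complex.one_mem_slitPlane)
      ).hasDerivAt.hasFDerivAt.restrictScalars ℝ).comp v₀ h1
  have h3 := (Complex.imCLM.hasFDerivAt.comp v₀ h2).const_mul ((2 * Real.pi)⁻¹)
  have h4 : u =ᶠ[𝓝 v₀] fun v => (2 * Real.pi)⁻¹ *
      (Complex.imCLM ∘ fun v => Complex.log ((f v / f v₀ : Circle) : ℂ)) v + u v₀ := by
    have h5 : ∀ᶠ v in 𝓝 v₀, |u v - u v₀| < 1 / 2 := by
      have := Metric.continuousAt_iff'.1 hu (1 / 2) (by norm_num)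
      simpa [Real.dist_eq] using this
    -- there `f v / f v₀ = exp (2πi (u v - u v₀))` lies in the domain of the principal logarithm
    filter_upwards [hfu, h5] with v hv hv5
    rw [abs_lt] at hv5
    have hpi := Real.pi_pos
    have h6 : ((f v / f v₀ : Circle) : ℂ) =
        Complex.exp ((2 * Real.pi * (u v - u v₀) : ℝ) * Complex.I) := by
      rw [← Circle.coe_exp, mul_sub, Circle.exp_sub, hv, hfu.self_of_nhds]
    change u v = (2 * Real.pi)⁻¹ * (Complex.log ((f v / f v₀ : Circle) : ℂ)).im + u v₀
    have him : (((2 * Real.pi * (u v - u v₀) : ℝ) : ℂ) * Complex.I).im =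
        2 * Real.pi * (u v - u v₀) := by simp
    rw [h6, Complex.log_exp (by rw [him]; nlinarith) (by rw [him]; nlinarith), him]
    field_simp
    ring
  refine ((h3.add_const (u v₀)).congr_of_eventuallyEq h4).congr_fderiv ?_
  ext x
  simp [twoPiIForm_apply]
  field_simp

end RealLog

variable {n : ℕ}
  {E : Type*} [NormedAddCommGroup E] [NormedSpace ℝ E]
  {M : Type*} [TopologicalSpace M] [ChartedSpace E M]
  {E' : Type*} [NormedAddCommGroup E'] [NormedSpace ℝ E']
  {X : Type*} [TopologicalSpace X] [ChartedSpace E' X]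
  [AddAction (Fin n → UnitAddCircle) X] {ι : Type*}
  {V : Type*} [NormedAddCommGroup V] [NormedSpace ℝ V]

/-! ### The holonomy around circle orbits -/

section FibreHolonomy

variable {P : PrincipalTorusBundle n E M E' X ι}
  (𝒢 : GerbeWithConnection.{w} (E := E') P.patch)

/-- The difference `B_α - B_β`, the curvature of `L α β`. -/
def curv (α β : ι) : TwoForm E' X := fun x =>
  let b : E' →L[ℝ] E' →L[ℝ] ℝ := bilinAt (𝒢.B α) x - bilinAt (𝒢.B β) x
  b

lemma bilinAt_curv (α β : ι) (x : X) (v w : E') :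
    bilinAt (curv 𝒢 α β) x v w = bilinAt (𝒢.B α) x v w - bilinAt (𝒢.B β) x v w := rfl

/-- The holonomy of `L α β` around the orbit of the `I`-th circle through `y`. -/
def fibreHol (α β : ι) (I : Fin n) (y : X) : Circle :=
  (𝒢.L α β).hol fun t : ℝ => torusPt (t • (Pi.single I 1 : Fin n → ℝ)) +ᵥ y

section Loops

variable [IsManifold 𝓘(ℝ, E') ∞ X] {α β γ : ι} {y : X}

include P in
lemma contMDiff_circleOrbit (I : Fin n) (y : X) : ContMDiff 𝓘(ℝ, ℝ) 𝓘(ℝ, E') ∞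
    fun t : ℝ => torusPt (t • (Pi.single I 1 : Fin n → ℝ)) +ᵥ y := by
  have h : ContMDiff 𝓘(ℝ, ℝ) 𝓘(ℝ, Fin n → ℝ) ∞ fun t : ℝ => t • (Pi.single I 1 : Fin n → ℝ) := by
    refine ContDiff.contMDiff ?_
    fun_prop
  exact (P.contMDiff_orbit y).comp h

lemma circleOrbit_one (I : Fin n) (y : X) :
    torusPt ((1 : ℝ) • (Pi.single I 1 : Fin n → ℝ)) +ᵥ y =
      torusPt ((0 : ℝ) • (Pi.single I 1 : Fin n → ℝ)) +ᵥ y := by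
  rw [one_smul, zero_smul, torusPt_single_one, torusPt_zero]

lemma fibreHol_mul_swap (I : Fin n) (hα : y ∈ P.patch α) (hβ : y ∈ P.patch β) :
    fibreHol 𝒢 α β I y * fibreHol 𝒢 β α I y = 1 :=
  𝒢.hol_mul_hol_swap (contMDiff_circleOrbit (P := P) I y) (circleOrbit_one I y)
    (fun _ => P.vadd_mem_patch _ hα) (fun _ => P.vadd_mem_patch _ hβ)

lemma fibreHol_self (I : Fin n) (hα : y ∈ P.patch α) : fibreHol 𝒢 α α I y = 1 :=
  𝒢.hol_self (contMDiff_circleOrbit (P := P) I y) (circleOrbit_one I y)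
    (fun _ => P.vadd_mem_patch _ hα)

lemma fibreHol_mul (I : Fin n) (hα : y ∈ P.patch α) (hβ : y ∈ P.patch β) (hγ : y ∈ P.patch γ) :
    fibreHol 𝒢 α β I y * fibreHol 𝒢 β γ I y = fibreHol 𝒢 α γ I y := by
  have h := 𝒢.hol_mul_hol_mul_hol (contMDiff_circleOrbit (P := P) I y) (circleOrbit_one I y)
    (fun _ => P.vadd_mem_patch _ hα) (fun _ => P.vadd_mem_patch _ hβ)
    (fun _ => P.vadd_mem_patch _ hγ)
  exact mul_right_cancel (h.trans (fibreHol_mul_swap 𝒢 I hα hγ).symm)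

end Loops

variable [IsManifold 𝓘(ℝ, E') ∞ X] {𝒢}

/-- The logarithmic derivative of the fibre holonomy is the contraction of the curvature with the
fundamental vector field. -/
lemma hasDLogWithinAt_fibreHol (h𝒢 : IsTorusInvariant P 𝒢) {α β : ι} (I : Fin n) {g : V → X}
    {O : Set V} (hO : IsOpen O) (hg : ∀ v ∈ O, ContMDiffAt 𝓘(ℝ, V) 𝓘(ℝ, E') ∞ g v)
    (hα : ∀ v ∈ O, g v ∈ P.patch α) (hβ : ∀ v ∈ O, g v ∈ P.patch β) {v₀ : V} (hv₀ : v₀ ∈ O) :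
    HasDLogWithinAt (fun v => fibreHol 𝒢 α β I (g v))
      (((bilinAt (curv 𝒢 α β) (g v₀)).flip (fundMap (g v₀) (Pi.single I 1))).comp
        (tmap V E' g v₀)) univ v₀ := by
  set e : V × (Fin n → ℝ) := (0, Pi.single I 1) with he
  have hΓ : ∀ y ∈ O ×ˢ (univ : Set (Fin n → ℝ)),
      ContMDiffAt 𝓘(ℝ, V × (Fin n → ℝ)) 𝓘(ℝ, E') ∞ (torusFlow (n := n) g) y :=
    fun y hy => P.contMDiffAt_torusFlow (hg y.1 hy.1)
  have hadd : ∀ (y : V × (Fin n → ℝ)) (t : ℝ),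
      torusFlow g (y + t • e) = torusPt (t • (Pi.single I 1 : Fin n → ℝ)) +ᵥ torusFlow g y := by
    intro y t
    rw [← torusFlow_add, he, Prod.smul_mk, smul_zero]
  have h := LineBundleWithConnection.hasDLogWithinAt_hol (L := 𝒢.L α β) (F := curv 𝒢 α β)
    (Γ := torusFlow (n := n) g) (Ω := O ×ˢ univ) (e := e)
    (y₀ := (v₀, 0)) (κ := (pullTwo (curv 𝒢 α β) (torusFlow (n := n) g) (v₀, 0)).flip e)
    (fun i x hx v w => 𝒢.curvature α β i x hx v w) (hO.prod isOpen_univ) hΓ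
    (fun y hy t => ⟨by simpa [he] using hy.1, mem_univ _⟩)
    (fun y hy => ⟨P.vadd_mem_patch _ (hα _ hy.1), P.vadd_mem_patch _ (hβ _ hy.1)⟩)
    (fun y => by rw [he, torusFlow_add, torusPt_single_one, zero_vadd])
    ⟨hv₀, mem_univ _⟩ ?_
  · have hk : HasFDerivWithinAt (fun v : V => (v, (0 : Fin n → ℝ)))
        (ContinuousLinearMap.inl ℝ V (Fin n → ℝ)) univ v₀ :=
      ((hasFDerivAt_id v₀).prodMk (hasFDerivAt_const (0 : Fin n → ℝ) v₀)).hasFDerivWithinAt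
    have h2 := HasDLogWithinAt.comp (k := fun v : V => (v, (0 : Fin n → ℝ))) h hk (mapsTo_univ _ _)
    have h3 : (fun v : V => (𝒢.L α β).hol fun t : ℝ => torusFlow g ((v, (0 : Fin n → ℝ)) + t • e)) =
        fun v => fibreHol 𝒢 α β I (g v) := by
      funext v
      simp only [fibreHol, hadd, torusFlow_zero]
    rw [h3] at h2
    refine h2.congr_form (ContinuousLinearMap.ext fun u => ?_)
    simp only [ContinuousLinearMap.comp_apply, ContinuousLinearMap.flip_apply,
      ContinuousLinearMap.inl_apply]
    rw [pullTwo_eq_bilinAt, P.tmap_torusFlow (hg v₀ hv₀), P.tmap_torusFlow (hg v₀ hv₀),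
      torusFlow_zero]
    simp
  -- by invariance, the contraction of the curvature is the same all along the circle
  · intro t v
    have hm : MDifferentiableAt 𝓘(ℝ, V × (Fin n → ℝ)) 𝓘(ℝ, E') (torusFlow (n := n) g)
        ((v₀, (0 : Fin n → ℝ)) + t • e) :=
      (hΓ _ ⟨by simpa [he] using hv₀, mem_univ _⟩).mdifferentiableAt (by simp)
    have hm0 : MDifferentiableAt 𝓘(ℝ, V × (Fin n → ℝ)) 𝓘(ℝ, E') (torusFlow (n := n) g)
        (v₀, (0 : Fin n → ℝ)) := (hΓ (v₀, 0) ⟨hv₀, mem_univ _⟩).mdifferentiableAt (by simp)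
    have hs : HasFDerivAt (fun y : V × (Fin n → ℝ) => y + t • e)
        (ContinuousLinearMap.id ℝ (V × (Fin n → ℝ))) (v₀, 0) := (hasFDerivAt_id _).add_const _
    have htm : ∀ v, tmap (V × (Fin n → ℝ)) E' (torusFlow (n := n) g) ((v₀, 0) + t • e) v =
        tmap E' E' (fun y : X => torusPt (t • (Pi.single I 1 : Fin n → ℝ)) +ᵥ y)
          (torusFlow g (v₀, (0 : Fin n → ℝ)))
          (tmap (V × (Fin n → ℝ)) E' (torusFlow (n := n) g) (v₀, 0) v) := by
      intro v
      have h1 := tmap_comp_apply (x := (v₀, (0 : Fin n → ℝ))) hm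
        hs.differentiableAt.mdifferentiableAt v
      rw [tmap_of_hasFDerivAt hs] at h1
      refine h1.symm.trans ?_
      rw [← tmap_comp_apply (P.mdifferentiableAt_vadd _ _) hm0]
      simp only [hadd]
    have ha : torusFlow g (v₀, (0 : Fin n → ℝ)) ∈ P.patch α := by
      rw [torusFlow_zero]; exact hα _ hv₀
    have hb : torusFlow g (v₀, (0 : Fin n → ℝ)) ∈ P.patch β := by
      rw [torusFlow_zero]; exact hβ _ hv₀
    rw [ContinuousLinearMap.flip_apply, pullTwo_eq_bilinAt, pullTwo_eq_bilinAt, htm, htm, hadd,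
      bilinAt_curv, bilinAt_curv, h𝒢.bilinAt_vadd _ ha, h𝒢.bilinAt_vadd _ hb]

/-- Along the fibres, the fibre holonomy is a character whose weight is the difference of the
matrices `B_0`. -/
lemma fibreHol_vadd (h𝒢 : IsTorusInvariant P 𝒢) {α β : ι} (I : Fin n) {y : X}
    (hα : y ∈ P.patch α) (hβ : y ∈ P.patch β) (θ : Fin n → ℝ) :
    fibreHol 𝒢 α β I (torusPt θ +ᵥ y) = fibreHol 𝒢 α β I y *
      Circle.exp (2 * Real.pi *
        -∑ J, (red₀ 𝒢 α (P.proj y) I J - red₀ 𝒢 β (P.proj y) I J) * θ J) := by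
  set N : Fin n → ℝ := fun J => red₀ 𝒢 α (P.proj y) I J - red₀ 𝒢 β (P.proj y) I J with hN
  have hval : ∀ (s : Fin n → ℝ) (t : Fin n → ℝ),
      bilinAt (curv 𝒢 α β) (torusPt s +ᵥ y) (fundMap (torusPt s +ᵥ y) t)
        (fundMap (torusPt s +ᵥ y) (Pi.single I 1)) = -∑ J, N J * t J := by
    intro s t
    rw [bilin_fundMap_left, ← Finset.sum_neg_distrib]
    refine Finset.sum_congr rfl fun J _ => ?_
    rw [bilinAt_curv, bilinAt_fundMap h𝒢 (P.vadd_mem_patch _ hα),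
      bilinAt_fundMap h𝒢 (P.vadd_mem_patch _ hβ), P.proj_vadd, red₀_skew 𝒢 hα, red₀_skew 𝒢 hβ]
    simp only [hN]
    ring
  let ℓ : (Fin n → ℝ) →L[ℝ] ℝ := -∑ J, N J • ContinuousLinearMap.proj (R := ℝ) J
  have hℓ : ∀ t, ℓ t = -∑ J, N J * t J := by
    intro t; simp [ℓ, _root_.sum_apply]
  have h1 : ∀ s : Fin n → ℝ, HasDLogWithinAt
      (fun s : Fin n → ℝ => fibreHol 𝒢 α β I (torusPt s +ᵥ y)) ℓ univ s := by
    intro s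
    refine (hasDLogWithinAt_fibreHol h𝒢 (g := fun s : Fin n → ℝ => torusPt s +ᵥ y) I
      isOpen_univ (fun v _ => P.contMDiff_orbit y v) (fun _ _ => P.vadd_mem_patch _ hα)
      (fun _ _ => P.vadd_mem_patch _ hβ) (mem_univ s)).congr_form
      (ContinuousLinearMap.ext fun t => ?_)
    rw [ContinuousLinearMap.comp_apply, ContinuousLinearMap.flip_apply, P.tmap_orbit, hval, hℓ]
  have h2 : ∀ t ∈ Icc (0 : ℝ) 1, HasDLogWithinAt (fun t : ℝ =>
      fibreHol 𝒢 α β I (torusPt (t • θ) +ᵥ y) / Circle.exp (2 * Real.pi * ℓ (t • θ))) 0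
      (Icc 0 1) t := by
    intro t _
    have hk : HasFDerivWithinAt (fun t : ℝ => t • θ)
        ((ContinuousLinearMap.id ℝ ℝ).smulRight θ) (Icc 0 1) t :=
      ((hasFDerivAt_id t).smul_const θ).hasFDerivWithinAt
    have h3 := HasDLogWithinAt.comp (k := fun t : ℝ => t • θ) (h1 (t • θ)) hk
      (mapsTo_univ _ _)
    exact (h3.div (hasDLogWithinAt_exp (ℓ.hasFDerivAt.comp_hasFDerivWithinAt t hk))).congr_form
      (sub_self _)
  have h3 := eq_of_hasDLogWithinAt_zero h2 (s := 1) (t := 0) ⟨zero_le_one, le_rfl⟩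
    ⟨le_rfl, zero_le_one⟩
  simp only [one_smul, zero_smul, map_zero, mul_zero, Circle.exp_zero, div_one, torusPt_zero,
    zero_vadd] at h3
  rw [← hℓ, ← h3, div_mul_cancel]

/-- The differences of the matrices `B_0` are integral. -/
lemma exists_int_red₀ (h𝒢 : IsTorusInvariant P 𝒢) {α β : ι} {x : M} (hx : x ∈ P.U α ∩ P.U β)
    (I J : Fin n) : ∃ k : ℤ, red₀ 𝒢 α x I J - red₀ 𝒢 β x I J = k := by
  have hα : P.sec α x ∈ P.patch α := P.sec_mem_patch hx.1
  have hβ : P.sec α x ∈ P.patch β := by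
    rw [PrincipalTorusBundle.patch, mem_preimage, P.proj_sec hx.1]; exact hx.2
  have h := fibreHol_vadd h𝒢 I hα hβ (Pi.single J 1)
  rw [torusPt_single_one, zero_vadd, left_eq_mul, circle_exp_eq_one_iff, P.proj_sec hx.1] at h
  obtain ⟨k, hk⟩ := h
  refine ⟨-k, ?_⟩
  simp [Pi.single_apply] at hk ⊢
  linarith

/-- Over connected overlaps, the differences of the matrices `B_0` are constant. -/
lemma exists_intMatrix (h𝒢 : IsTorusInvariant P 𝒢) [IsManifold 𝓘(ℝ, E) ∞ M] (α β : ι)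
    (hU : IsPreconnected (P.U α ∩ P.U β)) :
    ∃ m : Matrix (Fin n) (Fin n) ℤ, (∀ x ∈ P.U α ∩ P.U β, ∀ I J,
      red₀ 𝒢 α x I J - red₀ 𝒢 β x I J = m I J) ∧ (P.U α ∩ P.U β = ∅ → m = 0) := by
  rcases (P.U α ∩ P.U β).eq_empty_or_nonempty with h | ⟨x₀, hx₀⟩
  · exact ⟨0, by rw [h]; simp, fun _ => rfl⟩
  choose m hm using fun I J => exists_int_red₀ h𝒢 hx₀ I J
  refine ⟨Matrix.of m, fun x hx I J => ?_, fun h => by simp [h] at hx₀⟩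
  rw [Matrix.of_apply, ← hm I J]
  have hT : IsDiscrete (range (Int.cast : ℤ → ℝ)) := by
    rw [isDiscrete_iff_discreteTopology]
    exact Int.isClosedEmbedding_coe_real.isEmbedding.toHomeomorph.symm.isEmbedding.discreteTopology
  refine hU.constant_of_mapsTo hT (f := fun x => red₀ 𝒢 α x I J - red₀ 𝒢 β x I J) ?_ ?_ hx hx₀
  · exact ((contMDiffOn_red₀ 𝒢 α I J).continuousOn.mono inter_subset_left).sub
      ((contMDiffOn_red₀ 𝒢 β I J).continuousOn.mono inter_subset_right)
  · intro z hz
    obtain ⟨k, hk⟩ := exists_int_red₀ h𝒢 hz I J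
    exact ⟨k, hk.symm⟩

end FibreHolonomy

/-! ### The midpoint sections and the logarithms of the fibre holonomy -/

variable {n : ℕ}
  {E : Type*} [NormedAddCommGroup E] [NormedSpace ℝ E]
  {M : Type*} [TopologicalSpace M] [ChartedSpace E M]
  {E' : Type*} [NormedAddCommGroup E'] [NormedSpace ℝ E']
  {X : Type*} [TopologicalSpace X] [ChartedSpace E' X]
  [AddAction (Fin n → UnitAddCircle) X] {ι : Type*}
  {V : Type*} [NormedAddCommGroup V] [NormedSpace ℝ V]

namespace PrincipalTorusBundle

variable (P : PrincipalTorusBundle n E M E' X ι)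

/-- The section of `X` over `U α ∩ U β` which lies half-way between `sec α` and `sec β`. -/
def mid (α β : ι) (x : M) : X := P.coord α x (-(1 / 2 : ℝ) • P.lam α β x)

lemma mid_eq {α β : ι} {x : M} (hx : x ∈ P.U α ∩ P.U β) :
    P.mid α β x = P.coord β x (-(1 / 2 : ℝ) • P.lam β α x) := by
  rw [mid, P.coord_eq_coord hx, P.lam_skew α β x hx]
  congr 1
  funext i
  simp
  ring

lemma mid_swap {α β : ι} {x : M} (hx : x ∈ P.U α ∩ P.U β) : P.mid α β x = P.mid β α x :=
  P.mid_eq hx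

lemma coord_eq_vadd_mid (α β : ι) (x : M) (θ : Fin n → ℝ) :
    P.coord α x θ = torusPt (θ + (1 / 2 : ℝ) • P.lam α β x) +ᵥ P.mid α β x := by
  rw [mid, coord, coord, vadd_vadd, ← torusPt_add]
  congr 2
  funext i
  simp

lemma proj_mid {α β : ι} {x : M} (hx : x ∈ P.U α) : P.proj (P.mid α β x) = x := P.proj_coord hx _

lemma mid_mem {α β : ι} {x : M} (hx : x ∈ P.U α ∩ P.U β) :
    P.mid α β x ∈ P.patch α ∧ P.mid α β x ∈ P.patch β := by
  simp only [patch, mem_preimage, P.proj_mid hx.1]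
  exact hx

lemma isOpen_inter (α β : ι) : IsOpen (P.U α ∩ P.U β) := (P.isOpen_U α).inter (P.isOpen_U β)

lemma contMDiffAt_lam {α β : ι} {x : M} (hx : x ∈ P.U α ∩ P.U β) :
    ContMDiffAt 𝓘(ℝ, E) 𝓘(ℝ, Fin n → ℝ) ∞ (P.lam α β) x :=
  (P.smooth_lam α β x hx).contMDiffAt ((P.isOpen_inter α β).mem_nhds hx)

lemma contMDiffAt_mid {α β : ι} {x : M} (hx : x ∈ P.U α ∩ P.U β) :
    ContMDiffAt 𝓘(ℝ, E) 𝓘(ℝ, E') ∞ (P.mid α β) x := by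
  have h1 : ContMDiffAt 𝓘(ℝ, E) 𝓘(ℝ, Fin n → ℝ) ∞ (fun x => -(1 / 2 : ℝ) • P.lam α β x) x :=
    ContMDiffAt.comp (g := fun w : Fin n → ℝ => -(1 / 2 : ℝ) • w) x
      (ContDiffAt.contMDiffAt (by fun_prop)) (P.contMDiffAt_lam hx)
  exact (P.contMDiffAt_coord hx.1 _).comp x (contMDiffAt_id.prodMk h1)

/-- The pull-back of the connection to the midpoint section is `A_β - ½ dλ_{βα}`, because this
section has coordinates `θ_β = -½ λ_{βα}`. -/
lemma form_tmap_mid {Θ : TorusConnection P} {α β : ι} {x : M} (hx : x ∈ P.U α ∩ P.U β)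
    (J : Fin n) (v : E) :
    formAt (Θ.form J) (P.mid α β x) (tmap E E' (P.mid α β) x v) =
      formAt (Θ.potential β J) x v - 1 / 2 * tmap E (Fin n → ℝ) (P.lam β α) x v J := by
  set c : M → Fin n → ℝ := fun x => -(1 / 2 : ℝ) • P.lam β α x with hc
  have hlam := (P.contMDiffAt_lam hx.symm).mdifferentiableAt (n := ∞) (by simp)
  have hD : HasFDerivAt (fun w : Fin n → ℝ => -(1 / 2 : ℝ) • w)
      (-(1 / 2 : ℝ) • ContinuousLinearMap.id ℝ (Fin n → ℝ)) (P.lam β α x) :=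
    (-(1 / 2 : ℝ) • ContinuousLinearMap.id ℝ (Fin n → ℝ)).hasFDerivAt
  have h1 : tmap E (Fin n → ℝ) c x v = -(1 / 2 : ℝ) • tmap E (Fin n → ℝ) (P.lam β α) x v := by
    have := tmap_comp_apply (f := P.lam β α) (x := x) hD.differentiableAt.mdifferentiableAt hlam v
    rw [tmap_of_hasFDerivAt hD] at this
    exact this
  have hcd : MDifferentiableAt 𝓘(ℝ, E) 𝓘(ℝ, Fin n → ℝ) c x :=
    MDifferentiableAt.comp (g := fun w : Fin n → ℝ => -(1 / 2 : ℝ) • w) x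
      hD.differentiableAt.mdifferentiableAt hlam
  have h2 : P.mid α β =ᶠ[𝓝 x] fun x => P.coord β x (c x) := by
    filter_upwards [(P.isOpen_inter α β).mem_nhds hx] with z hz using P.mid_eq hz
  have h3 : tmap E E' (fun x => P.coord β x (c x)) x v =
      dPair E E' (P.coord β) x (c x) (v, tmap E (Fin n → ℝ) c x v) :=
    tmap_comp_pair ((P.contMDiffAt_coord hx.2 (c x)).mdifferentiableAt (by simp)) hcd v
  rw [tmap_congr h2, h3, P.mid_eq hx]
  refine (Θ.isLocallyCoordPlus β J x hx.2 (c x) v (tmap E (Fin n → ℝ) c x v)).trans ?_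
  change tmap E (Fin n → ℝ) c x v J + formAt (Θ.potential β J) x v = _
  rw [h1]
  simp
  ring

end PrincipalTorusBundle

lemma exists_isOpen_extChartAt_symm [IsManifold 𝓘(ℝ, E) ∞ M] {x₀ : M} {U : Set M}
    (hU : IsOpen U) (h₀ : x₀ ∈ U) :
    ∃ O : Set E, IsOpen O ∧ extChartAt 𝓘(ℝ, E) x₀ x₀ ∈ O ∧
      (∀ z ∈ O, ContMDiffAt 𝓘(ℝ, E) 𝓘(ℝ, E) ∞ (extChartAt 𝓘(ℝ, E) x₀).symm z) ∧
      ∀ z ∈ O, (extChartAt 𝓘(ℝ, E) x₀).symm z ∈ U := by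
  obtain ⟨O, h1, h2, h3⟩ := eventually_nhds_iff.1 (eventually_extChartAt_symm (E := E) hU h₀)
  exact ⟨O, h2, h3, fun z hz => (h1 z hz).1, fun z hz => (h1 z hz).2⟩

lemma eventually_extChartAt_symm_apply {x₀ : M} : ∀ᶠ x in 𝓝 x₀,
    (extChartAt 𝓘(ℝ, E) x₀).symm (extChartAt 𝓘(ℝ, E) x₀ x) = x := by
  filter_upwards [(isOpen_extChartAt_source (I := 𝓘(ℝ, E)) x₀).mem_nhds
    (mem_extChartAt_source x₀)] with x hx using (extChartAt 𝓘(ℝ, E) x₀).left_inv hx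

section Logarithm

variable {P : PrincipalTorusBundle n E M E' X ι}
  {𝒢 : GerbeWithConnection.{w} (E := E') P.patch}

/-- `h : M → ℝⁿ` is a continuous logarithm, on `U α ∩ U β`, of the fibre holonomies at the midpoint
section. -/
def IsHolLog (𝒢 : GerbeWithConnection.{w} (E := E') P.patch) (α β : ι) (h : M → Fin n → ℝ) : Prop :=
  ContinuousOn h (P.U α ∩ P.U β) ∧ ∀ x ∈ P.U α ∩ P.U β, ∀ I,
    Circle.exp (2 * Real.pi * h x I) = fibreHol 𝒢 α β I (P.mid α β x)

variable [IsManifold 𝓘(ℝ, E') ∞ X]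

lemma IsHolLog.swap {α β : ι} {h : M → Fin n → ℝ} (hh : IsHolLog 𝒢 α β h) :
    IsHolLog 𝒢 β α (-h) := by
  refine ⟨by rw [inter_comm]; exact hh.1.neg, fun x hx I => ?_⟩
  have hx' := hx.symm
  have h1 := fibreHol_mul_swap 𝒢 I (P.mid_mem hx').1 (P.mid_mem hx').2
  rw [← hh.2 x hx', P.mid_swap hx'] at h1
  rw [Pi.neg_apply, Pi.neg_apply, mul_neg, Circle.exp_neg]
  exact (eq_inv_of_mul_eq_one_right h1).symm

lemma isHolLog_self (α : ι) : IsHolLog 𝒢 α α 0 :=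
  ⟨continuousOn_const, fun x hx I => by
    rw [fibreHol_self 𝒢 I (P.mid_mem hx).1]; simp⟩

variable (h𝒢 : IsTorusInvariant P 𝒢)
include h𝒢

lemma hasDLogWithinAt_fibreHol_mid {α β : ι} (I : Fin n) {k : V → M} {O : Set V} (hO : IsOpen O)
    (hk : ∀ v ∈ O, ContMDiffAt 𝓘(ℝ, V) 𝓘(ℝ, E) ∞ k v) (hkU : ∀ v ∈ O, k v ∈ P.U α ∩ P.U β)
    {v₀ : V} (hv₀ : v₀ ∈ O) :
    HasDLogWithinAt (fun v => fibreHol 𝒢 α β I (P.mid α β (k v)))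
      (((bilinAt (curv 𝒢 α β) (P.mid α β (k v₀))).flip
        (fundMap (P.mid α β (k v₀)) (Pi.single I 1))).comp
        (tmap V E' (fun v => P.mid α β (k v)) v₀)) univ v₀ :=
  hasDLogWithinAt_fibreHol h𝒢 I (g := fun v => P.mid α β (k v)) hO
    (fun v hv => (P.contMDiffAt_mid (hkU v hv)).comp v (hk v hv))
    (fun v hv => (P.mid_mem (hkU v hv)).1) (fun v hv => (P.mid_mem (hkU v hv)).2) hv₀

variable [IsManifold 𝓘(ℝ, E) ∞ M]

lemma continuousOn_fibreHol_mid (α β : ι) (I : Fin n) :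
    ContinuousOn (fun x => fibreHol 𝒢 α β I (P.mid α β x)) (P.U α ∩ P.U β) := by
  intro x₀ hx₀
  refine ContinuousAt.continuousWithinAt ?_
  obtain ⟨O, hO, hz₀, hk, hkU⟩ := exists_isOpen_extChartAt_symm (E := E) (P.isOpen_inter α β) hx₀
  have h1 : ContinuousAt (fun v => fibreHol 𝒢 α β I
      (P.mid α β ((extChartAt 𝓘(ℝ, E) x₀).symm v))) (extChartAt 𝓘(ℝ, E) x₀ x₀) := by
    have h2 := (hasDLogWithinAt_fibreHol_mid h𝒢 I hO hk hkU hz₀).continuousWithinAt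
    rw [continuousWithinAt_univ] at h2
    exact Topology.IsInducing.subtypeVal.continuousAt_iff.2 h2
  have h3 := ContinuousAt.comp (f := extChartAt 𝓘(ℝ, E) x₀) h1 (continuousAt_extChartAt x₀)
  refine h3.congr ?_
  filter_upwards [eventually_extChartAt_symm_apply (E := E) (x₀ := x₀)] with x hx
  rw [Function.comp_apply, hx]

/-- The differential of a logarithm in a parametrization of the base. -/
lemma IsHolLog.hasFDerivAt {α β : ι} {h : M → Fin n → ℝ} (hh : IsHolLog 𝒢 α β h) (I : Fin n)
    {k : V → M} {O : Set V} (hO : IsOpen O)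
    (hk : ∀ v ∈ O, ContMDiffAt 𝓘(ℝ, V) 𝓘(ℝ, E) ∞ k v) (hkU : ∀ v ∈ O, k v ∈ P.U α ∩ P.U β)
    {v₀ : V} (hv₀ : v₀ ∈ O) :
    HasFDerivAt (fun v => h (k v) I)
      (((bilinAt (curv 𝒢 α β) (P.mid α β (k v₀))).flip
        (fundMap (P.mid α β (k v₀)) (Pi.single I 1))).comp
        (tmap V E' (fun v => P.mid α β (k v)) v₀)) v₀ := by
  refine hasFDerivAt_of_hasDLog (hasDLogWithinAt_fibreHol_mid h𝒢 I hO hk hkU hv₀) ?_ ?_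
  · have h1 : ContinuousAt h (k v₀) :=
      (hh.1 _ (hkU v₀ hv₀)).continuousAt ((P.isOpen_inter α β).mem_nhds (hkU v₀ hv₀))
    exact (continuous_apply I).continuousAt.comp
      (ContinuousAt.comp (f := k) h1 (hk v₀ hv₀).continuousAt)
  · filter_upwards [hO.mem_nhds hv₀] with v hv using hh.2 _ (hkU v hv) I

/-- A logarithm of the fibre holonomy is smooth because its differential, an evaluation of
`B_α - B_β`, is. -/
lemma IsHolLog.contMDiffOn {α β : ι} {h : M → Fin n → ℝ} (hh : IsHolLog 𝒢 α β h) :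
    ContMDiffOn 𝓘(ℝ, E) 𝓘(ℝ, Fin n → ℝ) ∞ h (P.U α ∩ P.U β) := by
  intro x₀ hx₀
  refine ContMDiffAt.contMDiffWithinAt ?_
  obtain ⟨O, hO, hz₀, hk, hkU⟩ := exists_isOpen_extChartAt_symm (E := E) (P.isOpen_inter α β) hx₀
  set k : E → M := ((extChartAt 𝓘(ℝ, E) x₀).symm : E → M) with hkdef
  have hs : ∀ v ∈ O, ContMDiffAt 𝓘(ℝ, E) 𝓘(ℝ, E') ∞ (fun v => P.mid α β (k v)) v :=
    fun v hv => (P.contMDiffAt_mid (hkU v hv)).comp v (hk v hv)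
  have hB : ∀ δ, (∀ v ∈ O, P.mid α β (k v) ∈ P.patch δ) →
      ContDiffAt ℝ ∞ (fun v => pullTwo (𝒢.B δ) (torusFlow (n := n) fun v => P.mid α β (k v))
        (v, (0 : Fin n → ℝ))) (extChartAt 𝓘(ℝ, E) x₀ x₀) := by
    intro δ hδ
    have h1 := (𝒢.smooth_B δ).contDiffAt_pullTwo
      (P.contMDiffAt_torusFlow (q := (extChartAt 𝓘(ℝ, E) x₀ x₀, (0 : Fin n → ℝ))) (hs _ hz₀))
      (by rw [torusFlow_zero]; exact hδ _ hz₀)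
    exact ContDiffAt.comp (f := fun v : E => (v, (0 : Fin n → ℝ))) _ h1
      (contDiffAt_id.prodMk contDiffAt_const)
  have hsm : ContDiffAt ℝ ∞ (fun v I => h (k v) I) (extChartAt 𝓘(ℝ, E) x₀ x₀) := by
    rw [contDiffAt_pi]
    intro I
    have hder := fun v hv => hh.hasFDerivAt h𝒢 I hO hk hkU (v₀ := v) hv
    have hF := (hB α fun v hv => (P.mid_mem (hkU v hv)).1).sub
      (hB β fun v hv => (P.mid_mem (hkU v hv)).2)
    have hw := contDiffAt_const (𝕜 := ℝ) (n := ∞) (x := extChartAt 𝓘(ℝ, E) x₀ x₀)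
      (c := ContinuousLinearMap.apply ℝ ℝ ((0, Pi.single I 1) : E × (Fin n → ℝ)))
    have hi := contDiffAt_const (𝕜 := ℝ) (n := ∞) (x := extChartAt 𝓘(ℝ, E) x₀ x₀)
      (c := ContinuousLinearMap.inl ℝ E (Fin n → ℝ))
    have h2 := (hw.clm_comp hF).clm_comp hi
    have h4 : ContDiffAt ℝ ∞ (fderiv ℝ (fun v => h (k v) I)) (extChartAt 𝓘(ℝ, E) x₀ x₀) := by
      refine h2.congr_of_eventuallyEq ?_
      filter_upwards [hO.mem_nhds hz₀] with v hv
      rw [(hder v hv).fderiv]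
      refine ContinuousLinearMap.ext fun u => ?_
      simp only [ContinuousLinearMap.comp_apply, ContinuousLinearMap.flip_apply,
        ContinuousLinearMap.apply_apply, ContinuousLinearMap.inl_apply,
        _root_.sub_apply]
      rw [pullTwo_eq_bilinAt, pullTwo_eq_bilinAt, P.tmap_torusFlow (hs v hv),
        P.tmap_torusFlow (hs v hv), torusFlow_zero, bilinAt_curv]
      simp
    rw [contDiffAt_infty]
    intro m
    refine ContDiffAt.of_le (n := (m : WithTop ℕ∞) + 1) ?_ (by exact_mod_cast le_self_add)
    refine contDiffAt_succ_iff_hasFDerivAt.2 ⟨fderiv ℝ (fun v => h (k v) I), ⟨O, hO.mem_nhds hz₀,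
      fun v hv => (hder v hv).differentiableAt.hasFDerivAt⟩, h4.of_le (by exact_mod_cast le_top)⟩
  have h5 := hsm.contMDiffAt.comp x₀ (contMDiffAt_extChartAt (n := ∞))
  refine h5.congr_of_eventuallyEq ?_
  filter_upwards [eventually_extChartAt_symm_apply (E := E) (x₀ := x₀)] with x hx
  simp only [Function.comp_apply, hkdef, hx]

/-- The differential of a logarithm of the fibre holonomy at the midpoint section. -/
lemma IsHolLog.tmap_apply {α β : ι} {h : M → Fin n → ℝ} (hh : IsHolLog 𝒢 α β h) {x : M}
    (hx : x ∈ P.U α ∩ P.U β) (I : Fin n) (v : E) :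
    tmap E (Fin n → ℝ) h x v I = bilinAt (curv 𝒢 α β) (P.mid α β x)
      (tmap E E' (P.mid α β) x v) (fundMap (P.mid α β x) (Pi.single I 1)) := by
  obtain ⟨O, hO, hz₀, hk, hkU⟩ := exists_isOpen_extChartAt_symm (E := E) (P.isOpen_inter α β) hx
  set e := extChartAt 𝓘(ℝ, E) x
  have hex : e.symm (e x) = x := extChartAt_to_inv x
  have hke : tmap E E e.symm (e x) (tmap E E e x v) = v := by
    rw [← tmap_comp_apply ((hk _ hz₀).mdifferentiableAt (by simp))
      ((contMDiffAt_extChartAt (n := ∞)).mdifferentiableAt (by simp)),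
      tmap_congr (eventually_extChartAt_symm_apply (E := E)), tmap_id]
    rfl
  have h1 := hh.hasFDerivAt h𝒢 I hO hk hkU hz₀
  have hhd : MDifferentiableAt 𝓘(ℝ, E) 𝓘(ℝ, Fin n → ℝ) h (e.symm (e x)) := by
    rw [hex]
    exact ((hh.contMDiffOn h𝒢 x hx).contMDiffAt
      ((P.isOpen_inter α β).mem_nhds hx)).mdifferentiableAt (by simp)
  have hkd : MDifferentiableAt 𝓘(ℝ, E) 𝓘(ℝ, E) e.symm (e x) :=
    (hk _ hz₀).mdifferentiableAt (by simp)
  have hmd : MDifferentiableAt 𝓘(ℝ, E) 𝓘(ℝ, E') (P.mid α β) (e.symm (e x)) := by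
    rw [hex]; exact (P.contMDiffAt_mid hx).mdifferentiableAt (by simp)
  have hpr : HasFDerivAt (fun w : Fin n → ℝ => w I) (ContinuousLinearMap.proj (R := ℝ) I)
      (h (e.symm (e x))) :=
    (ContinuousLinearMap.proj (R := ℝ) (φ := fun _ : Fin n => ℝ) I).hasFDerivAt
  have h2 := tmap_comp_apply (g := fun w : Fin n → ℝ => w I) (f := fun z => h (e.symm z))
    hpr.differentiableAt.mdifferentiableAt (hhd.comp (e x) hkd) (tmap E E e x v)
  have h3 := tmap_comp_apply (g := h) hhd hkd (tmap E E e x v)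
  have h4 := tmap_comp_apply (g := P.mid α β) hmd hkd (tmap E E e x v)
  rw [tmap_of_hasFDerivAt hpr, h3, tmap_of_hasFDerivAt h1, ContinuousLinearMap.comp_apply,
    ContinuousLinearMap.flip_apply, h4, hke, hex] at h2
  exact h2.symm

/-- Over a simply connected overlap, the fibre holonomies at the midpoint section lift through the
covering `Circle.exp`. -/
lemma exists_isHolLog (α β : ι) [SimplyConnectedSpace ↥(P.U α ∩ P.U β)] :
    ∃ h : M → Fin n → ℝ, IsHolLog 𝒢 α β h := by
  classical
  have : LocallyPathConnectedSpace M := ChartedSpace.locallyPathConnectedSpace E M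
  have : LocallyPathConnectedSpace ↥(P.U α ∩ P.U β) :=
    (P.isOpen_inter α β).locallyPathConnectedSpace
  have hne : Nonempty ↥(P.U α ∩ P.U β) := inferInstance
  obtain ⟨a₀⟩ := hne
  have key : ∀ I : Fin n, ∃ F : C(↥(P.U α ∩ P.U β), ℝ), ∀ x, Circle.exp (F x) =
      fibreHol 𝒢 α β I (P.mid α β x) := by
    intro I
    obtain ⟨e₀, he₀⟩ := Circle.exp_surjective (fibreHol 𝒢 α β I (P.mid α β a₀))
    obtain ⟨F, ⟨-, hF⟩, -⟩ := Circle.isCoveringMap_exp.existsUnique_continuousMap_lifts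
      ⟨fun x : ↥(P.U α ∩ P.U β) => fibreHol 𝒢 α β I (P.mid α β x),
        (continuousOn_fibreHol_mid h𝒢 α β I).domRestrict⟩ a₀ e₀ he₀
    exact ⟨F, fun x => congrFun hF x⟩
  choose F hF using key
  refine ⟨fun x I => if hx : x ∈ P.U α ∩ P.U β then (2 * Real.pi)⁻¹ * F I ⟨x, hx⟩ else 0, ?_, ?_⟩
  · rw [continuousOn_iff_continuous_domRestrict]
    refine continuous_pi fun I => ?_
    have h1 : Continuous fun x : ↥(P.U α ∩ P.U β) => (2 * Real.pi)⁻¹ * F I x := by fun_prop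
    refine h1.congr fun x => ?_
    simp only [Set.domRestrict_apply]
    rw [dif_pos x.2]
  · intro x hx I
    simp only [dif_pos hx]
    rw [← hF I ⟨x, hx⟩]
    congr 1
    have := Real.pi_pos
    field_simp

/-- Logarithms of the fibre holonomies can be chosen skew-symmetrically. -/
lemma exists_skew_isHolLog
    (hU : ∀ α β, (P.U α ∩ P.U β).Nonempty → SimplyConnectedSpace ↥(P.U α ∩ P.U β)) :
    ∃ h : ι → ι → M → Fin n → ℝ, (∀ α β, IsHolLog 𝒢 α β (h α β)) ∧ ∀ α β, h β α = -h α β := by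
  classical
  have key : ∀ α β, ∃ h : M → Fin n → ℝ, IsHolLog 𝒢 α β h := by
    intro α β
    rcases (P.U α ∩ P.U β).eq_empty_or_nonempty with h | h
    · exact ⟨0, continuousOn_const, fun x hx => by simp [h] at hx⟩
    · have := hU α β h
      exact exists_isHolLog h𝒢 α β
  choose h₀ hh₀ using key
  -- choose `h α β` for `α < β` in an arbitrary linear order and extend skew-symmetrically
  let _ : LinearOrder ι := IsWellOrder.linearOrder (WellOrderingRel (α := ι))
  refine ⟨fun α β => if α < β then h₀ α β else if β < α then -h₀ β α else 0,
    fun α β => ?_, fun α β => ?_⟩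
  · rcases lt_trichotomy α β with hlt | rfl | hlt
    · simpa [hlt] using hh₀ α β
    · simpa using isHolLog_self α
    · simpa [hlt, hlt.not_gt] using (hh₀ β α).swap
  · rcases lt_trichotomy α β with hlt | rfl | hlt
    · simp [hlt, hlt.not_gt]
    · simp
    · simp [hlt, hlt.not_gt]

end Logarithm

/-! ### The reduced data and the cocycle of affine transition functions -/

variable {n : ℕ}
  {E : Type*} [NormedAddCommGroup E] [NormedSpace ℝ E]
  {M : Type*} [TopologicalSpace M] [ChartedSpace E M]
  {E' : Type*} [NormedAddCommGroup E'] [NormedSpace ℝ E']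
  {X : Type*} [TopologicalSpace X] [ChartedSpace E' X]
  [AddAction (Fin n → UnitAddCircle) X] {ι : Type*}
  {P : PrincipalTorusBundle n E M E' X ι} (Θ : TorusConnection P)
  {𝒢 : GerbeWithConnection.{w} (E := E') P.patch}

section ReductionData

variable [IsManifold 𝓘(ℝ, E) ∞ M] [IsManifold 𝓘(ℝ, E') ∞ X] (h𝒢 : IsTorusInvariant P 𝒢)
include h𝒢

/-- The component of `B_α` in the direction of the midpoint section and of a fundamental vector
field. -/
lemma bilinAt_mid {α β δ : ι} {x : M} (hx : x ∈ P.U α ∩ P.U β) (hδ : x ∈ P.U δ) (I : Fin n)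
    (v : E) :
    bilinAt (𝒢.B δ) (P.mid α β x) (tmap E E' (P.mid α β) x v)
      (fundMap (P.mid α β x) (Pi.single I 1)) =
    formAt (red₁ Θ 𝒢 δ I) x v - ∑ J, red₀ 𝒢 δ x I J *
      (formAt (Θ.potential β J) x v - 1 / 2 * tmap E (Fin n → ℝ) (P.lam β α) x v J) := by
  have hmem : P.mid α β x ∈ P.patch δ := by
    rw [PrincipalTorusBundle.patch, mem_preimage, P.proj_mid hx.1]; exact hδ
  have hproj : tmap E' E P.proj (P.mid α β x) (tmap E E' (P.mid α β) x v) = v := by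
    rw [← tmap_comp_apply ((P.smooth_proj _).mdifferentiableAt (by simp))
      ((P.contMDiffAt_mid hx).mdifferentiableAt (by simp))]
    have h2 : (fun x => P.proj (P.mid α β x)) =ᶠ[𝓝 x] fun x => x := by
      filter_upwards [(P.isOpen_inter α β).mem_nhds hx] with z hz using P.proj_mid hz.1
    rw [tmap_congr h2, tmap_id]
    rfl
  have hfund : ∀ J, formAt (Θ.form J) (P.mid α β x) (fundMap (P.mid α β x) (Pi.single I 1)) =
      if J = I then 1 else 0 := by
    intro J
    refine (Θ.form_fundMap J _ _).trans ?_
    rw [Pi.single_apply]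
  rw [bilinAt_eq_red Θ h𝒢 hmem, P.tmap_proj_fundMap, hproj, P.proj_mid hx.1]
  simp only [hfund, P.form_tmap_mid hx, map_zero, zero_mul, sub_zero, mul_ite, mul_one, mul_zero,
    Finset.sum_ite_eq', Finset.mem_univ, if_true, zero_add]
  generalize hT : (fun J => formAt (Θ.potential β J) x v
    - 1 / 2 * tmap E (Fin n → ℝ) (P.lam β α) x v J) = T
  have hT' : ∀ J, formAt (Θ.potential β J) x v
    - 1 / 2 * tmap E (Fin n → ℝ) (P.lam β α) x v J = T J := fun J => congrFun hT J
  simp only [hT']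
  have h1 : ∑ K, ∑ L, red₀ 𝒢 δ x K L * ((if L = I then T K else 0) - (if K = I then 1 else 0) * T L)
      = -2 * ∑ J, red₀ 𝒢 δ x I J * T J := by
    simp only [mul_sub, Finset.sum_sub_distrib]
    have h2 : ∑ K, ∑ L, red₀ 𝒢 δ x K L * (if L = I then T K else 0) =
        -∑ J, red₀ 𝒢 δ x I J * T J := by
      rw [← Finset.sum_neg_distrib]
      refine Finset.sum_congr rfl fun K _ => ?_
      simp only [mul_ite, mul_zero, Finset.sum_ite_eq', Finset.mem_univ, if_true]
      rw [red₀_skew 𝒢 hδ I K]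
      ring
    have h3 : ∑ K, ∑ L, red₀ 𝒢 δ x K L * ((if K = I then 1 else 0) * T L) =
        ∑ J, red₀ 𝒢 δ x I J * T J := by
      rw [Finset.sum_eq_single I]
      · simp
      · intro K _ hK; simp [hK]
      · simp
    rw [h2, h3]; ring
  rw [h1]
  ring

/-- The reduced data exist, with `h̃_{αβ}` the logarithms of the fibre holonomies of `L α β`. -/
lemma exists_reduction
    (hU : ∀ α β, (P.U α ∩ P.U β).Nonempty → SimplyConnectedSpace ↥(P.U α ∩ P.U β)) :
    ∃ R : Reduction P Θ 𝒢, R.B₀ = red₀ 𝒢 ∧ ∀ α β, IsHolLog 𝒢 α β (R.h α β) := by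
  have hconn : ∀ α β, IsPreconnected (P.U α ∩ P.U β) := by
    intro α β
    rcases (P.U α ∩ P.U β).eq_empty_or_nonempty with h | h
    · rw [h]; exact isPreconnected_empty
    · have := hU α β h
      exact isPreconnected_iff_preconnectedSpace.2 inferInstance
  choose m hm hm0 using fun α β => exists_intMatrix h𝒢 α β (hconn α β)
  obtain ⟨h, hh, hskew⟩ := exists_skew_isHolLog h𝒢 hU
  refine ⟨{
    A := Θ.potential
    smooth_A := smoothOneFormOn_potential Θ
    connection_eq := Θ.isLocallyCoordPlus
    B₀ := red₀ 𝒢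
    smooth_B₀ := contMDiffOn_red₀ 𝒢
    B₀_skew := fun α x hx => by
      ext I J
      exact red₀_skew 𝒢 hx I J
    B₁ := red₁ Θ 𝒢
    smooth_B₁ := smoothOneFormOn_red₁ Θ 𝒢
    B₂ := red₂ Θ 𝒢
    smooth_B₂ := isSmoothTwoFormOn_red₂ Θ 𝒢
    decomposition := fun α x hx v w => bilinAt_eq_red Θ h𝒢 hx v w
    m := m
    m_skew := ?_
    m_symm := ?_
    m_cocycle := ?_
    h := h
    smooth_h := fun α β => (hh α β).contMDiffOn h𝒢
    h_skew := fun α β x _ => by rw [hskew α β]; rfl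
    gluing_B₀ := ?_
    gluing_B₁ := ?_ }, rfl, hh⟩
  · intro α β
    rcases (P.U α ∩ P.U β).eq_empty_or_nonempty with h | ⟨x, hx⟩
    · rw [hm0 α β h]; simp
    · ext I J
      have h1 := hm α β x hx I J
      have h2 := hm α β x hx J I
      rw [red₀_skew 𝒢 hx.1 I J, red₀_skew 𝒢 hx.2 I J] at h2
      simp only [Matrix.transpose_apply, Matrix.neg_apply]
      have : (m α β J I : ℝ) = -(m α β I J : ℝ) := by linarith
      exact_mod_cast this
  · intro α β
    rcases (P.U α ∩ P.U β).eq_empty_or_nonempty with h | ⟨x, hx⟩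
    · rw [hm0 α β h, hm0 β α (by rw [inter_comm]; exact h), neg_zero]
    · ext I J
      have h1 := hm α β x hx I J
      have h2 := hm β α x hx.symm I J
      simp only [Matrix.neg_apply]
      have : (m β α I J : ℝ) = -(m α β I J : ℝ) := by linarith
      exact_mod_cast this
  · rintro α β γ ⟨x, hx⟩
    ext I J
    have h1 := hm α β x hx.1 I J
    have h2 := hm β γ x ⟨hx.1.2, hx.2⟩ I J
    have h3 := hm γ α x ⟨hx.2, hx.1.1⟩ I J
    simp only [Matrix.add_apply, Matrix.zero_apply]
    have : (m α β I J : ℝ) + m β γ I J + m γ α I J = 0 := by linarith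
    exact_mod_cast this
  · intro α β x hx
    ext I J
    exact hm α β x hx I J
  · intro α β x hx I v'
    let v : E := v'
    have h1 := (hh α β).tmap_apply h𝒢 hx I v
    rw [bilinAt_curv, bilinAt_mid Θ h𝒢 hx hx.1, bilinAt_mid Θ h𝒢 hx hx.2] at h1
    have h2 : formAt (red₁ Θ 𝒢 α I) x v - formAt (red₁ Θ 𝒢 β I) x v =
        tmap E (Fin n → ℝ) (h α β) x v I + ∑ J, (m α β I J : ℝ) *
          (formAt (Θ.potential β J) x v - 1 / 2 * tmap E (Fin n → ℝ) (P.lam β α) x v J) := by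
      rw [h1]
      simp only [← hm α β x hx I, sub_mul, Finset.sum_sub_distrib]
      ring
    exact h2

end ReductionData

section Cocycle

variable {Θ} (R : Reduction P Θ 𝒢)

/-- The translation part of the affine coordinate change from the `β`-th to the `α`-th
coordinates of `Y`, obtained by solving the symmetric gluing relation for the former. -/
def Reduction.trans (α β : ι) (x : M) : Fin n ⊕ Fin n → ℝ :=
  (R.G α β).map (Int.cast : ℤ → ℝ) *ᵥ ((1 / 2 : ℝ) • R.shift β α x) - (1 / 2 : ℝ) • R.shift α β x

lemma Reduction.G_mulVec_inl (α β : ι) (w : Fin n ⊕ Fin n → ℝ) (I : Fin n) :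
    ((R.G α β).map (Int.cast : ℤ → ℝ) *ᵥ w) (Sum.inl I) =
      w (Sum.inl I) + ∑ J, (R.m α β I J : ℝ) * w (Sum.inr J) := by
  simp [Reduction.G, Matrix.mulVec, dotProduct, Matrix.one_apply, Fintype.sum_sum_type]

lemma Reduction.G_mulVec_inr (α β : ι) (w : Fin n ⊕ Fin n → ℝ) (I : Fin n) :
    ((R.G α β).map (Int.cast : ℤ → ℝ) *ᵥ w) (Sum.inr I) = w (Sum.inr I) := by
  simp [Reduction.G, Matrix.mulVec, dotProduct, Matrix.one_apply, Fintype.sum_sum_type]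

lemma Reduction.trans_inl {α β : ι} {x : M} (hx : x ∈ P.U α ∩ P.U β) (I : Fin n) :
    R.trans α β x (Sum.inl I) =
      -R.h α β x I - 1 / 2 * ∑ J, (R.m α β I J : ℝ) * P.lam α β x J := by
  simp only [Reduction.trans, Pi.sub_apply, R.G_mulVec_inl, Reduction.shift, Pi.smul_apply,
    Sum.elim_inl, Sum.elim_inr, smul_eq_mul, R.h_skew α β x hx, P.lam_skew α β x hx, Pi.neg_apply]
  rw [Finset.mul_sum, sub_eq_add_neg (-R.h α β x I), ← Finset.sum_neg_distrib]
  have : ∑ J, (R.m α β I J : ℝ) * (1 / 2 * -P.lam α β x J) =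
      ∑ J, -(1 / 2 * ((R.m α β I J : ℝ) * P.lam α β x J)) :=
    Finset.sum_congr rfl fun J _ => by ring
  rw [this]; ring

lemma Reduction.trans_inr {α β : ι} {x : M} (hx : x ∈ P.U α ∩ P.U β) (I : Fin n) :
    R.trans α β x (Sum.inr I) = -P.lam α β x I := by
  simp only [Reduction.trans, Pi.sub_apply, R.G_mulVec_inr, Reduction.shift, Pi.smul_apply,
    Sum.elim_inr, smul_eq_mul, P.lam_skew α β x hx, Pi.neg_apply]
  ring

lemma Reduction.m_self (α : ι) : R.m α α = 0 := by
  have h := R.m_symm α α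
  ext I J
  have h2 := congrFun (congrFun h I) J
  simp only [Matrix.neg_apply] at h2
  simp only [Matrix.zero_apply]
  omega

lemma Reduction.G_self (α : ι) : R.G α α = 1 := by
  rw [Reduction.G, R.m_self, Matrix.fromBlocks_one]

lemma Reduction.G_mul {α β γ : ι} (h : (P.U α ∩ P.U β ∩ P.U γ).Nonempty) :
    R.G α β * R.G β γ = R.G α γ := by
  have h1 := R.m_cocycle α β γ h
  rw [R.m_symm α γ, ← sub_eq_add_neg, sub_eq_zero] at h1
  simp [Reduction.G, Matrix.fromBlocks_multiply, ← h1, add_comm]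

lemma Reduction.trans_self {α : ι} {x : M} (hx : x ∈ P.U α) : R.trans α α x = 0 := by
  have hx' : x ∈ P.U α ∩ P.U α := ⟨hx, hx⟩
  have hl : ∀ I, P.lam α α x I = 0 := fun I => by
    have := congrFun (P.lam_skew α α x hx') I
    rw [Pi.neg_apply] at this
    linarith
  have hh : ∀ I, R.h α α x I = 0 := fun I => by
    have := congrFun (R.h_skew α α x hx') I
    rw [Pi.neg_apply] at this
    linarith
  funext i
  rcases i with I | I
  · rw [R.trans_inl hx']; simp [hl, hh]
  · rw [R.trans_inr hx']; simp [hl]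

/-- The functions `λ_{αβ}` form a cocycle modulo integers. -/
lemma lam_cocycle (P : PrincipalTorusBundle n E M E' X ι) {α β γ : ι} {x : M}
    (hα : x ∈ P.U α) (hβ : x ∈ P.U β) (hγ : x ∈ P.U γ) :
    EqModInt (P.lam α γ x) (P.lam α β x + P.lam β γ x) := by
  refine ((P.chart γ).eq_iff x hγ _ _).1 ?_
  rw [← P.lam_spec α γ x ⟨hα, hγ⟩, torusPt_add, ← vadd_vadd, ← P.lam_spec β γ x ⟨hβ, hγ⟩,
    ← P.lam_spec α β x ⟨hα, hβ⟩]

variable [IsManifold 𝓘(ℝ, E) ∞ M] [IsManifold 𝓘(ℝ, E') ∞ X]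

/-- The fibre holonomy in terms of the fibre coordinates. -/
lemma fibreHol_coord (h𝒢 : IsTorusInvariant P 𝒢) (hB : R.B₀ = red₀ 𝒢) {α β : ι}
    (hh : IsHolLog 𝒢 α β (R.h α β)) {x : M} (hx : x ∈ P.U α ∩ P.U β) (I : Fin n)
    (θ : Fin n → ℝ) :
    fibreHol 𝒢 α β I (P.coord α x θ) = Circle.exp (2 * Real.pi * (R.h α β x I
      - ∑ J, (R.m α β I J : ℝ) * (θ J + 1 / 2 * P.lam α β x J))) := by
  rw [P.coord_eq_vadd_mid α β, fibreHol_vadd h𝒢 I (P.mid_mem hx).1 (P.mid_mem hx).2,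
    ← hh.2 x hx I, ← Circle.exp_add, P.proj_mid hx.1, ← mul_add, ← sub_eq_add_neg]
  have h1 : ∀ J, red₀ 𝒢 α x I J - red₀ 𝒢 β x I J = R.m α β I J := by
    intro J
    rw [← hB]
    exact congrFun (congrFun (R.gluing_B₀ α β x hx) I) J
  simp only [h1, Pi.add_apply, Pi.smul_apply, smul_eq_mul]

/-- The affine coordinate changes satisfy the cocycle condition modulo integers: this combines the
multiplicativity of the fibre holonomies with the cocycle `λ`. -/
lemma Reduction.trans_cocycle (h𝒢 : IsTorusInvariant P 𝒢) (hB : R.B₀ = red₀ 𝒢)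
    (hh : ∀ α β, IsHolLog 𝒢 α β (R.h α β)) {α β γ : ι} {x : M}
    (hα : x ∈ P.U α) (hβ : x ∈ P.U β) (hγ : x ∈ P.U γ) :
    EqModInt (R.trans α γ x)
      ((R.G α β).map (Int.cast : ℤ → ℝ) *ᵥ R.trans β γ x + R.trans α β x) := by
  obtain ⟨l, hl⟩ := lam_cocycle P hα hβ hγ
  have hm : ∀ I J, R.m α γ I J = R.m α β I J + R.m β γ I J := by
    intro I J
    have h1 := R.m_cocycle α β γ ⟨x, ⟨hα, hβ⟩, hγ⟩
    rw [R.m_symm α γ, ← sub_eq_add_neg, sub_eq_zero] at h1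
    rw [← h1, Matrix.add_apply]
  -- the logarithm of `H_{αβ} H_{βγ} = H_{αγ}` at the point `θ_α = 0`
  have hstar : ∀ I, ∃ k : ℤ, R.h α β x I + R.h β γ x I - R.h α γ x I
      - ∑ J, ((R.m α β I J : ℝ) * (1 / 2 * P.lam α β x J)
        + (R.m β γ I J : ℝ) * (P.lam α β x J + 1 / 2 * P.lam β γ x J)
        - (R.m α γ I J : ℝ) * (1 / 2 * P.lam α γ x J)) = k := by
    intro I
    have hyα : P.coord α x 0 ∈ P.patch α := by
      rw [PrincipalTorusBundle.patch, mem_preimage, P.proj_coord hα]; exact hα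
    have hyβ : P.coord α x 0 ∈ P.patch β := by
      rw [PrincipalTorusBundle.patch, mem_preimage, P.proj_coord hα]; exact hβ
    have hyγ : P.coord α x 0 ∈ P.patch γ := by
      rw [PrincipalTorusBundle.patch, mem_preimage, P.proj_coord hα]; exact hγ
    have h1 := fibreHol_mul 𝒢 I hyα hyβ hyγ
    rw [fibreHol_coord R h𝒢 hB (hh α β) ⟨hα, hβ⟩, fibreHol_coord R h𝒢 hB (hh α γ) ⟨hα, hγ⟩,
      P.coord_eq_coord ⟨hα, hβ⟩, fibreHol_coord R h𝒢 hB (hh β γ) ⟨hβ, hγ⟩, ← Circle.exp_add,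
      ← div_eq_one, ← Circle.exp_sub, ← mul_add, ← mul_sub, circle_exp_eq_one_iff] at h1
    obtain ⟨k, hk⟩ := h1
    refine ⟨k, hk ▸ ?_⟩
    simp only [Pi.add_apply, Pi.zero_apply, zero_add, Finset.sum_sub_distrib,
      Finset.sum_add_distrib]
    ring
  choose k hk using hstar
  refine ⟨Sum.elim (fun I => k I + ∑ J, R.m α γ I J * (-l J)) (fun I => -l I), fun i => ?_⟩
  rcases i with I | I
  · rw [R.trans_inl ⟨hα, hγ⟩, Pi.add_apply, R.G_mulVec_inl, R.trans_inl ⟨hβ, hγ⟩,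
      R.trans_inl ⟨hα, hβ⟩]
    simp only [R.trans_inr ⟨hβ, hγ⟩, Sum.elim_inl]
    push_cast
    rw [← hk I]
    have hsum : ∑ J, ((R.m α β I J : ℝ) * (1 / 2 * P.lam α β x J)
        + (R.m β γ I J : ℝ) * (P.lam α β x J + 1 / 2 * P.lam β γ x J)
        - (R.m α γ I J : ℝ) * (1 / 2 * P.lam α γ x J)) =
        1 / 2 * ∑ J, (R.m α γ I J : ℝ) * P.lam α γ x J
        - 1 / 2 * ∑ J, (R.m β γ I J : ℝ) * P.lam β γ x J
        - 1 / 2 * ∑ J, (R.m α β I J : ℝ) * P.lam α β x J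
        + ∑ J, (R.m α β I J : ℝ) * -P.lam β γ x J
        + ∑ J, (R.m α γ I J : ℝ) * -(l J : ℝ) := by
      simp only [Finset.mul_sum, ← Finset.sum_add_distrib, ← Finset.sum_sub_distrib]
      refine Finset.sum_congr rfl fun J _ => ?_
      rw [hl J, hm I J, Pi.add_apply]
      push_cast
      ring
    rw [hsum]
    ring
  · rw [R.trans_inr ⟨hα, hγ⟩, Pi.add_apply, R.G_mulVec_inr, R.trans_inr ⟨hβ, hγ⟩,
      R.trans_inr ⟨hα, hβ⟩, hl I]
    simp
    ring

end Cocycle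

/-! ### The torus as a quotient of its space of coordinates -/

section TorusCoordinates

variable {κ : Type*}

/-- The point of `(ℝ/ℤ)^κ` with the given coordinates. -/
def toTorus (w : κ → ℝ) : κ → UnitAddCircle := fun i => (w i : UnitAddCircle)

lemma toTorus_surjective : Function.Surjective (toTorus (κ := κ)) := fun t => by
  choose θ hθ using fun i => QuotientAddGroup.mk_surjective (t i)
  exact ⟨θ, funext hθ⟩

lemma toTorus_eq_iff {a b : κ → ℝ} : toTorus a = toTorus b ↔ EqModInt a b := by
  rw [funext_iff]
  simp only [toTorus, coe_unitAddCircle_eq_iff, EqModInt]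
  exact ⟨fun h => ⟨fun i => (h i).choose, fun i => (h i).choose_spec⟩,
    fun ⟨k, hk⟩ i => ⟨k i, hk i⟩⟩

variable [Fintype κ]

/-- The inverse of a chart of the torus: the quotient map on the open unit cube with centre `θ`. -/
def torusSheet (θ : κ → ℝ) : OpenPartialHomeomorph (κ → ℝ) (κ → UnitAddCircle) :=
  OpenPartialHomeomorph.pi fun i => AddCircle.openPartialHomeomorphCoe (1 : ℝ) (θ i - 1 / 2)

lemma mem_torusSheet_source (θ : κ → ℝ) : θ ∈ (torusSheet θ).source := by
  change θ ∈ Set.pi univ _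
  intro i _
  change θ i ∈ Ioo (θ i - 1 / 2) (θ i - 1 / 2 + 1)
  constructor <;> linarith

lemma toTorus_torusSheet_symm {θ : κ → ℝ} {t : κ → UnitAddCircle}
    (ht : t ∈ (torusSheet θ).target) : toTorus ((torusSheet θ).symm t) = t :=
  (torusSheet θ).right_inv ht

/-- A continuous function which agrees modulo integers with a smooth one is smooth: the integers are
locally constant. -/
lemma contDiffAt_of_eqModInt {V : Type*} [NormedAddCommGroup V] [NormedSpace ℝ V]
    {u v : V → κ → ℝ} {z : V} (hu : ContinuousAt u z) (hv : ContDiffAt ℝ ∞ v z)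
    (huv : ∀ᶠ y in 𝓝 z, EqModInt (u y) (v y)) : ContDiffAt ℝ ∞ u z := by
  have h1 : ∀ᶠ y in 𝓝 z, dist ((u - v) y) ((u - v) z) < 1 :=
    Metric.tendsto_nhds.1 (hu.sub hv.continuousAt) 1 one_pos
  refine (hv.add (contDiffAt_const (c := u z - v z))).congr_of_eventuallyEq ?_
  filter_upwards [h1, huv] with y hy hy'
  obtain ⟨k, hk⟩ := hy'
  obtain ⟨k₀, hk₀⟩ := huv.self_of_nhds
  funext i
  have h2 := (dist_le_pi_dist ((u - v) y) ((u - v) z) i).trans_lt hy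
  rw [Real.dist_eq, Pi.sub_apply, Pi.sub_apply, Pi.sub_apply, Pi.sub_apply, hk, hk₀,
    add_sub_cancel_left, add_sub_cancel_left] at h2
  have h3 : k i = k₀ i := by
    rw [← sub_eq_zero, ← Int.abs_lt_one_iff]
    exact_mod_cast h2
  simp only [Pi.add_apply, Pi.sub_apply]
  rw [hk i, hk₀ i, h3]
  ring

end TorusCoordinates

/-! ### Affine torus bundles from cocycles -/

/-- A cocycle of affine transformations of `ℝ^κ / ℤ^κ` on a cover of `M`, with linear parts
`G α β ∈ GL(κ, ℤ)` and translations represented by smooth functions `c α β` on the overlaps. -/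
structure AffineCocycle (κ : Type*) [Fintype κ] [DecidableEq κ]
    (E : Type*) [NormedAddCommGroup E] [NormedSpace ℝ E]
    (M : Type*) [TopologicalSpace M] [ChartedSpace E M] (ι : Type*) where
  U : ι → Set M
  isOpen_U : ∀ α, IsOpen (U α)
  cover : ⋃ α, U α = univ
  G : ι → ι → Matrix κ κ ℤ
  c : ι → ι → M → κ → ℝ
  smooth_c : ∀ α β, ContMDiffOn 𝓘(ℝ, E) 𝓘(ℝ, κ → ℝ) ∞ (c α β) (U α ∩ U β)
  G_self : ∀ α, G α α = 1
  c_self : ∀ α, ∀ x ∈ U α, c α α x = 0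
  G_mul : ∀ α β γ, (U α ∩ U β ∩ U γ).Nonempty → G α β * G β γ = G α γ
  c_cocycle : ∀ α β γ, ∀ x ∈ U α ∩ U β ∩ U γ,
    EqModInt (c α γ x) ((G α β).map (Int.cast : ℤ → ℝ) *ᵥ c β γ x + c α β x)

namespace AffineCocycle

variable {κ : Type*} [Fintype κ] [DecidableEq κ]
  {E : Type*} [NormedAddCommGroup E] [NormedSpace ℝ E]
  {M : Type*} [TopologicalSpace M] [ChartedSpace E M] {ι : Type*}
  (C : AffineCocycle κ E M ι)

/-- The affine coordinate change on `ℝ^κ`, from the `β`-th to the `α`-th coordinates. -/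
def change (α β : ι) (x : M) (w : κ → ℝ) : κ → ℝ :=
  (C.G α β).map (Int.cast : ℤ → ℝ) *ᵥ w + C.c α β x

/-- The affine coordinate change on `ℝ^κ / ℤ^κ`, from the `β`-th to the `α`-th coordinates. -/
def torusChange (α β : ι) (x : M) (t : κ → UnitAddCircle) : κ → UnitAddCircle := fun i =>
  ∑ j, C.G α β i j • t j + (C.c α β x i : UnitAddCircle)

lemma torusChange_toTorus (α β : ι) (x : M) (w : κ → ℝ) :
    C.torusChange α β x (toTorus w) = toTorus (C.change α β x w) := by
  funext i
  simp only [torusChange, toTorus, change, Matrix.mulVec, dotProduct, Pi.add_apply,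
    Matrix.map_apply, AddCircle.coe_add]
  congr 1
  have h : ∀ s : Finset κ, ((∑ j ∈ s, (C.G α β i j : ℝ) * w j : ℝ) : UnitAddCircle) =
      ∑ j ∈ s, C.G α β i j • (w j : UnitAddCircle) := by
    intro s
    rw [show ((∑ j ∈ s, (C.G α β i j : ℝ) * w j : ℝ) : UnitAddCircle) =
      ∑ j ∈ s, (((C.G α β i j : ℝ) * w j : ℝ) : UnitAddCircle) from
        map_sum (QuotientAddGroup.mk' _) _ _]
    refine Finset.sum_congr rfl fun j _ => ?_
    rw [← zsmul_eq_mul, AddCircle.coe_zsmul]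
  exact (h _).symm

lemma torusChange_self {α : ι} {x : M} (hx : x ∈ C.U α) (t : κ → UnitAddCircle) :
    C.torusChange α α x t = t := by
  obtain ⟨w, rfl⟩ := toTorus_surjective t
  rw [torusChange_toTorus, change, C.G_self, C.c_self α x hx]
  simp [Matrix.map_one]

lemma torusChange_comp {α β γ : ι} {x : M} (hx : x ∈ C.U α ∩ C.U β ∩ C.U γ)
    (t : κ → UnitAddCircle) :
    C.torusChange α β x (C.torusChange β γ x t) = C.torusChange α γ x t := by
  obtain ⟨w, rfl⟩ := toTorus_surjective t
  rw [torusChange_toTorus, torusChange_toTorus, torusChange_toTorus, toTorus_eq_iff]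
  obtain ⟨k, hk⟩ := C.c_cocycle α β γ x hx
  refine ⟨-k, fun i => ?_⟩
  have hG : (C.G α γ).map (Int.cast : ℤ → ℝ) =
      (C.G α β).map (Int.cast : ℤ → ℝ) * (C.G β γ).map (Int.cast : ℤ → ℝ) := by
    rw [← C.G_mul α β γ ⟨x, hx⟩]
    exact Matrix.map_mul (f := Int.castRingHom ℝ)
  simp only [change, Matrix.mulVec_add, Pi.add_apply, hG, Matrix.mulVec_mulVec, hk i, Pi.neg_apply,
    Int.cast_neg]
  ring

lemma continuousOn_torusChange (α β : ι) :
    ContinuousOn (fun p : M × (κ → UnitAddCircle) => C.torusChange α β p.1 p.2)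
      ((C.U α ∩ C.U β) ×ˢ univ) := by
  refine continuousOn_pi.2 fun i => ContinuousOn.add ?_ ?_
  · refine Continuous.continuousOn (continuous_finsetSum _ fun j _ => ?_)
    exact (continuous_zsmul _).comp ((continuous_apply j).comp continuous_snd)
  · have h1 : ContinuousOn (fun x => C.c α β x i) (C.U α ∩ C.U β) :=
      (continuous_apply i).comp_continuousOn (C.smooth_c α β).continuousOn
    exact (AddCircle.continuous_mk' (1 : ℝ)).comp_continuousOn
      (h1.comp continuousOn_fst fun p hp => hp.1)

lemma exists_mem (x : M) : ∃ α, x ∈ C.U α := by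
  have h : x ∈ ⋃ α, C.U α := by rw [C.cover]; trivial
  exact mem_iUnion.1 h

/-- The fibre bundle with fibre `ℝ^κ / ℤ^κ` glued by the coordinate changes. -/
def core : FiberBundleCore ι M (κ → UnitAddCircle) where
  baseSet := C.U
  isOpen_baseSet := C.isOpen_U
  indexAt x := (C.exists_mem x).choose
  mem_baseSet_at x := (C.exists_mem x).choose_spec
  coordChange β α x := C.torusChange α β x
  coordChange_self α x hx t := C.torusChange_self hx t
  continuousOn_coordChange β α := by
    rw [inter_comm]; exact C.continuousOn_torusChange α β
  coordChange_comp γ β α x hx t := C.torusChange_comp ⟨⟨hx.2, hx.1.2⟩, hx.1.1⟩ t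

/-- The total space of the torus bundle. -/
abbrev Total : Type _ := C.core.TotalSpace

/-- The trivialization over `U α`. -/
def triv (α : ι) : OpenPartialHomeomorph C.Total (M × (κ → UnitAddCircle)) :=
  (C.core.localTriv α).toOpenPartialHomeomorph

/-- The projection of the torus bundle. -/
def proj (y : C.Total) : M := Bundle.TotalSpace.proj y

lemma continuous_proj : Continuous C.proj := C.core.continuous_proj

/-- The point over `x` with fibre coordinates `w` in the `α`-th chart. -/
def point (α : ι) (x : M) (w : κ → ℝ) : C.Total := (C.triv α).symm (x, toTorus w)

lemma mem_triv_source {α : ι} {y : C.Total} : y ∈ (C.triv α).source ↔ C.proj y ∈ C.U α := Iff.rfl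

lemma mem_triv_target {α : ι} {q : M × (κ → UnitAddCircle)} :
    q ∈ (C.triv α).target ↔ q.1 ∈ C.U α := C.core.mem_localTriv_target α q

lemma triv_fst (α : ι) (y : C.Total) : (C.triv α y).1 = C.proj y := rfl

lemma triv_triv_symm {α β : ι} {x : M} (hx : x ∈ C.U α ∩ C.U β) (t : κ → UnitAddCircle) :
    C.triv α ((C.triv β).symm (x, t)) = (x, C.torusChange α β x t) := by
  refine Prod.ext rfl ?_
  change C.torusChange α (C.core.indexAt x) x (C.torusChange (C.core.indexAt x) β x t) = _
  exact C.torusChange_comp ⟨⟨hx.1, C.core.mem_baseSet_at x⟩, hx.2⟩ t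

lemma proj_point (α : ι) (x : M) (w : κ → ℝ) : C.proj (C.point α x w) = x := rfl

lemma triv_point {α : ι} {x : M} (hx : x ∈ C.U α) (w : κ → ℝ) :
    C.triv α (C.point α x w) = (x, toTorus w) :=
  (C.triv α).right_inv (C.mem_triv_target.2 hx)

lemma exists_point_eq {α : ι} {y : C.Total} (hy : C.proj y ∈ C.U α) :
    ∃ w, C.point α (C.proj y) w = y := by
  obtain ⟨w, hw⟩ := toTorus_surjective (C.triv α y).2
  refine ⟨w, ?_⟩
  rw [point, hw]
  exact (C.triv α).left_inv (C.mem_triv_source.2 hy)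

lemma point_eq_iff {α : ι} {x : M} (hx : x ∈ C.U α) {w w' : κ → ℝ} :
    C.point α x w = C.point α x w' ↔ EqModInt w w' := by
  rw [← toTorus_eq_iff]
  refine ⟨fun h => ?_, fun h => by rw [point, h]; rfl⟩
  have h1 := congrArg (C.triv α) h
  rw [C.triv_point hx, C.triv_point hx] at h1
  exact (Prod.ext_iff.1 h1).2

lemma point_eq_point {α β : ι} {x : M} (hx : x ∈ C.U α ∩ C.U β) (w : κ → ℝ) :
    C.point β x w = C.point α x (C.change α β x w) := by
  have h : C.triv α (C.point β x w) = C.triv α (C.point α x (C.change α β x w)) := by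
    rw [C.triv_point hx.1, point, C.triv_triv_symm hx, torusChange_toTorus]
  have hs : ∀ y : C.Total, C.proj y = x → y ∈ (C.triv α).source :=
    fun y hy => C.mem_triv_source.2 (hy ▸ hx.1)
  exact (C.triv α).injOn (hs _ rfl) (hs _ rfl) h

/-- A chart of the total space around the point with coordinates `θ` over `x₀`. -/
def chart (α : ι) (x₀ : M) (θ : κ → ℝ) : OpenPartialHomeomorph C.Total (E × (κ → ℝ)) :=
  (C.triv α).trans ((chartAt E x₀).prod (torusSheet θ).symm)

lemma mem_chart_source {α : ι} {x₀ : M} {θ : κ → ℝ} {y : C.Total} :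
    y ∈ (C.chart α x₀ θ).source ↔ C.proj y ∈ C.U α ∧ C.proj y ∈ (chartAt E x₀).source ∧
      (C.triv α y).2 ∈ (torusSheet θ).target := by
  simp only [chart, OpenPartialHomeomorph.trans_source, mem_inter_iff, C.mem_triv_source,
    mem_preimage, OpenPartialHomeomorph.prod_source, mem_prod, C.triv_fst,
    OpenPartialHomeomorph.symm_source]

lemma chart_apply (α : ι) (x₀ : M) (θ : κ → ℝ) (y : C.Total) :
    C.chart α x₀ θ y = (chartAt E x₀ (C.proj y), (torusSheet θ).symm (C.triv α y).2) := rfl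

lemma chart_symm_apply (α : ι) (x₀ : M) (θ : κ → ℝ) (q : E × (κ → ℝ)) :
    (C.chart α x₀ θ).symm q = C.point α ((chartAt E x₀).symm q.1) q.2 := rfl

lemma mem_chart_target {α : ι} {x₀ : M} {θ : κ → ℝ} {q : E × (κ → ℝ)} :
    q ∈ (C.chart α x₀ θ).target ↔ (q.1 ∈ (chartAt E x₀).target ∧ q.2 ∈ (torusSheet θ).source) ∧
      (chartAt E x₀).symm q.1 ∈ C.U α := by
  simp only [chart, OpenPartialHomeomorph.trans_target, mem_inter_iff, mem_preimage,
    OpenPartialHomeomorph.prod_target, mem_prod, OpenPartialHomeomorph.symm_target,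
    C.mem_triv_target]
  rfl

lemma point_mem_chart_source {α : ι} {x₀ : M} (hx : x₀ ∈ C.U α) (θ : κ → ℝ) :
    C.point α x₀ θ ∈ (C.chart α x₀ θ).source := by
  rw [mem_chart_source, C.proj_point, C.triv_point hx]
  exact ⟨hx, _root_.mem_chart_source E x₀, (torusSheet θ).map_source (mem_torusSheet_source θ)⟩

lemma exists_chart_source (y : C.Total) :
    ∃ a : ι × M × (κ → ℝ), y ∈ (C.chart a.1 a.2.1 a.2.2).source := by
  obtain ⟨α, hα⟩ := C.exists_mem (C.proj y)
  obtain ⟨w, hw⟩ := C.exists_point_eq hα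
  refine ⟨(α, C.proj y, w), ?_⟩
  have := C.point_mem_chart_source hα w
  rwa [hw] at this

/-- The smooth structure of the total space, with the charts `chart α x₀ θ`. -/
instance chartedSpace : ChartedSpace (E × (κ → ℝ)) C.Total where
  atlas := range fun a : ι × M × (κ → ℝ) => C.chart a.1 a.2.1 a.2.2
  chartAt y := C.chart (C.exists_chart_source y).choose.1 (C.exists_chart_source y).choose.2.1
    (C.exists_chart_source y).choose.2.2
  mem_chart_source y := (C.exists_chart_source y).choose_spec
  chart_mem_atlas _ := ⟨_, rfl⟩

lemma chart_mem_atlas (α : ι) (x₀ : M) (θ : κ → ℝ) :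
    C.chart α x₀ θ ∈ atlas (E × (κ → ℝ)) C.Total := ⟨(α, x₀, θ), rfl⟩

section Manifold

variable [IsManifold 𝓘(ℝ, E) ∞ M]

lemma contMDiffAt_chartAt_symm {x₀ : M} {z : E} (hz : z ∈ (chartAt E x₀).target) :
    ContMDiffAt 𝓘(ℝ, E) 𝓘(ℝ, E) ∞ (chartAt E x₀).symm z :=
  contMDiffAt_symm_of_mem_maximalAtlas (IsManifold.chart_mem_maximalAtlas x₀) hz

lemma contMDiffAt_chartAt' {x₀ x : M} (hx : x ∈ (chartAt E x₀).source) :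
    ContMDiffAt 𝓘(ℝ, E) 𝓘(ℝ, E) ∞ (chartAt E x₀) x :=
  contMDiffAt_of_mem_maximalAtlas (IsManifold.chart_mem_maximalAtlas x₀) hx

instance isManifold : IsManifold 𝓘(ℝ, E × (κ → ℝ)) ∞ C.Total := by
  refine isManifold_of_contDiffOn _ _ _ ?_
  rintro _ _ ⟨⟨β, x₀, θ₀⟩, rfl⟩ ⟨⟨α, x₁, θ₁⟩, rfl⟩
  simp only [modelWithCornersSelf_coe, modelWithCornersSelf_coe_symm, Function.id_comp,
    Function.comp_id, preimage_id, range_id, inter_univ]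
  intro q hq
  refine ContDiffAt.contDiffWithinAt ?_
  set T := (C.chart β x₀ θ₀).symm ≫ₕ C.chart α x₁ θ₁ with hT
  have hTopen : T.source ∈ 𝓝 q := T.open_source.mem_nhds hq
  have hsrc : ∀ q ∈ T.source, q.1 ∈ (chartAt E x₀).target ∧
      (chartAt E x₀).symm q.1 ∈ C.U α ∩ C.U β ∧ (chartAt E x₀).symm q.1 ∈ (chartAt E x₁).source ∧
      (T q).1 = chartAt E x₁ ((chartAt E x₀).symm q.1) ∧
      EqModInt (T q).2 (C.change α β ((chartAt E x₀).symm q.1) q.2) := by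
    intro q hq
    rw [hT, OpenPartialHomeomorph.trans_source, OpenPartialHomeomorph.symm_source, mem_inter_iff,
      C.mem_chart_target, mem_preimage, C.mem_chart_source, C.chart_symm_apply, C.proj_point] at hq
    obtain ⟨⟨⟨h1, h2⟩, h3⟩, h4, h5, h6⟩ := hq
    refine ⟨h1, ⟨h4, h3⟩, h5, rfl, ?_⟩
    rw [← toTorus_eq_iff]
    refine (toTorus_torusSheet_symm h6).trans ?_
    rw [C.point_eq_point ⟨h4, h3⟩, C.triv_point h4]
  have hx := hsrc q hq
  have hk : ContMDiffAt 𝓘(ℝ, E × (κ → ℝ)) 𝓘(ℝ, E) ∞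
      (fun q : E × (κ → ℝ) => (chartAt E x₀).symm q.1) q :=
    ContMDiffAt.comp (g := (chartAt E x₀).symm) (f := Prod.fst) q
      (contMDiffAt_chartAt_symm hx.1) contDiffAt_fst.contMDiffAt
  have h1 : ContDiffAt ℝ ∞ (fun q => (T q).1) q := by
    have h2 : ContMDiffAt 𝓘(ℝ, E × (κ → ℝ)) 𝓘(ℝ, E) ∞
        (fun q : E × (κ → ℝ) => chartAt E x₁ ((chartAt E x₀).symm q.1)) q :=
      ContMDiffAt.comp (g := chartAt E x₁) q (contMDiffAt_chartAt' hx.2.2.1) hk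
    refine h2.contDiffAt.congr_of_eventuallyEq ?_
    filter_upwards [hTopen] with q' hq' using (hsrc q' hq').2.2.2.1
  have h2 : ContDiffAt ℝ ∞ (fun q => (T q).2) q := by
    have hc : ContDiffAt ℝ ∞ (fun q : E × (κ → ℝ) => C.c α β ((chartAt E x₀).symm q.1)) q :=
      (ContMDiffAt.comp (g := C.c α β) q ((C.smooth_c α β _ hx.2.1).contMDiffAt
        (((C.isOpen_U α).inter (C.isOpen_U β)).mem_nhds hx.2.1)) hk).contDiffAt
    have hl : ContDiffAt ℝ ∞ (fun q : E × (κ → ℝ) =>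
        (C.G α β).map (Int.cast : ℤ → ℝ) *ᵥ q.2) q :=
      (Matrix.mulVecLin ((C.G α β).map
        (Int.cast : ℤ → ℝ))).toContinuousLinearMap.contDiff.contDiffAt.comp q contDiffAt_snd
    refine contDiffAt_of_eqModInt ?_ (hl.add hc) ?_
    · exact continuous_snd.continuousAt.comp (T.continuousAt hq)
    · filter_upwards [hTopen] with q' hq' using (hsrc q' hq').2.2.2.2
  exact h1.prodMk h2

lemma contMDiff_proj : ContMDiff 𝓘(ℝ, E × (κ → ℝ)) 𝓘(ℝ, E) ∞ C.proj := by
  intro y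
  obtain ⟨⟨α, x₀, θ⟩, hy⟩ := C.exists_chart_source y
  have h1 : ContMDiffAt 𝓘(ℝ, E × (κ → ℝ)) 𝓘(ℝ, E × (κ → ℝ)) ∞ (C.chart α x₀ θ) y :=
    contMDiffAt_of_mem_maximalAtlas
      (IsManifold.subset_maximalAtlas (C.chart_mem_atlas α x₀ θ)) hy
  have h2 : ContMDiffAt 𝓘(ℝ, E × (κ → ℝ)) 𝓘(ℝ, E) ∞ (fun y => (C.chart α x₀ θ y).1) y :=
    ContMDiffAt.comp (g := Prod.fst) y contDiffAt_fst.contMDiffAt h1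
  have hs := C.mem_chart_source.1 hy
  have h3 : ContMDiffAt 𝓘(ℝ, E × (κ → ℝ)) 𝓘(ℝ, E) ∞
      (fun y => (chartAt E x₀).symm (C.chart α x₀ θ y).1) y :=
    ContMDiffAt.comp (g := (chartAt E x₀).symm) y
      (contMDiffAt_chartAt_symm ((chartAt E x₀).map_source hs.2.1)) h2
  refine h3.congr_of_eventuallyEq ?_
  filter_upwards [(C.chart α x₀ θ).open_source.mem_nhds hy] with y' hy'
  exact ((chartAt E x₀).left_inv (C.mem_chart_source.1 hy').2.1).symm

lemma isLocalDiffeomorphOn_point (α : ι) :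
    IsLocalDiffeomorphOn (𝓘(ℝ, E).prod 𝓘(ℝ, κ → ℝ)) 𝓘(ℝ, E × (κ → ℝ)) ∞
      (fun q : M × (κ → ℝ) => C.point α q.1 q.2) (C.U α ×ˢ univ) := by
  rintro ⟨⟨x₀, θ⟩, hx₀, -⟩
  have he := IsManifold.subset_maximalAtlas (I := 𝓘(ℝ, E × (κ → ℝ))) (n := ∞)
    (C.chart_mem_atlas α x₀ θ)
  set e := C.chart α x₀ θ with hedef
  let H : OpenPartialHomeomorph (M × (κ → ℝ)) C.Total :=
    ((chartAt E x₀).prod (OpenPartialHomeomorph.refl (κ → ℝ))).trans e.symm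
  have hHs : ∀ q ∈ H.source, q.1 ∈ (chartAt E x₀).source ∧ (chartAt E x₀ q.1, q.2) ∈ e.target := by
    intro q hq
    simpa [H, OpenPartialHomeomorph.trans_source] using hq
  have hHt : ∀ y ∈ H.target, y ∈ e.source ∧ (e y).1 ∈ (chartAt E x₀).target := by
    intro y hy
    simpa [H, OpenPartialHomeomorph.trans_target] using hy
  refine ⟨⟨H.toPartialEquiv, H.open_source, H.open_target, ?_, ?_⟩, ?_, ?_⟩
  · intro q hq
    refine ContMDiffAt.contMDiffWithinAt ?_
    have h1 : ContMDiffAt (𝓘(ℝ, E).prod 𝓘(ℝ, κ → ℝ)) 𝓘(ℝ, E × (κ → ℝ)) ∞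
        (fun q : M × (κ → ℝ) => (chartAt E x₀ q.1, q.2)) q :=
      ContMDiffAt.prodMk_space (ContMDiffAt.comp (g := chartAt E x₀) q
        (contMDiffAt_chartAt' (hHs q hq).1) contMDiffAt_fst) contMDiffAt_snd
    exact ContMDiffAt.comp (g := e.symm) q
      (contMDiffAt_symm_of_mem_maximalAtlas he (hHs q hq).2) h1
  · intro y hy
    refine ContMDiffAt.contMDiffWithinAt ?_
    have h1 : ContMDiffAt 𝓘(ℝ, E × (κ → ℝ)) 𝓘(ℝ, E × (κ → ℝ)) ∞ e y :=
      contMDiffAt_of_mem_maximalAtlas he (hHt y hy).1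
    have h2 : ContMDiffAt 𝓘(ℝ, E × (κ → ℝ)) 𝓘(ℝ, E) ∞ (fun y => (e y).1) y :=
      ContMDiffAt.comp (g := Prod.fst) y contDiffAt_fst.contMDiffAt h1
    have h3 : ContMDiffAt 𝓘(ℝ, E × (κ → ℝ)) 𝓘(ℝ, κ → ℝ) ∞ (fun y => (e y).2) y :=
      ContMDiffAt.comp (g := Prod.snd) y contDiffAt_snd.contMDiffAt h1
    exact (ContMDiffAt.comp (g := (chartAt E x₀).symm) y
      (contMDiffAt_chartAt_symm (hHt y hy).2) h2).prodMk h3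
  · change (x₀, θ) ∈ H.source
    have h1 := e.map_source (C.point_mem_chart_source hx₀ θ)
    have h2 : e (C.point α x₀ θ) = (chartAt E x₀ x₀, θ) := by
      rw [hedef, C.chart_apply, C.proj_point, C.triv_point hx₀]
      exact Prod.ext rfl ((torusSheet θ).left_inv (mem_torusSheet_source θ))
    rw [h2] at h1
    simpa [H, OpenPartialHomeomorph.trans_source] using h1
  · intro q hq
    change C.point α q.1 q.2 = e.symm (chartAt E x₀ q.1, q.2)
    rw [hedef, C.chart_symm_apply, (chartAt E x₀).left_inv (hHs q hq).1]

lemma isTorusChart (α : ι) :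
    IsTorusChart (E := E) (F := E × (κ → ℝ)) C.proj (C.U α) (C.point α) where
  proj_apply x _ w := C.proj_point α x w
  exists_coord _ hy := C.exists_point_eq hy
  eq_iff _ hx _ _ := C.point_eq_iff hx
  localDiffeo := C.isLocalDiffeomorphOn_point α

lemma isAffineTorusBundle (hG : ∀ α β, IsUnit (C.G α β)) :
    IsAffineTorusBundle (E := E) (F := E × (κ → ℝ)) C.proj C.U C.point C.G where
  isOpen := C.isOpen_U
  cover := C.cover
  smooth_proj := C.contMDiff_proj
  chart := C.isTorusChart
  isUnit := hG
  affine α β := ⟨C.c α β, C.smooth_c α β, fun _ hx w => C.point_eq_point hx w⟩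

end Manifold

instance t2Space [T2Space M] : T2Space C.Total := by
  refine ⟨fun y y' hne => ?_⟩
  by_cases hp : C.proj y = C.proj y'
  · obtain ⟨α, hα⟩ := C.exists_mem (C.proj y)
    have hy : y ∈ (C.triv α).source := C.mem_triv_source.2 hα
    have hy' : y' ∈ (C.triv α).source := C.mem_triv_source.2 (hp ▸ hα)
    obtain ⟨u, v, hu, hv, hyu, hyv, huv⟩ := t2_separation fun h => hne ((C.triv α).injOn hy hy' h)
    exact ⟨_, _, (C.triv α).isOpen_inter_preimage hu, (C.triv α).isOpen_inter_preimage hv,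
      ⟨hy, hyu⟩, ⟨hy', hyv⟩, (huv.preimage _).mono inter_subset_right inter_subset_right⟩
  · obtain ⟨u, v, hu, hv, hyu, hyv, huv⟩ := t2_separation hp
    exact ⟨_, _, hu.preimage C.continuous_proj, hv.preimage C.continuous_proj, hyu, hyv,
      huv.preimage _⟩

instance secondCountableTopology [SecondCountableTopology M] :
    SecondCountableTopology C.Total := by
  obtain ⟨S, hS, hSU⟩ := TopologicalSpace.isOpen_iUnion_countable C.U C.isOpen_U
  have : Countable S := hS
  have h1 : ∀ α : S, SecondCountableTopology (C.triv α).source := fun α =>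
    (C.triv α).toHomeomorphSourceTarget.isEmbedding.secondCountableTopology
  refine TopologicalSpace.secondCountableTopology_of_countable_cover
    (U := fun α : S => (C.triv α).source) (fun α => (C.triv α).open_source) ?_
  refine eq_univ_of_forall fun y => ?_
  have h2 : C.proj y ∈ ⋃ α ∈ S, C.U α := by rw [hSU, C.cover]; trivial
  simp only [mem_iUnion] at h2 ⊢
  obtain ⟨α, hα, hy⟩ := h2
  exact ⟨⟨α, hα⟩, hy⟩

end AffineCocycle

/-! ### Connection forms on the total space -/

section CoordinateForms

variable {E : Type*} [NormedAddCommGroup E] [NormedSpace ℝ E]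
  {M : Type*} [TopologicalSpace M] [ChartedSpace E M]
  {F : Type*} [NormedAddCommGroup F] [NormedSpace ℝ F]
  {Y : Type*} [TopologicalSpace Y] [ChartedSpace F Y]
  {κ : Type*} [Fintype κ]
  {p : Y → M} {U : Set M} {Φ : M → (κ → ℝ) → Y}

lemma IsTorusChart.mdifferentiableAt (hΦ : IsTorusChart (E := E) (F := F) p U Φ) {x : M}
    (hx : x ∈ U) (w : κ → ℝ) :
    MDifferentiableAt (𝓘(ℝ, E).prod 𝓘(ℝ, κ → ℝ)) 𝓘(ℝ, F)
      (fun q : M × (κ → ℝ) => Φ q.1 q.2) (x, w) :=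
  (hΦ.localDiffeo ⟨(x, w), hx, mem_univ w⟩).contMDiffAt.mdifferentiableAt (by simp)

lemma IsTorusChart.mdifferentiableAt_left (hΦ : IsTorusChart (E := E) (F := F) p U Φ) {x : M}
    (hx : x ∈ U) (w : κ → ℝ) :
    MDifferentiableAt 𝓘(ℝ, E) 𝓘(ℝ, F) (fun z => Φ z w) x :=
  MDifferentiableAt.comp (g := fun q : M × (κ → ℝ) => Φ q.1 q.2) (f := fun z => (z, w)) x
    (hΦ.mdifferentiableAt hx w) (mdifferentiableAt_id.prodMk mdifferentiableAt_const)

lemma IsTorusChart.mdifferentiableAt_right (hΦ : IsTorusChart (E := E) (F := F) p U Φ) {x : M}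
    (hx : x ∈ U) (w : κ → ℝ) :
    MDifferentiableAt 𝓘(ℝ, κ → ℝ) 𝓘(ℝ, F) (Φ x) w :=
  MDifferentiableAt.comp (g := fun q : M × (κ → ℝ) => Φ q.1 q.2) (f := fun w => (x, w)) w
    (hΦ.mdifferentiableAt hx w) (mdifferentiableAt_const.prodMk mdifferentiableAt_id)

/-- The differential of a torus chart does not change when integers are added to the
coordinates. -/
lemma IsTorusChart.dPair_eq (hΦ : IsTorusChart (E := E) (F := F) p U Φ) (hU : IsOpen U) {x : M}
    (hx : x ∈ U) {w w' : κ → ℝ} (h : EqModInt w w') : dPair E F Φ x w = dPair E F Φ x w' := by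
  obtain ⟨k, hk⟩ := h
  have heq : ∀ z ∈ U, ∀ s, Φ z s = Φ z (s + (w' - w)) := by
    intro z hz s
    refine (hΦ.eq_iff z hz _ _).2 ⟨k, fun i => ?_⟩
    rw [Pi.add_apply, Pi.sub_apply, hk i]
    ring
  refine ContinuousLinearMap.ext fun q => ?_
  obtain ⟨v, t⟩ := q
  rw [dPair_apply (hΦ.mdifferentiableAt hx w), dPair_apply (hΦ.mdifferentiableAt hx w')]
  congr 1
  · have h1 : (fun z => Φ z w) =ᶠ[𝓝 x] fun z => Φ z w' := by
      filter_upwards [hU.mem_nhds hx] with z hz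
      rw [heq z hz w, add_sub_cancel]
    rw [tmap_congr h1]
  · have h1 : Φ x = fun s => Φ x (s + (w' - w)) := funext fun s => heq x hx s
    have h2 : HasFDerivAt (fun s : κ → ℝ => s + (w' - w)) (ContinuousLinearMap.id ℝ (κ → ℝ)) w :=
      (hasFDerivAt_id w).add_const _
    have hm : MDifferentiableAt 𝓘(ℝ, κ → ℝ) 𝓘(ℝ, F) (Φ x) (w + (w' - w)) :=
      hΦ.mdifferentiableAt_right hx _
    have h3 := tmap_comp_apply (g := Φ x) (f := fun s : κ → ℝ => s + (w' - w)) hm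
      h2.differentiableAt.mdifferentiableAt t
    rw [← h1, tmap_of_hasFDerivAt h2, add_sub_cancel] at h3
    exact h3

lemma IsTorusChart.dPair_surjective (hΦ : IsTorusChart (E := E) (F := F) p U Φ) {x : M}
    (hx : x ∈ U) (w : κ → ℝ) (v : F) : ∃ u t, dPair E F Φ x w (u, t) = v := by
  have hl := hΦ.localDiffeo ⟨(x, w), hx, mem_univ w⟩
  obtain ⟨⟨u, t⟩, hut⟩ := (hl.mfderivToContinuousLinearEquiv (by simp)).surjective v
  exact ⟨u, t, hut⟩

/-- The prescription `dw_i + a` does not depend on the integer ambiguity of the coordinates `w`. -/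
lemma IsTorusChart.exists_coordForm (hΦ : IsTorusChart (E := E) (F := F) p U Φ) (hU : IsOpen U)
    (i : κ) (a : OneForm E M) (y : Y) : ∃ ℓ : F →L[ℝ] ℝ, p y ∈ U →
      ∀ w, Φ (p y) w = y → ∀ v t, ℓ (dPair E F Φ (p y) w (v, t)) = t i + formAt a (p y) v := by
  by_cases hy : p y ∈ U
  swap
  · exact ⟨0, fun h => absurd h hy⟩
  obtain ⟨w₀, hw₀⟩ := hΦ.exists_coord y hy
  have hl := hΦ.localDiffeo ⟨(p y, w₀), hy, mem_univ w₀⟩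
  let D : (E × (κ → ℝ)) ≃L[ℝ] F := hl.mfderivToContinuousLinearEquiv (by simp)
  have hD : ∀ q, D q = dPair E F Φ (p y) w₀ q := fun q => rfl
  let b : E × (κ → ℝ) →L[ℝ] ℝ :=
    (ContinuousLinearMap.proj i).comp (ContinuousLinearMap.snd ℝ E (κ → ℝ)) +
      (formAt a (p y)).comp (ContinuousLinearMap.fst ℝ E (κ → ℝ))
  refine ⟨b.comp (D.symm : F →L[ℝ] E × (κ → ℝ)), fun _ w hw v t => ?_⟩
  rw [hΦ.dPair_eq hU hy ((hΦ.eq_iff (p y) hy w w₀).1 (hw.trans hw₀.symm)), ← hD,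
    ContinuousLinearMap.comp_apply, ContinuousLinearEquiv.coe_coe, D.symm_apply_apply]
  rfl

/-- The form `dw_i + a` on the part of `Y` over the domain of a torus chart with fibre
coordinates `w` (and an irrelevant value elsewhere). -/
def coordForm (hΦ : IsTorusChart (E := E) (F := F) p U Φ) (hU : IsOpen U) (i : κ)
    (a : OneForm E M) : OneForm F Y := fun y => (hΦ.exists_coordForm hU i a y).choose

lemma coordForm_dPair (hΦ : IsTorusChart (E := E) (F := F) p U Φ) (hU : IsOpen U) (i : κ)
    (a : OneForm E M) {x : M} (hx : x ∈ U) (w : κ → ℝ) (v : E) (t : κ → ℝ) :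
    formAt (coordForm hΦ hU i a) (Φ x w) (dPair E F Φ x w (v, t)) = t i + formAt a x v := by
  have h : ∀ y, p y = x → Φ x w = y →
      formAt (coordForm hΦ hU i a) y (dPair E F Φ x w (v, t)) = t i + formAt a x v := by
    rintro y rfl hw
    exact (hΦ.exists_coordForm hU i a y).choose_spec hx w hw v t
  exact h _ (hΦ.proj_apply x hx w) rfl

lemma isLocallyCoordPlus_coordForm (hΦ : IsTorusChart (E := E) (F := F) p U Φ) (hU : IsOpen U)
    (i : κ) (a : OneForm E M) : IsLocallyCoordPlus U Φ i a (coordForm hΦ hU i a) :=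
  fun _ hx w v t => coordForm_dPair hΦ hU i a hx w v t

/-- A form on `p⁻¹ U` is determined by its values on the image of the differential of a chart. -/
lemma formAt_ext (hΦ : IsTorusChart (E := E) (F := F) p U Φ) {y : Y} (hy : p y ∈ U)
    {ℓ ℓ' : F →L[ℝ] ℝ} (h : ∀ w, Φ (p y) w = y → ∀ v t,
      ℓ (dPair E F Φ (p y) w (v, t)) = ℓ' (dPair E F Φ (p y) w (v, t))) : ℓ = ℓ' := by
  obtain ⟨w, hw⟩ := hΦ.exists_coord y hy
  refine ContinuousLinearMap.ext fun v => ?_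
  obtain ⟨u, t, rfl⟩ := hΦ.dPair_surjective hy w v
  exact h w hw u t

section Smooth

variable [IsManifold 𝓘(ℝ, E) ∞ M] [IsManifold 𝓘(ℝ, F) ∞ Y]

/-- The pull-back of `dw_i + a` to the parametrization of `Y` by a chart of `M` and the fibre
coordinates is visibly smooth. -/
lemma smoothOneFormOn_coordForm (hΦ : IsTorusChart (E := E) (F := F) p U Φ) (hU : IsOpen U)
    (i : κ) {a : OneForm E M} (ha : SmoothOneFormOn a U) :
    SmoothOneFormOn (coordForm hΦ hU i a) (p ⁻¹' U) := by
  intro y hy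
  obtain ⟨w₀, hw₀⟩ := hΦ.exists_coord y hy
  set x₀ := p y with hx₀
  have hx : x₀ ∈ U := hy
  clear_value x₀
  subst hw₀
  obtain ⟨O, hO, hz₀, hk, hkU⟩ := exists_isOpen_extChartAt_symm (E := E) hU hx
  set e := extChartAt 𝓘(ℝ, E) x₀ with he
  let g : E × (κ → ℝ) → Y := fun q => Φ (e.symm q.1) q.2
  have hex : e.symm (e x₀) = x₀ := extChartAt_to_inv x₀
  have hg : ∀ q : E × (κ → ℝ), q.1 ∈ O →
      ContMDiffAt 𝓘(ℝ, E × (κ → ℝ)) 𝓘(ℝ, F) ∞ g q := by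
    intro q hq
    have h1 : ContMDiffAt 𝓘(ℝ, E × (κ → ℝ)) (𝓘(ℝ, E).prod 𝓘(ℝ, κ → ℝ)) ∞
        (fun q : E × (κ → ℝ) => (e.symm q.1, q.2)) q :=
      (ContMDiffAt.comp (g := e.symm) (f := Prod.fst) q (hk _ hq)
        contDiffAt_fst.contMDiffAt).prodMk contDiffAt_snd.contMDiffAt
    exact ContMDiffAt.comp (g := fun q : M × (κ → ℝ) => Φ q.1 q.2) q
      (hΦ.localDiffeo ⟨(e.symm q.1, q.2), hkU _ hq, mem_univ _⟩).contMDiffAt h1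
  have hgx : g (e x₀, w₀) = Φ x₀ w₀ := by simp only [g, hex]
  -- a local inverse of the parametrization `g`
  have hl := hΦ.localDiffeo ⟨(x₀, w₀), hx, mem_univ w₀⟩
  let loc : Y → M × (κ → ℝ) := hl.localInverse
  have hloc : ContMDiffAt 𝓘(ℝ, F) (𝓘(ℝ, E).prod 𝓘(ℝ, κ → ℝ)) ∞ loc (Φ x₀ w₀) :=
    hl.localInverse_contMDiffAt
  have hlocx : loc (Φ x₀ w₀) = (x₀, w₀) := hl.localInverse_left_inv hl.localInverse_mem_target
  let k : Y → E × (κ → ℝ) := fun y => (e (loc y).1, (loc y).2)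
  have hks : ContMDiffAt 𝓘(ℝ, F) 𝓘(ℝ, E × (κ → ℝ)) ∞ k (g (e x₀, w₀)) := by
    rw [hgx]
    have h1 : ContMDiffAt 𝓘(ℝ, F) 𝓘(ℝ, E) ∞ (fun y => (loc y).1) (Φ x₀ w₀) :=
      ContMDiffAt.comp (g := Prod.fst) _ contMDiffAt_fst hloc
    have h2 : ContMDiffAt 𝓘(ℝ, F) 𝓘(ℝ, κ → ℝ) ∞ (fun y => (loc y).2) (Φ x₀ w₀) :=
      ContMDiffAt.comp (g := Prod.snd) _ contMDiffAt_snd hloc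
    refine ContMDiffAt.prodMk_space ?_ h2
    refine ContMDiffAt.comp (g := e) _ ?_ h1
    rw [hlocx]
    exact contMDiffAt_extChartAt (n := ∞)
  have hgk : ∀ᶠ y in 𝓝 (g (e x₀, w₀)), g (k y) = y := by
    rw [hgx]
    have h1 : ∀ᶠ y in 𝓝 (Φ x₀ w₀), (loc y).1 ∈ e.source := by
      refine (continuous_fst.continuousAt.comp hloc.continuousAt).preimage_mem_nhds ?_
      refine (isOpen_extChartAt_source (I := 𝓘(ℝ, E)) x₀).mem_nhds ?_
      rw [Function.comp_apply, hlocx]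
      exact mem_extChartAt_source x₀
    filter_upwards [h1, hl.localInverse_eventuallyEq_right] with y hy1 hy2
    simp only [g, k, e.left_inv hy1]
    exact hy2
  have hpull : ContDiffAt ℝ ∞ (pullOne (coordForm hΦ hU i a) g) (e x₀, w₀) := by
    have h1 : ContDiffAt ℝ ∞ (fun q : E × (κ → ℝ) =>
        (ContinuousLinearMap.proj (R := ℝ) (φ := fun _ : κ => ℝ) i).comp
          (ContinuousLinearMap.snd ℝ E (κ → ℝ)) +
        (oneFormInChart a x₀ q.1).comp (ContinuousLinearMap.fst ℝ E (κ → ℝ))) (e x₀, w₀) := by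
      refine contDiffAt_const.add (ContDiffAt.clm_comp ?_ contDiffAt_const)
      exact ContDiffAt.comp (g := oneFormInChart a x₀) (f := Prod.fst) (e x₀, w₀) (ha x₀ hx)
        contDiffAt_fst
    refine h1.congr_of_eventuallyEq ?_
    have hOn : ∀ᶠ q : E × (κ → ℝ) in 𝓝 (e x₀, w₀), q.1 ∈ O :=
      continuous_fst.continuousAt.preimage_mem_nhds (hO.mem_nhds hz₀)
    filter_upwards [hOn] with q hq
    refine ContinuousLinearMap.ext fun r => ?_
    obtain ⟨u, t⟩ := r
    obtain ⟨z, w⟩ := q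
    have hgd := (hg (z, w) hq).mdifferentiableAt (by simp)
    have hi1 : HasFDerivAt (fun z : E => (z, w)) (ContinuousLinearMap.inl ℝ E (κ → ℝ)) z :=
      (hasFDerivAt_id z).prodMk (hasFDerivAt_const w z)
    have hi2 : HasFDerivAt (fun w : κ → ℝ => (z, w)) (ContinuousLinearMap.inr ℝ E (κ → ℝ)) w :=
      (hasFDerivAt_const z w).prodMk (hasFDerivAt_id w)
    have hzd : MDifferentiableAt 𝓘(ℝ, E) 𝓘(ℝ, E) e.symm z := (hk z hq).mdifferentiableAt (by simp)
    have h3 := tmap_comp_apply (g := g) (f := fun z : E => (z, w)) (x := z) hgd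
      hi1.differentiableAt.mdifferentiableAt u
    have h4 := tmap_comp_apply (g := g) (f := fun w : κ → ℝ => (z, w)) (x := w) hgd
      hi2.differentiableAt.mdifferentiableAt t
    have h5 := tmap_comp_apply (g := fun x => Φ x w) (f := e.symm) (x := z)
      (hΦ.mdifferentiableAt_left (hkU z hq) w) hzd u
    rw [tmap_of_hasFDerivAt hi1] at h3
    rw [tmap_of_hasFDerivAt hi2] at h4
    have h6 : tmap (E × (κ → ℝ)) F g (z, w) (u, t) =
        dPair E F Φ (e.symm z) w (tmap E E e.symm z u, t) := by
      rw [dPair_apply (hΦ.mdifferentiableAt (hkU z hq) w), ← h5]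
      have h7 : tmap (E × (κ → ℝ)) F g (z, w) (u, t) =
          tmap (E × (κ → ℝ)) F g (z, w) (ContinuousLinearMap.inl ℝ E (κ → ℝ) u) +
          tmap (E × (κ → ℝ)) F g (z, w) (ContinuousLinearMap.inr ℝ E (κ → ℝ) t) := by
        rw [← map_add]; simp
      rw [h7, ← h3, ← h4]
    rw [pullOne_eq_formAt, h6]
    refine (coordForm_dPair hΦ hU i a (hkU z hq) w _ t).trans ?_
    rfl
  have hfin := contDiffAt_oneFormInChart_of_pullOne (g := g) (v₀ := (e x₀, w₀)) (k := k)
    (hg _ hz₀) hks (by simp only [k, hgx, hlocx]) hgk hpull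
  rw [hgx] at hfin
  exact hfin

end Smooth

/-- If the coordinates of two torus charts are related by `w ↦ G w + c` and the forms on the base by
`a + dc = G b`, then the forms `dw_i + a_i` and `dw_j + b_j` are related by `G`. -/
lemma coordForm_gluing [DecidableEq κ] {V : Set M} {Ψ : M → (κ → ℝ) → Y}
    (hΦ : IsTorusChart (E := E) (F := F) p U Φ) (hU : IsOpen U)
    (hΨ : IsTorusChart (E := E) (F := F) p V Ψ) (hV : IsOpen V)
    {G : Matrix κ κ ℤ} {c : M → κ → ℝ} {y : Y} (hy : p y ∈ U ∩ V)
    (hc : MDifferentiableAt 𝓘(ℝ, E) 𝓘(ℝ, κ → ℝ) c (p y))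
    (hglue : ∀ x ∈ U ∩ V, ∀ w, Ψ x w = Φ x (G.map (Int.cast : ℤ → ℝ) *ᵥ w + c x))
    {a b : κ → OneForm E M}
    (hab : ∀ i v, formAt (a i) (p y) v + tmap E (κ → ℝ) c (p y) v i =
      ∑ j, (G i j : ℝ) * formAt (b j) (p y) v) (i : κ) :
    formAt (coordForm hΦ hU i (a i)) y =
      ∑ j, (G i j : ℝ) • formAt (coordForm hΨ hV j (b j)) y := by
  refine formAt_ext hΨ hy.2 fun w hw v t => ?_
  set x := p y with hx
  clear_value x
  subst hw
  have hrhs : (∑ j, (G i j : ℝ) • formAt (coordForm hΨ hV j (b j)) (Ψ x w))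
      (dPair E F Ψ x w (v, t)) = ∑ j, (G i j : ℝ) * (t j + formAt (b j) x v) := by
    rw [_root_.sum_apply]
    refine Finset.sum_congr rfl fun j _ => ?_
    rw [_root_.smul_apply, coordForm_dPair hΨ hV j (b j) hy.2, smul_eq_mul]
  set L : (κ → ℝ) →L[ℝ] (κ → ℝ) :=
    (Matrix.mulVecLin (G.map (Int.cast : ℤ → ℝ))).toContinuousLinearMap with hL
  have hLapp : ∀ s, L s = G.map (Int.cast : ℤ → ℝ) *ᵥ s := fun s => rfl
  set w' := G.map (Int.cast : ℤ → ℝ) *ᵥ w + c x with hw'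
  have hsh : HasFDerivAt (fun s : κ → ℝ => s + G.map (Int.cast : ℤ → ℝ) *ᵥ w)
      (ContinuousLinearMap.id ℝ (κ → ℝ)) (c x) := (hasFDerivAt_id _).add_const _
  let c' : M → κ → ℝ := fun z => c z + G.map (Int.cast : ℤ → ℝ) *ᵥ w
  have hc'x : c' x = w' := add_comm _ _
  have hc'd : MDifferentiableAt 𝓘(ℝ, E) 𝓘(ℝ, κ → ℝ) c' x :=
    MDifferentiableAt.comp (g := fun s : κ → ℝ => s + G.map (Int.cast : ℤ → ℝ) *ᵥ w) x
      hsh.differentiableAt.mdifferentiableAt hc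
  have hc't : tmap E (κ → ℝ) c' x v = tmap E (κ → ℝ) c x v := by
    have := tmap_comp_apply (f := c) (x := x) hsh.differentiableAt.mdifferentiableAt hc v
    rw [tmap_of_hasFDerivAt hsh] at this
    exact this
  have h1 : tmap E F (fun z => Ψ z w) x v =
      dPair E F Φ x w' (v, tmap E (κ → ℝ) c x v) := by
    have h2 : (fun z => Ψ z w) =ᶠ[𝓝 x] fun z => Φ z (c' z) := by
      filter_upwards [(hU.inter hV).mem_nhds hy] with z hz
      rw [hglue z hz w, add_comm]
    rw [tmap_congr h2, tmap_comp_pair (by rw [hc'x]; exact hΦ.mdifferentiableAt hy.1 _) hc'd, hc'x,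
      hc't]
  have h2 : tmap (κ → ℝ) F (Ψ x) w t = dPair E F Φ x w' (0, L t) := by
    have h3 : Ψ x = fun s => Φ x (L s + c x) := funext fun s => hglue x hy s
    have h4 : HasFDerivAt (fun s : κ → ℝ => L s + c x) L w := L.hasFDerivAt.add_const _
    have hm : MDifferentiableAt 𝓘(ℝ, κ → ℝ) 𝓘(ℝ, F) (Φ x) (L w + c x) :=
      hΦ.mdifferentiableAt_right hy.1 _
    have h5 := tmap_comp_apply (g := Φ x) (f := fun s : κ → ℝ => L s + c x) hm
      h4.differentiableAt.mdifferentiableAt t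
    rw [← h3, tmap_of_hasFDerivAt h4] at h5
    rw [h5, dPair_apply (hΦ.mdifferentiableAt hy.1 _), map_zero, zero_add]
    rfl
  have h3 : dPair E F Ψ x w (v, t) = dPair E F Φ x w' (v, tmap E (κ → ℝ) c x v + L t) := by
    rw [dPair_apply (hΨ.mdifferentiableAt hy.2 w), h1, h2, ← map_add]
    simp
  rw [hrhs, h3, hglue x hy w, coordForm_dPair hΦ hU i (a i) hy.1]
  simp only [mul_add, Finset.sum_add_distrib, ← hab i v, Pi.add_apply, hLapp, Matrix.mulVec,
    dotProduct, Matrix.map_apply]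
  ring

end CoordinateForms

section FormOperations

variable {E : Type*} [NormedAddCommGroup E] [NormedSpace ℝ E]
  {X : Type*} [TopologicalSpace X] [ChartedSpace E X] {U : Set X}

lemma SmoothOneFormOn.congr {η η' : OneForm E X} (h : SmoothOneFormOn η U) (hU : IsOpen U)
    (heq : ∀ x ∈ U, formAt η' x = formAt η x) : SmoothOneFormOn η' U := by
  intro x hx
  refine (h x hx).congr_of_eventuallyEq ?_
  have h1 := (continuousAt_extChartAt_symm (I := 𝓘(ℝ, E)) x).preimage_mem_nhds
    (hU.mem_nhds (by rwa [extChartAt_to_inv]))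
  filter_upwards [h1] with z hz
  refine ContinuousLinearMap.ext fun u => ?_
  exact DFunLike.congr_fun (heq _ hz) _

/-- A linear combination, with functions as coefficients, of `1`-forms. -/
def lincomb {J : Type*} [Fintype J] (f : J → X → ℝ) (η : J → OneForm E X) : OneForm E X := fun x =>
  let ℓ : E →L[ℝ] ℝ := ∑ j, f j x • formAt (η j) x
  ℓ

lemma formAt_lincomb {J : Type*} [Fintype J] (f : J → X → ℝ) (η : J → OneForm E X) (x : X) :
    formAt (lincomb f η) x = ∑ j, f j x • formAt (η j) x := rfl

lemma SmoothOneFormOn.lincomb [IsManifold 𝓘(ℝ, E) ∞ X] {J : Type*} [Fintype J] {f : J → X → ℝ}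
    {η : J → OneForm E X} (hU : IsOpen U) (hf : ∀ j, ContMDiffOn 𝓘(ℝ, E) 𝓘(ℝ, ℝ) ∞ (f j) U)
    (hη : ∀ j, SmoothOneFormOn (η j) U) : SmoothOneFormOn (lincomb f η) U := by
  intro x hx
  obtain ⟨hk, h₀⟩ := (eventually_extChartAt_symm (E := E) hU hx).self_of_nhds
  have h1 : ContDiffAt ℝ ∞ (fun z => ∑ j, f j ((extChartAt 𝓘(ℝ, E) x).symm z) •
      oneFormInChart (η j) x z) (extChartAt 𝓘(ℝ, E) x x) := by
    refine ContDiffAt.sum fun j _ => ContDiffAt.fun_smul ?_ (hη j x hx)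
    exact (ContMDiffAt.comp (g := f j) _ ((hf j _ h₀).contMDiffAt (hU.mem_nhds h₀)) hk).contDiffAt
  refine h1.congr_of_eventuallyEq (Filter.Eventually.of_forall fun z => ?_)
  refine ContinuousLinearMap.ext fun u => ?_
  change (∑ j, f j ((extChartAt 𝓘(ℝ, E) x).symm z) •
    formAt (η j) ((extChartAt 𝓘(ℝ, E) x).symm z))
      (tmap E E (extChartAt 𝓘(ℝ, E) x).symm z u) = _
  rw [_root_.sum_apply, _root_.sum_apply]
  rfl

end FormOperations

/-! ### The affine torus bundle of a reduction -/

variable {n : ℕ}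
  {E : Type*} [NormedAddCommGroup E] [NormedSpace ℝ E]
  {M : Type*} [TopologicalSpace M] [ChartedSpace E M]
  {E' : Type*} [NormedAddCommGroup E'] [NormedSpace ℝ E']
  {X : Type*} [TopologicalSpace X] [ChartedSpace E' X]
  [AddAction (Fin n → UnitAddCircle) X] {ι : Type*}
  {P : PrincipalTorusBundle n E M E' X ι} {Θ : TorusConnection P}
  {𝒢 : GerbeWithConnection.{w} (E := E') P.patch} (R : Reduction P Θ 𝒢)

namespace Reduction

lemma isUnit_G (α β : ι) : IsUnit (R.G α β) := by
  refine ⟨⟨R.G α β, Matrix.fromBlocks 1 (-R.m α β) 0 1, ?_, ?_⟩, rfl⟩ <;>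
  simp [Reduction.G, Matrix.fromBlocks_multiply, Matrix.fromBlocks_one]

lemma sum_G_inl (α β : ι) (I : Fin n) (f : Fin n ⊕ Fin n → ℝ) :
    ∑ j, (R.G α β (Sum.inl I) j : ℝ) * f j =
      f (Sum.inl I) + ∑ J, (R.m α β I J : ℝ) * f (Sum.inr J) := by
  rw [← R.G_mulVec_inl]
  simp [Matrix.mulVec, dotProduct]

lemma sum_G_inr (α β : ι) (I : Fin n) (f : Fin n ⊕ Fin n → ℝ) :
    ∑ j, (R.G α β (Sum.inr I) j : ℝ) * f j = f (Sum.inr I) := by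
  rw [← R.G_mulVec_inr α β f]
  simp [Matrix.mulVec, dotProduct]

/-- The linear map through which the translations factor:
`c_{αβ}` is the image of `(h̃_{αβ}, λ_{βα})`. -/
def transMap (α β : ι) : (Fin n → ℝ) × (Fin n → ℝ) →L[ℝ] (Fin n ⊕ Fin n → ℝ) :=
  ContinuousLinearMap.pi (Sum.elim
    (fun I => -(ContinuousLinearMap.proj I).comp (ContinuousLinearMap.fst ℝ _ _) +
      ∑ J, (1 / 2 * (R.m α β I J : ℝ)) •
        (ContinuousLinearMap.proj J).comp (ContinuousLinearMap.snd ℝ (Fin n → ℝ) (Fin n → ℝ)))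
    (fun I => (ContinuousLinearMap.proj I).comp (ContinuousLinearMap.snd ℝ _ _)))

lemma transMap_inl (α β : ι) (q : (Fin n → ℝ) × (Fin n → ℝ)) (I : Fin n) :
    R.transMap α β q (Sum.inl I) = -q.1 I + ∑ J, 1 / 2 * (R.m α β I J : ℝ) * q.2 J := by
  simp [transMap]

lemma transMap_inr (α β : ι) (q : (Fin n → ℝ) × (Fin n → ℝ)) (I : Fin n) :
    R.transMap α β q (Sum.inr I) = q.2 I := by
  simp [transMap]

lemma trans_eq_transMap {α β : ι} {x : M} (hx : x ∈ P.U α ∩ P.U β) :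
    R.trans α β x = R.transMap α β (R.h α β x, P.lam β α x) := by
  funext i
  rcases i with I | I
  · rw [R.trans_inl hx, R.transMap_inl, P.lam_skew α β x hx, Finset.mul_sum, sub_eq_add_neg,
      ← Finset.sum_neg_distrib]
    congr 1
    refine Finset.sum_congr rfl fun J _ => ?_
    simp only [Pi.neg_apply]
    ring
  · rw [R.trans_inr hx, R.transMap_inr, P.lam_skew α β x hx]; rfl

lemma contMDiffAt_h {α β : ι} {x : M} (hx : x ∈ P.U α ∩ P.U β) :
    ContMDiffAt 𝓘(ℝ, E) 𝓘(ℝ, Fin n → ℝ) ∞ (R.h α β) x :=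
  (R.smooth_h α β x hx).contMDiffAt ((P.isOpen_inter α β).mem_nhds hx)

lemma trans_eventuallyEq {α β : ι} {x : M} (hx : x ∈ P.U α ∩ P.U β) :
    R.trans α β =ᶠ[𝓝 x] fun x => R.transMap α β (R.h α β x, P.lam β α x) := by
  filter_upwards [(P.isOpen_inter α β).mem_nhds hx] with z hz using R.trans_eq_transMap hz

lemma contMDiffAt_trans {α β : ι} {x : M} (hx : x ∈ P.U α ∩ P.U β) :
    ContMDiffAt 𝓘(ℝ, E) 𝓘(ℝ, Fin n ⊕ Fin n → ℝ) ∞ (R.trans α β) x := by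
  refine ContMDiffAt.congr_of_eventuallyEq ?_ (R.trans_eventuallyEq hx)
  exact ContMDiffAt.comp (g := R.transMap α β) x (R.transMap α β).contDiff.contDiffAt.contMDiffAt
    ((R.contMDiffAt_h hx).prodMk_space (P.contMDiffAt_lam hx.symm))

lemma tmap_trans {α β : ι} {x : M} (hx : x ∈ P.U α ∩ P.U β) (v : E) :
    tmap E (Fin n ⊕ Fin n → ℝ) (R.trans α β) x v = R.transMap α β
      (tmap E (Fin n → ℝ) (R.h α β) x v, tmap E (Fin n → ℝ) (P.lam β α) x v) := by
  set b : M → (Fin n → ℝ) × (Fin n → ℝ) := fun x => (R.h α β x, P.lam β α x) with hb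
  have hbd : MDifferentiableAt 𝓘(ℝ, E) 𝓘(ℝ, (Fin n → ℝ) × (Fin n → ℝ)) b x :=
    ((R.contMDiffAt_h hx).prodMk_space (P.contMDiffAt_lam hx.symm)).mdifferentiableAt (by simp)
  have h1 : tmap E _ (fun x => R.transMap α β (b x)) x v = _ :=
    tmap_comp_apply (R.transMap α β).differentiableAt.mdifferentiableAt hbd v
  have h2 := tmap_comp_apply (g := Prod.fst) (hasFDerivAt_fst (𝕜 := ℝ)
    (p := b x)).differentiableAt.mdifferentiableAt hbd v
  have h3 := tmap_comp_apply (g := Prod.snd) (hasFDerivAt_snd (𝕜 := ℝ)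
    (p := b x)).differentiableAt.mdifferentiableAt hbd v
  rw [tmap_of_hasFDerivAt hasFDerivAt_fst] at h2
  rw [tmap_of_hasFDerivAt hasFDerivAt_snd] at h3
  rw [tmap_congr (R.trans_eventuallyEq hx), h1,
    tmap_of_hasFDerivAt (R.transMap α β).hasFDerivAt]
  exact congrArg _ (Prod.ext h2.symm h3.symm)

/-- On overlaps the local connection forms satisfy `A_β = A_α + dλ_{βα}`. -/
lemma A_gluing {α β : ι} {x : M} (hx : x ∈ P.U α ∩ P.U β) (I : Fin n) (v : E) :
    formAt (R.A β I) x v = formAt (R.A α I) x v + tmap E (Fin n → ℝ) (P.lam β α) x v I := by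
  have hlam := (P.contMDiffAt_lam hx.symm).mdifferentiableAt (n := ∞) (by simp)
  have hx0 : ∀ z ∈ P.U α ∩ P.U β, P.coord β z 0 = P.coord α z (P.lam β α z) := fun z hz => by
    rw [P.coord_eq_coord hz.symm, zero_add]
  have h1 : formAt (Θ.form I) (P.coord β x 0) (dPair E E' (P.coord β) x 0 (v, 0)) =
      (0 : Fin n → ℝ) I + formAt (R.A β I) x v := R.connection_eq β I x hx.2 0 v 0
  have h2 : formAt (Θ.form I) (P.coord α x (P.lam β α x))
      (dPair E E' (P.coord α) x (P.lam β α x) (v, tmap E (Fin n → ℝ) (P.lam β α) x v)) =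
      tmap E (Fin n → ℝ) (P.lam β α) x v I + formAt (R.A α I) x v :=
    R.connection_eq α I x hx.1 (P.lam β α x) v (tmap E (Fin n → ℝ) (P.lam β α) x v)
  have h3 : dPair E E' (P.coord β) x 0 (v, 0) =
      dPair E E' (P.coord α) x (P.lam β α x) (v, tmap E (Fin n → ℝ) (P.lam β α) x v) := by
    rw [dPair_apply ((P.contMDiffAt_coord hx.2 0).mdifferentiableAt (by simp)), map_zero, add_zero,
      ← tmap_comp_pair ((P.contMDiffAt_coord hx.1 _).mdifferentiableAt (by simp)) hlam]
    refine DFunLike.congr_fun (tmap_congr ?_) v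
    filter_upwards [(P.isOpen_inter α β).mem_nhds hx] with z hz using hx0 z hz
  rw [h3, hx0 x hx, h2, Pi.zero_apply, zero_add] at h1
  rw [← h1, add_comm]

/-- On overlaps `(B_{1α}, A_α) + dc_{αβ} = G_{αβ} (B_{1β}, A_β)`. -/
lemma potential_gluing {α β : ι} {x : M} (hx : x ∈ P.U α ∩ P.U β) (i : Fin n ⊕ Fin n) (v : E) :
    formAt (R.potential α i) x v + tmap E (Fin n ⊕ Fin n → ℝ) (R.trans α β) x v i =
      ∑ j, (R.G α β i j : ℝ) * formAt (R.potential β j) x v := by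
  rw [R.tmap_trans hx]
  rcases i with I | I
  · rw [R.sum_G_inl, R.transMap_inl]
    have h := R.gluing_B₁ α β x hx I v
    have h2 : formAt (R.B₁ α I) x v - formAt (R.B₁ β I) x v =
        tmap E (Fin n → ℝ) (R.h α β) x v I + ∑ J, (R.m α β I J : ℝ) *
          (formAt (R.A β J) x v - 1 / 2 * tmap E (Fin n → ℝ) (P.lam β α) x v J) := h
    simp only [mul_sub, Finset.sum_sub_distrib] at h2
    have h3 : ∑ J, (R.m α β I J : ℝ) * (1 / 2 * tmap E (Fin n → ℝ) (P.lam β α) x v J) =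
        ∑ J, 1 / 2 * (R.m α β I J : ℝ) * tmap E (Fin n → ℝ) (P.lam β α) x v J :=
      Finset.sum_congr rfl fun J _ => by ring
    rw [h3] at h2
    change formAt (R.B₁ α I) x v + _ = formAt (R.B₁ β I) x v +
      ∑ J, (R.m α β I J : ℝ) * formAt (R.A β J) x v
    linarith
  · rw [R.sum_G_inr, R.transMap_inr]
    exact (R.A_gluing hx I v).symm

lemma smooth_potential (α : ι) (i : Fin n ⊕ Fin n) : SmoothOneFormOn (R.potential α i) (P.U α) := by
  rcases i with I | I
  · exact R.smooth_B₁ α I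
  · exact R.smooth_A α I

variable [IsManifold 𝓘(ℝ, E) ∞ M] [IsManifold 𝓘(ℝ, E') ∞ X]

/-- The cocycle of affine coordinate changes of a reduction whose functions `h̃` are logarithms of
fibre holonomies. -/
def cocycle (h𝒢 : IsTorusInvariant P 𝒢) (hB : R.B₀ = red₀ 𝒢)
    (hh : ∀ α β, IsHolLog 𝒢 α β (R.h α β)) : AffineCocycle (Fin n ⊕ Fin n) E M ι where
  U := P.U
  isOpen_U := P.isOpen_U
  cover := P.cover
  G := R.G
  c := R.trans
  smooth_c _ _ _ hx := (R.contMDiffAt_trans hx).contMDiffWithinAt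
  G_self := R.G_self
  c_self _ _ hx := R.trans_self hx
  G_mul _ _ _ h := R.G_mul h
  c_cocycle _ _ _ _ hx := R.trans_cocycle h𝒢 hB hh hx.1.1 hx.1.2 hx.2

end Reduction

section TotalSpace

variable {F : Type*} [NormedAddCommGroup F] [NormedSpace ℝ F]
  {Y : Type*} [TopologicalSpace Y] [ChartedSpace F Y]
  {p : Y → M} {Φ : ι → M → (Fin n ⊕ Fin n → ℝ) → Y}

variable {R} (hY : IsAffineTorusBundle (E := E) (F := F) p P.U Φ R.G)
  (hglue : ∀ α β, ∀ x ∈ P.U α ∩ P.U β, ∀ w,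
    Φ β x w = Φ α x ((R.G α β).map (Int.cast : ℤ → ℝ) *ᵥ w + R.trans α β x))
include hY hglue

/-- The gluing of the fibre coordinates, in the form symmetric in the two indices. -/
lemma chart_eq_chart_iff {α β : ι} {x : M} (hx : x ∈ P.U α ∩ P.U β)
    (wα wβ : Fin n ⊕ Fin n → ℝ) :
    Φ α x wα = Φ β x wβ ↔ EqModInt (wα + (1 / 2 : ℝ) • R.shift α β x)
      ((R.G α β).map (Int.cast : ℤ → ℝ) *ᵥ (wβ + (1 / 2 : ℝ) • R.shift β α x)) := by
  rw [hglue α β x hx, (hY.chart α).eq_iff x hx.1]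
  refine exists_congr fun k => forall_congr' fun i => ?_
  simp only [Reduction.trans, Matrix.mulVec_add, Pi.add_apply, Pi.sub_apply]
  constructor <;> intro h <;> linarith

/-- The projection of the total space to `X`, which keeps the second half of the coordinates. -/
lemma exists_map_to_X : ∃ q : Y → X, ContMDiff 𝓘(ℝ, F) 𝓘(ℝ, E') ∞ q ∧
    ∀ α, ∀ x ∈ P.U α, ∀ w, q (Φ α x w) = P.coord α x (fun I => w (Sum.inr I)) := by
  have hex : ∀ y : Y, ∃ z : X, ∀ α, ∀ x ∈ P.U α, ∀ w, Φ α x w = y →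
      P.coord α x (fun I => w (Sum.inr I)) = z := by
    intro y
    have hy : p y ∈ ⋃ α, P.U α := by rw [P.cover]; trivial
    obtain ⟨β, hβ⟩ := mem_iUnion.1 hy
    obtain ⟨w', hw'⟩ := (hY.chart β).exists_coord y hβ
    refine ⟨P.coord β (p y) (fun I => w' (Sum.inr I)), fun α x hα w hw => ?_⟩
    have hpx : p y = x := by rw [← hw, (hY.chart α).proj_apply x hα]
    rw [hpx] at hβ hw' ⊢
    rw [P.coord_eq_coord ⟨hβ, hα⟩]
    refine ((P.chart α).eq_iff x hα _ _).2 ?_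
    have h1 : Φ α x w = Φ α x _ := hw.trans (hw'.symm.trans (hglue α β x ⟨hα, hβ⟩ w'))
    obtain ⟨k, hk⟩ := ((hY.chart α).eq_iff x hα _ _).1 h1
    refine ⟨fun I => k (Sum.inr I), fun I => ?_⟩
    change w (Sum.inr I) = w' (Sum.inr I) + P.lam β α x I + (k (Sum.inr I) : ℝ)
    rw [hk (Sum.inr I), Pi.add_apply, R.G_mulVec_inr, R.trans_inr ⟨hα, hβ⟩,
      P.lam_skew α β x ⟨hα, hβ⟩, Pi.neg_apply]
  choose q hq using hex
  have hqΦ : ∀ α, ∀ x ∈ P.U α, ∀ w, q (Φ α x w) = P.coord α x (fun I => w (Sum.inr I)) :=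
    fun α x hx w => (hq _ α x hx w rfl).symm
  refine ⟨q, fun y => ?_, hqΦ⟩
  have hy : p y ∈ ⋃ α, P.U α := by rw [P.cover]; trivial
  obtain ⟨α, hα⟩ := mem_iUnion.1 hy
  obtain ⟨w, hw⟩ := (hY.chart α).exists_coord y hα
  set x := p y with hxdef
  clear_value x
  subst hw
  have hl := (hY.chart α).localDiffeo ⟨(x, w), hα, mem_univ w⟩
  have hloc := hl.localInverse_contMDiffAt
  have hlocx : hl.localInverse (Φ α x w) = (x, w) :=
    hl.localInverse_left_inv hl.localInverse_mem_target
  have hrest : ContMDiff (𝓘(ℝ, E).prod 𝓘(ℝ, Fin n ⊕ Fin n → ℝ)) (𝓘(ℝ, E).prod 𝓘(ℝ, Fin n → ℝ)) ∞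
      (fun m : M × (Fin n ⊕ Fin n → ℝ) => (m.1, fun I => m.2 (Sum.inr I))) := by
    have h1 : ContMDiff 𝓘(ℝ, Fin n ⊕ Fin n → ℝ) 𝓘(ℝ, Fin n → ℝ) ∞
        (fun w : Fin n ⊕ Fin n → ℝ => fun I => w (Sum.inr I)) := by
      refine ContDiff.contMDiff ?_
      fun_prop
    exact contMDiff_fst.prodMk (h1.comp contMDiff_snd)
  have h2 : ContMDiffAt 𝓘(ℝ, F) 𝓘(ℝ, E') ∞ (fun y => P.coord α (hl.localInverse y).1
      (fun I => (hl.localInverse y).2 (Sum.inr I))) (Φ α x w) := by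
    have h3 := ContMDiffAt.comp (Φ α x w) (hrest (hl.localInverse (Φ α x w))) hloc
    refine ContMDiffAt.comp (g := fun m : M × (Fin n → ℝ) => P.coord α m.1 m.2) (Φ α x w) ?_ h3
    rw [Function.comp_apply, hlocx]
    exact P.contMDiffAt_coord hα _
  refine h2.congr_of_eventuallyEq ?_
  have h4 : ∀ᶠ y in 𝓝 (Φ α x w), (hl.localInverse y).1 ∈ P.U α := by
    refine (continuous_fst.continuousAt.comp hloc.continuousAt).preimage_mem_nhds ?_
    rw [Function.comp_apply, hlocx]
    exact (P.isOpen_U α).mem_nhds hα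
  filter_upwards [h4, hl.localInverse_eventuallyEq_right] with y hy1 hy2
  have h5 : Φ α (hl.localInverse y).1 (hl.localInverse y).2 = y := hy2
  rw [← hqΦ α _ hy1, h5]

omit hglue in
/-- The form `dw_i + a` in the `α`-th chart, where `a` is the `i`-th local connection form. -/
lemma smoothOneFormOn_chartForm [IsManifold 𝓘(ℝ, E) ∞ M] [IsManifold 𝓘(ℝ, F) ∞ Y] (α : ι)
    (i : Fin n ⊕ Fin n) :
    SmoothOneFormOn (coordForm (hY.chart α) (P.isOpen_U α) i (R.potential α i)) (p ⁻¹' P.U α) :=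
  smoothOneFormOn_coordForm (hY.chart α) (P.isOpen_U α) i (R.smooth_potential α i)

lemma chartForm_gluing {α β : ι} {y : Y} (hy : p y ∈ P.U α ∩ P.U β) (i : Fin n ⊕ Fin n) :
    formAt (coordForm (hY.chart α) (P.isOpen_U α) i (R.potential α i)) y =
      ∑ j, (R.G α β i j : ℝ) •
        formAt (coordForm (hY.chart β) (P.isOpen_U β) j (R.potential β j)) y :=
  coordForm_gluing (hY.chart α) (P.isOpen_U α) (hY.chart β) (P.isOpen_U β) hy
    ((R.contMDiffAt_trans hy).mdifferentiableAt (by simp)) (hglue α β)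
    (fun i v => R.potential_gluing hy i v) i

/-- The forms `Θ̃_α - B_{0α} Θ_α` agree on overlaps and define global forms. -/
lemma exists_global_form [IsManifold 𝓘(ℝ, E) ∞ M] [IsManifold 𝓘(ℝ, F) ∞ Y] (I : Fin n) :
    ∃ η : OneForm F Y, SmoothOneFormOn η univ ∧ ∀ α, ∀ y ∈ p ⁻¹' P.U α,
      formAt η y = formAt (coordForm (hY.chart α) (P.isOpen_U α) (Sum.inl I)
          (R.potential α (Sum.inl I))) y
        - ∑ J, R.B₀ α (p y) I J • formAt (coordForm (hY.chart α) (P.isOpen_U α) (Sum.inr J)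
          (R.potential α (Sum.inr J))) y := by
  set Ξ : ι → Fin n ⊕ Fin n → OneForm F Y := fun α i =>
    coordForm (hY.chart α) (P.isOpen_U α) i (R.potential α i) with hΞ
  let loc : ι → OneForm F Y := fun α => lincomb
    (fun (j : Fin n ⊕ Fin n) y => Sum.elim (fun K => if K = I then 1 else 0)
      (fun J => -R.B₀ α (p y) I J) j) (Ξ α)
  have hloc : ∀ α y, formAt (loc α) y = formAt (Ξ α (Sum.inl I)) y
      - ∑ J, R.B₀ α (p y) I J • formAt (Ξ α (Sum.inr J)) y := by
    intro α y
    refine (formAt_lincomb _ _ y).trans ?_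
    rw [Fintype.sum_sum_type]
    simp [sub_eq_add_neg]
    rw [← Finset.sum_neg_distrib]
    exact Finset.sum_congr rfl fun J _ => ContinuousLinearMap.ext fun v => neg_mul _ _
  have hsm : ∀ α, SmoothOneFormOn (loc α) (p ⁻¹' P.U α) := by
    intro α
    refine SmoothOneFormOn.lincomb ((P.isOpen_U α).preimage hY.smooth_proj.continuous)
      (fun j => ?_) (fun j => smoothOneFormOn_chartForm hY α j)
    rcases j with K | J
    · exact contMDiffOn_const
    · have h1 : ContMDiffOn 𝓘(ℝ, F) 𝓘(ℝ, ℝ) ∞ (fun y => R.B₀ α (p y) I J) (p ⁻¹' P.U α) :=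
        (R.smooth_B₀ α I J).comp hY.smooth_proj.contMDiffOn (subset_refl _)
      exact h1.neg
  have hagree : ∀ α β, ∀ y, p y ∈ P.U α ∩ P.U β → formAt (loc α) y = formAt (loc β) y := by
    intro α β y hy
    have hg := chartForm_gluing hY hglue hy
    refine ContinuousLinearMap.ext fun v => ?_
    have h1 : ∀ i, formAt (Ξ α i) y v = ∑ j, (R.G α β i j : ℝ) * formAt (Ξ β j) y v := by
      intro i
      rw [hΞ, hg i, _root_.sum_apply]
      rfl
    have hm : ∀ J, R.B₀ α (p y) I J - R.B₀ β (p y) I J = R.m α β I J := fun J =>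
      congrFun (congrFun (R.gluing_B₀ α β (p y) hy) I) J
    rw [hloc, hloc]
    simp only [_root_.sub_apply, _root_.sum_apply, _root_.smul_apply, smul_eq_mul, h1,
      R.sum_G_inl α β I fun j => formAt (Ξ β j) y v,
      R.sum_G_inr α β _ fun j => formAt (Ξ β j) y v]
    have h2 : ∀ J, R.B₀ α (p y) I J = R.B₀ β (p y) I J + R.m α β I J := fun J => by
      rw [← hm J]; ring
    simp only [h2, add_mul, Finset.sum_add_distrib]
    ring
  have hidx : ∀ y : Y, ∃ α, p y ∈ P.U α := fun y => by
    have hy : p y ∈ ⋃ α, P.U α := by rw [P.cover]; trivial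
    exact mem_iUnion.1 hy
  choose a ha using hidx
  have hglob : ∀ α, ∀ y ∈ p ⁻¹' P.U α, formAt (fun y => loc (a y) y) y = formAt (loc α) y :=
    fun α y hy => hagree (a y) α y ⟨ha y, hy⟩
  refine ⟨fun y => loc (a y) y, fun y _ => ?_, fun α y hy => (hglob α y hy).trans (hloc α y)⟩
  exact (hsm (a y)).congr ((P.isOpen_U (a y)).preimage hY.smooth_proj.continuous)
    (hglob (a y)) y (ha y)

end TotalSpace

end TorusGerbe

end

theorem mainTheorem2
    {E : Type*} [NormedAddCommGroup E] [NormedSpace ℝ E] [FiniteDimensional ℝ E]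
    {M : Type u} [TopologicalSpace M] [ChartedSpace E M] [IsManifold 𝓘(ℝ, E) ∞ M]
    [T2Space M] [SecondCountableTopology M]
    {E' : Type*} [NormedAddCommGroup E'] [NormedSpace ℝ E'] [FiniteDimensional ℝ E']
    {X : Type*} [TopologicalSpace X] [ChartedSpace E' X] [IsManifold 𝓘(ℝ, E') ∞ X]
    {n : ℕ} [AddAction (Fin n → UnitAddCircle) X] {ι : Type*}
    (P : TorusGerbe.PrincipalTorusBundle n E M E' X ι)
    (hU : ∀ α β, (P.U α ∩ P.U β).Nonempty → SimplyConnectedSpace ↥(P.U α ∩ P.U β))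
    (Θ : TorusGerbe.TorusConnection P)
    (𝒢 : TorusGerbe.GerbeWithConnection.{w} (E := E') P.patch)
    (h𝒢 : TorusGerbe.IsTorusInvariant P 𝒢) :
    ∃ (R : TorusGerbe.Reduction P Θ 𝒢)
      (Y : Type u) (_ : TopologicalSpace Y) (_ : ChartedSpace (E × (Fin n ⊕ Fin n → ℝ)) Y)
      (_ : IsManifold 𝓘(ℝ, E × (Fin n ⊕ Fin n → ℝ)) ∞ Y) (_ : T2Space Y)
      (_ : SecondCountableTopology Y)
      (p : Y → M) (q : Y → X) (Φ : ι → M → (Fin n ⊕ Fin n → ℝ) → Y)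
      (Ξ : ι → Fin n ⊕ Fin n → TorusGerbe.OneForm (E × (Fin n ⊕ Fin n → ℝ)) Y)
      (Θs : Fin n → TorusGerbe.OneForm (E × (Fin n ⊕ Fin n → ℝ)) Y),
      -- `Y` is an affine torus bundle over `M` with linear parts `(1, m; 0, 1)`
      TorusGerbe.IsAffineTorusBundle (E := E) (F := E × (Fin n ⊕ Fin n → ℝ)) p P.U Φ R.G ∧
      -- `Y` lies over `X`, and the second half of its fibre coordinates is that of `X`
      ContMDiff 𝓘(ℝ, E × (Fin n ⊕ Fin n → ℝ)) 𝓘(ℝ, E') ∞ q ∧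
      (∀ α, ∀ x ∈ P.U α, ∀ w, q (Φ α x w) = P.coord α x (fun I => w (Sum.inr I))) ∧
      -- gluing of the coordinates `(θ̃, θ)`, modulo integers
      (∀ α β, ∀ x ∈ P.U α ∩ P.U β, ∀ wα wβ : Fin n ⊕ Fin n → ℝ,
        Φ α x wα = Φ β x wβ ↔
          TorusGerbe.EqModInt (wα + (1 / 2 : ℝ) • R.shift α β x)
            ((R.G α β).map (Int.cast : ℤ → ℝ) *ᵥ (wβ + (1 / 2 : ℝ) • R.shift β α x))) ∧
      -- the affine connection `(dθ̃_α + B_{1α}, dθ_α + A_α)` and its gluing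
      (∀ α i, TorusGerbe.SmoothOneFormOn (Ξ α i) (p ⁻¹' P.U α)) ∧
      (∀ α i, TorusGerbe.IsLocallyCoordPlus (P.U α) (Φ α) i (R.potential α i) (Ξ α i)) ∧
      (∀ α β, ∀ y ∈ p ⁻¹' (P.U α ∩ P.U β), ∀ i,
        Ξ α i y = ∑ j, (R.G α β i j : ℝ) • Ξ β j y) ∧
      -- the global form `Θ_# = Θ̃ - B₀ Θ`
      (∀ I, TorusGerbe.SmoothOneFormOn (Θs I) univ) ∧
      (∀ α, ∀ y ∈ p ⁻¹' P.U α, ∀ I,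
        Θs I y = Ξ α (Sum.inl I) y - ∑ J, R.B₀ α (p y) I J • Ξ α (Sum.inr J) y) := by
  obtain ⟨R, hB, hh⟩ := TorusGerbe.exists_reduction Θ h𝒢 hU
  let C := R.cocycle h𝒢 hB hh
  have hY : TorusGerbe.IsAffineTorusBundle (E := E) (F := E × (Fin n ⊕ Fin n → ℝ))
      C.proj P.U C.point R.G := C.isAffineTorusBundle R.isUnit_G
  have hglue : ∀ α β, ∀ x ∈ P.U α ∩ P.U β, ∀ w,
      C.point β x w = C.point α x ((R.G α β).map (Int.cast : ℤ → ℝ) *ᵥ w + R.trans α β x) :=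
    fun α β x hx w => C.point_eq_point hx w
  obtain ⟨q, hq, hqΦ⟩ := TorusGerbe.exists_map_to_X hY hglue
  choose Θs hΘs hΘsα using TorusGerbe.exists_global_form hY hglue
  exact ⟨R, C.Total, inferInstance, C.chartedSpace, C.isManifold, C.t2Space,
    C.secondCountableTopology, C.proj, q, C.point,
    fun α i => TorusGerbe.coordForm (hY.chart α) (P.isOpen_U α) i (R.potential α i), Θs,
    hY, hq, hqΦ,
    fun α β x hx wα wβ => TorusGerbe.chart_eq_chart_iff hY hglue hx wα wβ,
    fun α i => TorusGerbe.smoothOneFormOn_chartForm hY α i,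
    fun α i => TorusGerbe.isLocallyCoordPlus_coordForm (hY.chart α) (P.isOpen_U α) i
      (R.potential α i),
    fun α β y hy i => TorusGerbe.chartForm_gluing hY hglue hy i,
    hΘs, fun α y hy I => hΘsα I α y hy⟩
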